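/- Let $(M,g)$ be a complete connected smooth Riemannian manifold without boundary, of dimension at least $2$, with all sectional curvatures $\ge 1$, and let $d$ be its Riemannian distance. Let $D\subset M$ be a closed set with nonempty topological boundary $\partial D$ that is convex, i.e. any two points of $D$ are joined by a minimal geodesic (a geodesic whose length is the distance between its endpoints) contained in $D$. Set $$f(x)=e^{\pi/2-d(x,\partial D)} .$$ Then: 1. $f$ is continuous, and it is strictly convex on the interior of $D$: for every nonconstant geodesic segment $\gamma:[a,b]\to M$ contained in $D\setminus\partial D$, the function $f\circ\gamma$ is strictly convex on $[a,b]$. 2. For every $x\in D\setminus\partial D$, with $\ell=d(x,\partial D)$, one has $\ell>0$ and $f$ is $\min(1,\ell)$-convex at $x$ in the support-function sense: for every $\eta$ with $0<\eta<\min(1,\ell)$ there are an open neighbourhood $U$ of $x$ and a smooth function $h:U\to\mathbb{R}$ with $h\le f$ on $U$, $h(x)=f(x)$, and $D^2h(v,v)\ge\eta\|v\|^2$ for all $v\in T_xM$, where $D^2h$ is the Riemannian Hessian. -/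

import Mathlib

open Set Filter Topology Bundle
open scoped Manifold ContDiff

noncomputable section

namespace RiemConvex

variable {E : Type*} [NormedAddCommGroup E] [NormedSpace ℝ E]
  {M : Type*} [MetricSpace M] [ChartedSpace E M]
  [RiemannianBundle (fun x : M ↦ TangentSpace 𝓘(ℝ, E) x)]

/-- The Riemannian metric read in the chart `φ` centred at `x₀`: the inner product at `φ⁻¹ y` of
`dφ⁻¹_y u` and `dφ⁻¹_y v`. -/
def chartMetric (x₀ : M) (y u v : E) : ℝ :=
  inner ℝ
    (mfderiv 𝓘(ℝ, E) 𝓘(ℝ, E) (extChartAt 𝓘(ℝ, E) x₀).symm y u :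
      TangentSpace 𝓘(ℝ, E) ((extChartAt 𝓘(ℝ, E) x₀).symm y))
    (mfderiv 𝓘(ℝ, E) 𝓘(ℝ, E) (extChartAt 𝓘(ℝ, E) x₀).symm y v)

/-- Christoffel symbols of the first kind in the chart centred at `x₀`:
`½ (∂_u g(v, w) + ∂_v g(u, w) - ∂_w g(u, v))`. -/
def christoffelFirst (x₀ : M) (y u v w : E) : ℝ :=
  (fderiv ℝ (fun z ↦ chartMetric x₀ z v w) y u
    + fderiv ℝ (fun z ↦ chartMetric x₀ z u w) y v
    - fderiv ℝ (fun z ↦ chartMetric x₀ z u v) y w) / 2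

/-- The Gram matrix `g_ij` of the metric in the chart centred at `x₀`, with respect to a fixed basis
of the model space. -/
def gram [FiniteDimensional ℝ E] (x₀ : M) (y : E) :
    Matrix (Fin (Module.finrank ℝ E)) (Fin (Module.finrank ℝ E)) ℝ :=
  Matrix.of fun i j ↦ chartMetric x₀ y (Module.finBasis ℝ E i) (Module.finBasis ℝ E j)

/-- Christoffel symbols `Γ(u, v)` of the Levi-Civita connection in the chart centred at `x₀`, with
the index raised by the inverse Gram matrix: the vector with `g(Γ(u, v), w)` equal to
`christoffelFirst x₀ y u v w` for all `w`. -/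
def christoffel [FiniteDimensional ℝ E] (x₀ : M) (y u v : E) : E :=
  ∑ k, (∑ l, (gram x₀ y)⁻¹ k l * christoffelFirst x₀ y u v (Module.finBasis ℝ E l)) •
    Module.finBasis ℝ E k

/-- The curvature tensor `R(u, v) w = ∇_u ∇_v w - ∇_v ∇_u w` (constant coordinate fields) in the
chart centred at `x₀`. -/
def chartCurvature [FiniteDimensional ℝ E] (x₀ : M) (y u v w : E) : E :=
  fderiv ℝ (fun z ↦ christoffel x₀ z v w) y u - fderiv ℝ (fun z ↦ christoffel x₀ z u w) y v
    + christoffel x₀ y u (christoffel x₀ y v w) - christoffel x₀ y v (christoffel x₀ y u w)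

/-- Coordinates of a tangent vector at `p` in the chart centred at `p`. -/
def coords (p : M) (v : TangentSpace 𝓘(ℝ, E) p) : E :=
  mfderiv 𝓘(ℝ, E) 𝓘(ℝ, E) (extChartAt 𝓘(ℝ, E) p) p v

/-- The sectional curvature of the plane spanned by the (linearly independent) tangent vectors
`u`, `v` at `p`: `⟨R(u, v) v, u⟩ / (|u|² |v|² - ⟨u, v⟩²)`. -/
def sectionalCurvature [FiniteDimensional ℝ E] (p : M) (u v : TangentSpace 𝓘(ℝ, E) p) : ℝ :=
  chartMetric p (extChartAt 𝓘(ℝ, E) p p)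
      (chartCurvature p (extChartAt 𝓘(ℝ, E) p p) (coords p u) (coords p v) (coords p v))
      (coords p u)
    / (‖u‖ ^ 2 * ‖v‖ ^ 2 - (inner ℝ u v) ^ 2)

variable (E M) in
/-- All sectional curvatures of `M` are at least `κ`. -/
def SecGE [FiniteDimensional ℝ E] (κ : ℝ) : Prop :=
  ∀ (p : M) (u v : TangentSpace 𝓘(ℝ, E) p), LinearIndependent ℝ ![u, v] →
    κ ≤ sectionalCurvature p u v

/-- The Riemannian Hessian `D²h(v, w)` at `p` (for `h` smooth near `p`):
`∂_v ∂_w h - dh(Γ(v, w))` in the chart centred at `p`. -/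
def hessian [FiniteDimensional ℝ E] (h : M → ℝ) (p : M) (v w : TangentSpace 𝓘(ℝ, E) p) : ℝ :=
  fderiv ℝ (fun z ↦ fderiv ℝ (h ∘ (extChartAt 𝓘(ℝ, E) p).symm) z (coords p w))
      (extChartAt 𝓘(ℝ, E) p p) (coords p v)
    - fderiv ℝ (h ∘ (extChartAt 𝓘(ℝ, E) p).symm) (extChartAt 𝓘(ℝ, E) p p)
        (christoffel p (extChartAt 𝓘(ℝ, E) p p) (coords p v) (coords p w))

variable (E) in
/-- `γ` is a geodesic on `s`: it is smooth, and at each time `t ∈ s` the curve `c = φ ∘ γ`, with `φ`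
the chart centred at `γ t`, satisfies the geodesic equation `c'' + Γ(c', c') = 0`. -/
def IsGeodesicOn [FiniteDimensional ℝ E] (γ : ℝ → M) (s : Set ℝ) : Prop :=
  ∀ t ∈ s, ContMDiffAt 𝓘(ℝ, ℝ) 𝓘(ℝ, E) ∞ γ t ∧
    deriv (deriv (extChartAt 𝓘(ℝ, E) (γ t) ∘ γ)) t
      + christoffel (γ t) (extChartAt 𝓘(ℝ, E) (γ t) (γ t))
          (deriv (extChartAt 𝓘(ℝ, E) (γ t) ∘ γ) t)
          (deriv (extChartAt 𝓘(ℝ, E) (γ t) ∘ γ) t) = 0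

variable (E) in
/-- `γ : [0, 1] → M` is a minimal geodesic from `x` to `y`: a geodesic whose length is the
distance between its endpoints. -/
def IsMinimalGeodesic [FiniteDimensional ℝ E] (γ : ℝ → M) (x y : M) : Prop :=
  IsGeodesicOn E γ (Icc 0 1) ∧ γ 0 = x ∧ γ 1 = y ∧
    Manifold.pathELength 𝓘(ℝ, E) γ 0 1 = edist x y

variable (E) in
/-- A set is convex if any two of its points are joined by a minimal geodesic contained in it. -/
def GeodConvex [FiniteDimensional ℝ E] (D : Set M) : Prop :=
  ∀ x ∈ D, ∀ y ∈ D, ∃ γ : ℝ → M, IsMinimalGeodesic E γ x y ∧ ∀ t ∈ Icc (0 : ℝ) 1, γ t ∈ D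

variable (E) in
/-- `f` is strictly convex on `U`: its restriction to every nonconstant geodesic segment contained
in `U` is strictly convex. -/
def StrictGeodConvexOn [FiniteDimensional ℝ E] (U : Set M) (f : M → ℝ) : Prop :=
  ∀ (γ : ℝ → M) (a b : ℝ), a < b → IsGeodesicOn E γ (Icc a b) →
    (∀ t ∈ Icc a b, γ t ∈ U) → (∃ t ∈ Icc a b, γ t ≠ γ a) →
    StrictConvexOn ℝ (Icc a b) (f ∘ γ)

variable (E) in
/-- `h` is an `η`-supporting function of `f` at `p`, defined on the open neighbourhood `U` of `p`
(only the values of `h` on `U` matter). -/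
structure IsSupportingAt [FiniteDimensional ℝ E] (f : M → ℝ) (η : ℝ) (p : M)
    (U : Set M) (h : M → ℝ) : Prop where
  isOpen : IsOpen U
  mem : p ∈ U
  smooth : ContMDiffOn 𝓘(ℝ, E) 𝓘(ℝ, ℝ) ∞ h U
  le : ∀ x ∈ U, h x ≤ f x
  eq : h p = f p
  hess : ∀ v : TangentSpace 𝓘(ℝ, E) p, η * ‖v‖ ^ 2 ≤ hessian h p v v

variable (E) in
/-- `f` is `ε`-convex at `p` in the support-function sense: `ε > 0`, and for each `0 < η < ε` there
is an `η`-supporting function of `f` at `p`. -/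
def EpsConvexAt [FiniteDimensional ℝ E] (f : M → ℝ) (ε : ℝ) (p : M) : Prop :=
  0 < ε ∧ ∀ η : ℝ, 0 < η → η < ε → ∃ (U : Set M) (h : M → ℝ), IsSupportingAt E f η p U h

end RiemConvex

end

/-!
Let `x` be interior to `D` and `ℓ` its distance to the boundary. The distance to the boundary is
bounded from above near `x`, to second order, by a smooth function whose Hessian at `x` is at most
`-ℓ` on vectors orthogonal to a shortest geodesic from the boundary, up to an arbitrarily small
error. The exponential of minus this function supports `f` from below. Its Hessian is `exp (π/2 -
ℓ)` times the form `a² + ℓ |b|²`, up to a small error, with `a` the component of a vector along the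
shortest geodesic and `b` the orthogonal one. Since also `ℓ ≤ π/2`, this is at least `min 1 ℓ`
times the square of the norm (`GeodConvex.epsConvexAt`). A continuous function with support
functions of positive Hessian is strictly convex along nonconstant geodesics
(`strictGeodConvexOn_of_epsConvexAt`).

The upper bound for the distance is a second variation argument. Bounded closed parts of `D` are
compact (`GeodConvex.isCompact_inter_closedBall`), so that `x` has a nearest boundary point `q`,
and `q` is joined to `x` by a minimal geodesic `γ` on `[0, 1]`, of speed `ℓ`. Convexity of `D`
provides a supporting half space at `q`, up to an error of order greater than two
(`GeodConvex.exists_support`), and its normal is tangent to `γ`. Hence the distance `ρ` to the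
complement of `D`, at points reached from `q` orthogonally to `γ` by `w`, is `o(|w|²)`
(`GeodConvex.infDist_quadExp_le`). Now `γ` is varied by a normal field of the form `φ` times a
parallel field `w`. As the curvatures are at least `1`, the second variation formula gives `ρ ≤ ℓ t
+ c(t) |w|² + o(|w|²)` along the variation, for every `c` with `c(0) = 0` and `c' > (φ'² - ℓ² φ²) /
(2 ℓ)` (`CurveBound.of_zero`). With `φ = cos (π t / 2)`, which vanishes at the endpoint, a length
`ℓ > π/2` would give `c(1) < 0` and so `ρ x < ℓ`, a contradiction (`IsNormalRay.le_pi_div_two`);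
this uses that the dimension is at least two. With `φ = 1`, one can take `c(1)` close to `-ℓ/2`,
and by shortening or prolonging the varied curves one reaches all points near `x`
(`IsNormalRay.eventually_infDist_le`).

Only expansions of order two are needed, so the exponential map is replaced by its second order
expansion `quadExp` in a chart, which is independent of the chart up to `o(|w|²)`
(`IsLocalIsometryOn.quadExp_isLittleO`). Likewise the parallel field is replaced by
`normalTransport`, which is parallel to first order at one time only. This suffices because the
bound is transported over short time intervals, with a loss that is small relative to their length:
if `c'` exceeds the second variation strictly, the estimate holds for all steps within some
neighbourhood of each time (`CurveBound.exists_step`), and real induction carries it along `[0,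
1]`. In this way no existence theorem for geodesics, Jacobi fields or parallel transport is used:
the only geodesics in the argument are those that convexity of `D` provides.
-/

noncomputable section

set_option maxSynthPendingDepth 3
set_option linter.unusedSectionVars false

namespace RiemConvex

/-! ### Metrics and connections in coordinates -/

section LocalGeometry

variable {E : Type*} [NormedAddCommGroup E] [NormedSpace ℝ E]

/-- A Riemannian metric `G` on an open subset `U` of a vector space, together with its Levi-Civita
connection `Γ` (the Christoffel symbols, as a bilinear map): `Γ` is symmetric and compatible with
the metric. -/
structure IsLeviCivitaOn (G : E → E →L[ℝ] E →L[ℝ] ℝ) (Γ : E → E →L[ℝ] E →L[ℝ] E) (U : Set E) :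
    Prop where
  isOpen : IsOpen U
  contDiffOn_metric : ContDiffOn ℝ ∞ G U
  contDiffOn_gamma : ContDiffOn ℝ ∞ Γ U
  symm : ∀ y ∈ U, ∀ u v, G y u v = G y v u
  pos : ∀ y ∈ U, ∀ u, u ≠ 0 → 0 < G y u u
  gamma_symm : ∀ y ∈ U, ∀ u v, Γ y u v = Γ y v u
  compat : ∀ y ∈ U, ∀ u v w, fderiv ℝ G y u v w = G y (Γ y u v) w + G y v (Γ y u w)

/-- The Christoffel symbols of the first kind of the metric `G`, as a trilinear map. -/
def firstKind (G : E → E →L[ℝ] E →L[ℝ] ℝ) (y : E) : E →L[ℝ] E →L[ℝ] E →L[ℝ] ℝ :=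
  (2⁻¹ : ℝ) • (fderiv ℝ G y + (fderiv ℝ G y).flip
    - ((ContinuousLinearMap.flipₗᵢ ℝ E E ℝ).toContinuousLinearEquiv.toContinuousLinearMap.comp
        (fderiv ℝ G y).flip))

lemma firstKind_apply (G : E → E →L[ℝ] E →L[ℝ] ℝ) (y u v w : E) :
    firstKind G y u v w
      = (fderiv ℝ G y u v w + fderiv ℝ G y v u w - fderiv ℝ G y w u v) / 2 := by
  simp [firstKind]
  ring

/-- The Christoffel symbols of the second kind of the metric `G`, as a bilinear map: the index is
raised by the inverse of `G y : E →L[ℝ] (E →L[ℝ] ℝ)`, so the value is zero where `G y` is not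
invertible. -/
def gammaOf (G : E → E →L[ℝ] E →L[ℝ] ℝ) (y : E) : E →L[ℝ] E →L[ℝ] E :=
  (ContinuousLinearMap.compL ℝ E (E →L[ℝ] ℝ) E (ContinuousLinearMap.inverse (G y))).comp
    (firstKind G y)

lemma gammaOf_apply (G : E → E →L[ℝ] E →L[ℝ] ℝ) (y u v : E) :
    gammaOf G y u v = ContinuousLinearMap.inverse (G y) (firstKind G y u v) := rfl

variable [FiniteDimensional ℝ E]

/-- A positive definite form on a finite-dimensional space identifies it with its dual. -/
lemma exists_equiv_of_pos (B : E →L[ℝ] E →L[ℝ] ℝ) (h : ∀ u, u ≠ 0 → 0 < B u u) :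
    ∃ e : E ≃L[ℝ] (E →L[ℝ] ℝ), (e : E →L[ℝ] E →L[ℝ] ℝ) = B := by
  have hinj : Function.Injective B := by
    rw [injective_iff_map_eq_zero]
    intro u hu
    by_contra hne
    have := h u hne
    simp [hu] at this
  have hfin : Module.finrank ℝ E = Module.finrank ℝ (E →L[ℝ] ℝ) := by
    rw [← LinearEquiv.finrank_eq (LinearMap.toContinuousLinearMap (𝕜 := ℝ) (E := E) (F' := ℝ))]
    exact Subspace.dual_finrank_eq.symm
  let e := LinearEquiv.ofInjectiveOfFinrankEq (B : E →ₗ[ℝ] (E →L[ℝ] ℝ)) hinj hfin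
  exact ⟨e.toContinuousLinearEquiv, by ext u v; rfl⟩

lemma metric_inverse_apply {B : E →L[ℝ] E →L[ℝ] ℝ} (h : ∀ u, u ≠ 0 → 0 < B u u)
    (φ : E →L[ℝ] ℝ) (w : E) : B (ContinuousLinearMap.inverse B φ) w = φ w := by
  obtain ⟨e, rfl⟩ := exists_equiv_of_pos B h
  simp

/-- Existence of the Levi-Civita connection. -/
lemma isLeviCivitaOn_gammaOf {G : E → E →L[ℝ] E →L[ℝ] ℝ} {U : Set E} (hU : IsOpen U)
    (hG : ContDiffOn ℝ ∞ G U) (hs : ∀ y ∈ U, ∀ u v, G y u v = G y v u)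
    (hpos : ∀ y ∈ U, ∀ u, u ≠ 0 → 0 < G y u u) :
    IsLeviCivitaOn G (gammaOf G) U := by
  have hD : ContDiffOn ℝ ∞ (fderiv ℝ G) U := hG.fderiv_of_isOpen hU (by simp)
  have hdiff : ∀ y ∈ U, DifferentiableAt ℝ G y := fun y hy ↦
    (hG.differentiableOn (by simp)).differentiableAt (hU.mem_nhds hy)
  have hDs : ∀ y ∈ U, ∀ u v w, fderiv ℝ G y u v w = fderiv ℝ G y u w v := by
    intro y hy u v w
    have h1 : HasFDerivAt (fun z ↦ G z v w)
        (((fderiv ℝ G y).flip v).flip w) y :=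
      ((hdiff y hy).hasFDerivAt.clm_apply (hasFDerivAt_const v y)).clm_apply
        (hasFDerivAt_const w y) |>.congr_fderiv (by ext; simp)
    have h2 : HasFDerivAt (fun z ↦ G z w v)
        (((fderiv ℝ G y).flip w).flip v) y :=
      ((hdiff y hy).hasFDerivAt.clm_apply (hasFDerivAt_const w y)).clm_apply
        (hasFDerivAt_const v y) |>.congr_fderiv (by ext; simp)
    have h3 : (fun z ↦ G z v w) =ᶠ[𝓝 y] fun z ↦ G z w v := by
      filter_upwards [hU.mem_nhds hy] with z hz using hs z hz v w
    have := (h2.congr_of_eventuallyEq h3).unique h1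
    have := congrArg (fun f : E →L[ℝ] ℝ ↦ f u) this
    simpa using this.symm
  refine ⟨hU, hG, ?_, hs, hpos, ?_, ?_⟩
  · rw [contDiffOn_clm_apply]
    intro u
    rw [contDiffOn_clm_apply]
    intro v
    simp only [gammaOf_apply]
    refine ContDiffOn.clm_apply ?_ ?_
    · intro y hy
      obtain ⟨e, he⟩ := exists_equiv_of_pos (G y) (hpos y hy)
      have := contDiffAt_map_inverse (𝕜 := ℝ) (n := ∞) e
      rw [he] at this
      exact this.comp_contDiffWithinAt y (hG y hy)
    · rw [contDiffOn_clm_apply]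
      intro w
      simp only [firstKind_apply]
      have hc : ∀ a b c : E, ContDiffOn ℝ ∞ (fun y ↦ fderiv ℝ G y a b c) U := fun a b c ↦
        ((hD.clm_apply contDiffOn_const).clm_apply contDiffOn_const).clm_apply contDiffOn_const
      exact (((hc u v w).add (hc v u w)).sub (hc w u v)).div_const _
  · intro y hy u v
    rw [gammaOf_apply, gammaOf_apply]
    congr 1
    ext w
    rw [firstKind_apply, firstKind_apply, hDs y hy w u v]
    ring
  · intro y hy u v w
    rw [hs y hy v, gammaOf_apply, gammaOf_apply, metric_inverse_apply (hpos y hy),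
      metric_inverse_apply (hpos y hy), firstKind_apply, firstKind_apply, hDs y hy u w v,
      hDs y hy v u w, hDs y hy w u v]
    ring

omit [FiniteDimensional ℝ E] in
/-- The Koszul formula, which determines the connection. -/
lemma IsLeviCivitaOn.metric_gamma {G : E → E →L[ℝ] E →L[ℝ] ℝ} {Γ : E → E →L[ℝ] E →L[ℝ] E}
    {U : Set E} (h : IsLeviCivitaOn G Γ U) {y : E} (hy : y ∈ U) (u v w : E) :
    G y (Γ y u v) w = firstKind G y u v w := by
  rw [firstKind_apply, h.compat y hy, h.compat y hy, h.compat y hy, h.gamma_symm y hy v u,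
    h.gamma_symm y hy w u, h.gamma_symm y hy w v, h.symm y hy u, h.symm y hy v,
    h.symm y hy (Γ y u w) v]
  ring

omit [FiniteDimensional ℝ E] in
lemma IsLeviCivitaOn.nonneg {G : E → E →L[ℝ] E →L[ℝ] ℝ} {Γ : E → E →L[ℝ] E →L[ℝ] E}
    {U : Set E} (h : IsLeviCivitaOn G Γ U) {y : E} (hy : y ∈ U) (v : E) :
    0 ≤ G y v v := by
  rcases eq_or_ne v 0 with hv | hv
  · simp [hv]
  · exact (h.pos y hy _ hv).le

lemma IsLeviCivitaOn.eq_of_metric_eq {G : E → E →L[ℝ] E →L[ℝ] ℝ} {Γ : E → E →L[ℝ] E →L[ℝ] E}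
    {U : Set E} (h : IsLeviCivitaOn G Γ U) {y : E} (hy : y ∈ U) {u v : E}
    (huv : ∀ w, G y u w = G y v w) : u = v := by
  by_contra hne
  have := h.pos y hy (u - v) (sub_ne_zero.mpr hne)
  simp [huv] at this

end LocalGeometry

section ChartGeometry

variable {E : Type*} [NormedAddCommGroup E] [NormedSpace ℝ E] [FiniteDimensional ℝ E]
  {M : Type*} [MetricSpace M] [ChartedSpace E M]
  [RiemannianBundle (fun x : M ↦ TangentSpace 𝓘(ℝ, E) x)]

/-- The metric in the chart centred at `p`, as a continuous bilinear form. -/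
def chartG (p : M) (y : E) : E →L[ℝ] E →L[ℝ] ℝ :=
  (LinearMap.mk₂ ℝ (fun u v : E ↦ chartMetric p y u v)
    (fun u u' v ↦ by
      simp only [chartMetric]
      erw [map_add, inner_add_left])
    (fun c u v ↦ by
      simp only [chartMetric]
      erw [map_smul, inner_smul_left]; rfl)
    (fun u v v' ↦ by
      simp only [chartMetric]
      erw [map_add, inner_add_right])
    (fun c u v ↦ by
      simp only [chartMetric]
      erw [map_smul, inner_smul_right]; rfl)).toContinuousBilinearMap

lemma chartG_apply (p : M) (y u v : E) : chartG p y u v = chartMetric p y u v := rfl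

/-- The Levi-Civita connection in the chart centred at `p`, as a continuous bilinear map. It agrees
with `christoffel` on the target of the chart, see `christoffel_eq`. -/
def chartΓ (p : M) : E → E →L[ℝ] E →L[ℝ] E := gammaOf (chartG p)

variable [IsManifold 𝓘(ℝ, E) ∞ M]

lemma isOpen_chart_target (p : M) : IsOpen (extChartAt 𝓘(ℝ, E) p).target :=
  isOpen_extChartAt_target p

lemma mdifferentiableAt_chart_symm (p : M) {y : E} (hy : y ∈ (extChartAt 𝓘(ℝ, E) p).target) :
    MDifferentiableAt 𝓘(ℝ, E) 𝓘(ℝ, E) (extChartAt 𝓘(ℝ, E) p).symm y := by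
  have := mdifferentiableWithinAt_extChartAt_symm (I := 𝓘(ℝ, E)) hy
  rwa [modelWithCornersSelf_coe, range_id, mdifferentiableWithinAt_univ] at this

lemma mfderiv_chart_symm_injective (p : M) {y : E} (hy : y ∈ (extChartAt 𝓘(ℝ, E) p).target)
    {u : E} (hu : mfderiv 𝓘(ℝ, E) 𝓘(ℝ, E) (extChartAt 𝓘(ℝ, E) p).symm y u = 0) : u = 0 := by
  have h := mfderiv_extChartAt_comp_mfderivWithin_extChartAt_symm (I := 𝓘(ℝ, E)) hy
  rw [modelWithCornersSelf_coe, range_id, mfderivWithin_univ] at h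
  have h2 := congrArg (fun f : E →L[ℝ] E ↦ f u) h
  have h3 : (mfderiv 𝓘(ℝ, E) 𝓘(ℝ, E) (extChartAt 𝓘(ℝ, E) p) ((extChartAt 𝓘(ℝ, E) p).symm y))
      (mfderiv 𝓘(ℝ, E) 𝓘(ℝ, E) (extChartAt 𝓘(ℝ, E) p).symm y u) = u := h2
  rw [hu] at h3
  exact h3.symm.trans (map_zero _)

variable [IsContMDiffRiemannianBundle 𝓘(ℝ, E) ∞ E (fun x : M ↦ TangentSpace 𝓘(ℝ, E) x)]

lemma contDiffOn_chartMetric (p : M) (u v : E) :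
    ContDiffOn ℝ ∞ (fun y ↦ chartMetric p y u v) (extChartAt 𝓘(ℝ, E) p).target := by
  rw [← contMDiffOn_iff_contDiffOn]
  have key : ∀ u : E, ContMDiffOn 𝓘(ℝ, E) (𝓘(ℝ, E).prod 𝓘(ℝ, E)) ∞
      (fun y ↦ (TotalSpace.mk' E ((extChartAt 𝓘(ℝ, E) p).symm y)
        (mfderiv 𝓘(ℝ, E) 𝓘(ℝ, E) (extChartAt 𝓘(ℝ, E) p).symm y u) :
          TotalSpace E (fun x : M ↦ TangentSpace 𝓘(ℝ, E) x)))
      (extChartAt 𝓘(ℝ, E) p).target := by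
    intro u
    have h1 := (contMDiffOn_extChartAt_symm (I := 𝓘(ℝ, E)) (n := ∞) p).contMDiffOn_tangentMapWithin
      (m := ∞) (by simp) (isOpen_chart_target p).uniqueMDiffOn
    have h2 : ContMDiff 𝓘(ℝ, E) (𝓘(ℝ, E).prod 𝓘(ℝ, E)) ∞
        (fun y : E ↦ (TotalSpace.mk' E y u : TangentBundle 𝓘(ℝ, E) E)) := by
      intro y
      rw [contMDiffAt_totalSpace]
      refine ⟨contMDiffAt_id, ?_⟩
      simpa using! contMDiffAt_const
    have h3 := h1.comp h2.contMDiffOn (s := (extChartAt 𝓘(ℝ, E) p).target) (fun y hy ↦ hy)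
    refine h3.congr fun y hy ↦ ?_
    simp only [tangentMapWithin, Function.comp_apply]
    rw [mfderivWithin_of_mem_nhds ((isOpen_chart_target p).mem_nhds hy)]
  exact ContMDiffOn.inner_bundle (IB := 𝓘(ℝ, E)) (F := E) (B := M)
    (E := fun x : M ↦ TangentSpace 𝓘(ℝ, E) x) (key u) (key v)

lemma isLeviCivitaOn_chart (p : M) :
    IsLeviCivitaOn (chartG p) (chartΓ p) (extChartAt 𝓘(ℝ, E) p).target := by
  refine isLeviCivitaOn_gammaOf (isOpen_chart_target p) ?_ ?_ ?_
  · rw [contDiffOn_clm_apply]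
    intro u
    rw [contDiffOn_clm_apply]
    intro v
    exact contDiffOn_chartMetric p u v
  · intro y _ u v
    exact real_inner_comm (F := TangentSpace 𝓘(ℝ, E) ((extChartAt 𝓘(ℝ, E) p).symm y)) _ _
  · intro y hy u hu
    rw [chartG_apply, chartMetric]
    exact (real_inner_self_pos
      (F := TangentSpace 𝓘(ℝ, E) ((extChartAt 𝓘(ℝ, E) p).symm y))).mpr
      fun h ↦ hu (mfderiv_chart_symm_injective p hy h)

lemma fderiv_chartMetric (p : M) {y : E} (hy : y ∈ (extChartAt 𝓘(ℝ, E) p).target) (u v w : E) :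
    fderiv ℝ (fun z ↦ chartMetric p z v w) y u = fderiv ℝ (chartG p) y u v w := by
  have hd : DifferentiableAt ℝ (chartG p) y :=
    ((isLeviCivitaOn_chart p).contDiffOn_metric.differentiableOn (by simp)).differentiableAt
      ((isOpen_chart_target p).mem_nhds hy)
  have h1 : HasFDerivAt (fun z ↦ chartG p z v w) (((fderiv ℝ (chartG p) y).flip v).flip w) y :=
      (hd.hasFDerivAt.clm_apply (hasFDerivAt_const v y)).clm_apply
        (hasFDerivAt_const w y) |>.congr_fderiv (by ext; simp)
  exact congrArg (fun f : E →L[ℝ] ℝ ↦ f u) h1.fderiv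

lemma gram_isUnit_det (p : M) {y : E} (hy : y ∈ (extChartAt 𝓘(ℝ, E) p).target) :
    IsUnit (gram p y).det := by
  rw [← Matrix.isUnit_iff_isUnit_det, ← Matrix.mulVec_injective_iff_isUnit]
  have : Function.Injective (gram p y).mulVecLin := by
    rw [← LinearMap.ker_eq_bot, LinearMap.ker_eq_bot']
    intro c hc
    by_contra hne
    have h0 : ∑ i, c i • Module.finBasis ℝ E i ≠ 0 := by
      intro h
      exact hne (funext (Fintype.linearIndependent_iff.mp
        (Module.finBasis ℝ E).linearIndependent c h))
    have := (isLeviCivitaOn_chart p).pos y hy _ h0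
    have h2 : chartG p y (∑ i, c i • Module.finBasis ℝ E i) (∑ i, c i • Module.finBasis ℝ E i)
        = ∑ i, c i * (gram p y).mulVecLin c i := by
      simp only [map_sum, map_smul, _root_.sum_apply, _root_.smul_apply,
        Matrix.mulVecLin_apply, Matrix.mulVec, dotProduct, smul_eq_mul, gram, Matrix.of_apply,
        chartG_apply, Finset.mul_sum]
      rw [Finset.sum_comm]
      refine Finset.sum_congr rfl fun i _ ↦ Finset.sum_congr rfl fun j _ ↦ ?_
      ring
    rw [h2, hc] at this
    simp at this
  exact this

lemma christoffel_eq (p : M) {y : E} (hy : y ∈ (extChartAt 𝓘(ℝ, E) p).target) (u v : E) :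
    christoffel p y u v = chartΓ p y u v := by
  have hLC := isLeviCivitaOn_chart (E := E) p
  refine hLC.eq_of_metric_eq hy fun w ↦ ?_
  rw [hLC.metric_gamma hy]
  have hfk : ∀ w, christoffelFirst p y u v w = firstKind (chartG p) y u v w := by
    intro w
    rw [firstKind_apply, christoffelFirst, fderiv_chartMetric p hy, fderiv_chartMetric p hy,
      fderiv_chartMetric p hy]
  have key : ∀ m, chartG p y (christoffel p y u v) (Module.finBasis ℝ E m)
      = firstKind (chartG p) y u v (Module.finBasis ℝ E m) := by
    intro m
    simp only [christoffel, map_sum, map_smul, _root_.sum_apply,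
      _root_.smul_apply, smul_eq_mul, hfk]
    have h1 : ∀ k, chartG p y (Module.finBasis ℝ E k) (Module.finBasis ℝ E m)
        = gram p y m k := fun k ↦ by
      rw [hLC.symm y hy]; rfl
    simp only [h1, Finset.sum_mul]
    rw [Finset.sum_comm]
    have h2 : ∀ l, ∑ k, (gram p y)⁻¹ k l * firstKind (chartG p) y u v (Module.finBasis ℝ E l)
        * gram p y m k = (if m = l then 1 else 0)
          * firstKind (chartG p) y u v (Module.finBasis ℝ E l) := by
      intro l
      have := congrFun (congrFun (Matrix.mul_nonsing_inv _ (gram_isUnit_det p hy)) m) l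
      rw [Matrix.mul_apply, Matrix.one_apply] at this
      rw [← this, Finset.sum_mul]
      exact Finset.sum_congr rfl fun k _ ↦ by ring
    simp [h2]
  have : (chartG p y (christoffel p y u v) : E →ₗ[ℝ] ℝ) = (firstKind (chartG p) y u v) :=
    (Module.finBasis ℝ E).ext key
  exact congrArg (fun f : E →ₗ[ℝ] ℝ ↦ f w) this

/-- The curvature of the connection `Γ`, as `R(u, v) w = ∇_u ∇_v w - ∇_v ∇_u w`. -/
def curvatureOf (Γ : E → E →L[ℝ] E →L[ℝ] E) (y u v w : E) : E :=
  fderiv ℝ Γ y u v w - fderiv ℝ Γ y v u w + Γ y u (Γ y v w) - Γ y v (Γ y u w)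

lemma chartCurvature_eq (p : M) {y : E} (hy : y ∈ (extChartAt 𝓘(ℝ, E) p).target) (u v w : E) :
    chartCurvature p y u v w = curvatureOf (chartΓ p) y u v w := by
  have hd : DifferentiableAt ℝ (chartΓ p) y :=
    ((isLeviCivitaOn_chart p).contDiffOn_gamma.differentiableOn (by simp)).differentiableAt
      ((isOpen_chart_target p).mem_nhds hy)
  have h1 : ∀ v w u : E, fderiv ℝ (fun z ↦ christoffel p z v w) y u
      = fderiv ℝ (chartΓ p) y u v w := by
    intro v w u
    have h1 : HasFDerivAt (fun z ↦ chartΓ p z v w) (((fderiv ℝ (chartΓ p) y).flip v).flip w) y :=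
        (hd.hasFDerivAt.clm_apply (hasFDerivAt_const v y)).clm_apply
          (hasFDerivAt_const w y) |>.congr_fderiv (by ext; simp)
    have h2 : (fun z ↦ christoffel p z v w) =ᶠ[𝓝 y] fun z ↦ chartΓ p z v w := by
      filter_upwards [(isOpen_chart_target p).mem_nhds hy] with z hz using christoffel_eq p hz v w
    rw [h2.fderiv_eq, h1.fderiv]; rfl
  rw [chartCurvature, curvatureOf, h1, h1, christoffel_eq p hy, christoffel_eq p hy,
    christoffel_eq p hy, christoffel_eq p hy]

end ChartGeometry

/-! ### Second order calculus in coordinates -/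

lemma two_le_infty : (2 : ℕ∞ω) ≤ ∞ := WithTop.coe_le_coe.mpr le_top

section LocalCalculus

variable {E : Type*} [NormedAddCommGroup E] [NormedSpace ℝ E]
  {F : Type*} [NormedAddCommGroup F] [NormedSpace ℝ F]

/-- If `f'` is approximated by the bilinear map `L` near `x` up to `ε`, then the second order
expansion of `f` at `x` with quadratic term `½ L(v, v)` has error at most `ε ‖v‖²`. -/
lemma norm_taylor_two_le {f : E → F} {f' : E → E →L[ℝ] F} {x v : E} {L : E →L[ℝ] E →L[ℝ] F} {ε : ℝ}
    (hε : 0 ≤ ε)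
    (hd : ∀ s ∈ Icc (0 : ℝ) 1, HasFDerivAt f (f' (x + s • v)) (x + s • v))
    (hL : ∀ s ∈ Icc (0 : ℝ) 1, ‖f' (x + s • v) - f' x - L (s • v)‖ ≤ ε * ‖s • v‖) :
    ‖f (x + v) - f x - f' x v - (2⁻¹ : ℝ) • L v v‖ ≤ ε * ‖v‖ ^ 2 := by
  have hderiv : ∀ s ∈ Icc (0 : ℝ) 1, HasDerivWithinAt
      (fun s : ℝ ↦ f (x + s • v) - f x - s • f' x v - (s ^ 2 / 2) • L v v)
      (f' (x + s • v) v - f' x v - s • L v v) (Icc 0 1) s := by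
    intro s hs
    have hl : HasDerivAt (fun s : ℝ ↦ x + s • v) v s := by
      simpa using ((hasDerivAt_id s).smul_const v).const_add x
    have hd := (hd s hs).comp_hasDerivAt s hl
    have h2 : HasDerivAt (fun s : ℝ ↦ s • f' x v) (f' x v) s := by
      simpa using (hasDerivAt_id s).smul_const (f' x v)
    have h3 : HasDerivAt (fun s : ℝ ↦ (s ^ 2 / 2) • L v v) (s • L v v) s := by
      have : HasDerivAt (fun s : ℝ ↦ s ^ 2 / 2) s s := by
        simpa using ((hasDerivAt_id s).pow 2).div_const 2
      exact this.smul_const (L v v)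
    exact (((hd.sub_const (f x)).sub h2).sub h3).hasDerivWithinAt
  have hbound : ∀ s ∈ Ico (0 : ℝ) 1, ‖f' (x + s • v) v - f' x v - s • L v v‖ ≤ ε * ‖v‖ ^ 2 := by
    intro s hs
    have h6 := hL s ⟨hs.1, hs.2.le⟩
    have h7 : f' (x + s • v) v - f' x v - s • L v v = (f' (x + s • v) - f' x - L (s • v)) v := by
      simp only [map_smul, _root_.sub_apply, _root_.smul_apply]
    rw [h7]
    have h8 : ‖s • v‖ ≤ ‖v‖ := by
      rw [norm_smul, Real.norm_of_nonneg hs.1]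
      exact mul_le_of_le_one_left (norm_nonneg _) hs.2.le
    calc _ ≤ ‖f' (x + s • v) - f' x - L (s • v)‖ * ‖v‖ :=
          ContinuousLinearMap.le_opNorm _ _
      _ ≤ (ε * ‖v‖) * ‖v‖ :=
          mul_le_mul_of_nonneg_right (h6.trans (mul_le_mul_of_nonneg_left h8 hε)) (norm_nonneg _)
      _ = ε * ‖v‖ ^ 2 := by ring
  have := norm_image_sub_le_of_norm_deriv_le_segment_01' hderiv hbound
  simpa using this

/-- Second order Taylor expansion of a `C²` map, locally uniform in the base point: the second
derivative may be frozen at `x₀`. -/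
lemma exists_taylor_two {f : E → F} {x₀ : E} (hf : ContDiffAt ℝ 2 f x₀) {ε : ℝ} (hε : 0 < ε) :
    ∃ δ > 0, ∀ x v, ‖x - x₀‖ < δ → ‖v‖ < δ →
      ‖f (x + v) - f x - fderiv ℝ f x v - (2⁻¹ : ℝ) • fderiv ℝ (fderiv ℝ f) x₀ v v‖
        ≤ ε * ‖v‖ ^ 2 := by
  have h1 : ContDiffAt ℝ 1 (fderiv ℝ f) x₀ := hf.fderiv_right (by norm_num)
  have h3 := (h1.hasStrictFDerivAt (by norm_num)).isLittleO.def hε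
  have h4 : ∀ᶠ x in 𝓝 x₀, DifferentiableAt ℝ f x :=
    (hf.eventually (by simp)).mono fun x hx ↦ hx.differentiableAt (by norm_num)
  rw [nhds_prod_eq] at h3
  obtain ⟨t, ht, h3t⟩ := mem_prod_self_iff.mp h3
  obtain ⟨r, hr, hball⟩ := Metric.mem_nhds_iff.mp (inter_mem ht h4)
  refine ⟨r / 2, by positivity, fun x v hx hv ↦ ?_⟩
  have hmem : ∀ s ∈ Icc (0 : ℝ) 1, x + s • v ∈ Metric.ball x₀ r := by
    intro s hs
    rw [mem_ball_iff_norm]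
    calc ‖x + s • v - x₀‖ = ‖(x - x₀) + s • v‖ := by congr 1; abel
      _ ≤ ‖x - x₀‖ + ‖s • v‖ := norm_add_le _ _
      _ ≤ ‖x - x₀‖ + 1 * ‖v‖ := by
          rw [norm_smul, Real.norm_of_nonneg hs.1]; gcongr; exact hs.2
      _ < r := by linarith
  have h0 : x ∈ t := by
    have := (hball (hmem 0 (by simp))).1
    simpa using this
  refine norm_taylor_two_le hε.le (fun s hs ↦ (hball (hmem s hs)).2.hasFDerivAt) fun s hs ↦ ?_
  have h5 : (x + s • v, x) ∈ t ×ˢ t := ⟨(hball (hmem s hs)).1, h0⟩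
  have h6 := h3t h5
  rw [mem_ofPred_eq] at h6
  simpa only [add_sub_cancel_left] using h6

/-- The second order approximation `y + w - ½ Γ(w, w)` of the exponential map at `y`. -/
def quadExp (Γ : E → E →L[ℝ] E →L[ℝ] E) (y w : E) : E := y + w - (2⁻¹ : ℝ) • Γ y w w

/-- The second order approximation `z - y + ½ Γ(z - y, z - y)` of the inverse of the exponential
map at `y`. -/
def quadLog (Γ : E → E →L[ℝ] E →L[ℝ] E) (y z : E) : E :=
  z - y + (2⁻¹ : ℝ) • Γ y (z - y) (z - y)

lemma norm_apply_apply_le (B : E →L[ℝ] E →L[ℝ] F) (u v : E) : ‖B u v‖ ≤ ‖B‖ * ‖u‖ * ‖v‖ :=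
  B.le_opNorm₂ u v

/-- `T` is a local isometry between `G` on the open set `V` and `G'` on `U'`. No injectivity is
required. -/
structure IsLocalIsometryOn (G G' : E → E →L[ℝ] E →L[ℝ] ℝ) (T : E → E) (V U' : Set E) : Prop where
  isOpen : IsOpen V
  contDiffOn : ContDiffOn ℝ ∞ T V
  mapsTo : MapsTo T V U'
  metric_eq : ∀ y ∈ V, ∀ u v, G y u v = G' (T y) (fderiv ℝ T y u) (fderiv ℝ T y v)

variable {G G' : E → E →L[ℝ] E →L[ℝ] ℝ} {Γ Γ' : E → E →L[ℝ] E →L[ℝ] E} {U U' V : Set E}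
  {T : E → E}

lemma IsLeviCivitaOn.differentiableAt_metric (h : IsLeviCivitaOn G Γ U) {y : E} (hy : y ∈ U) :
    DifferentiableAt ℝ G y :=
  (h.contDiffOn_metric.differentiableOn (by simp)).differentiableAt (h.isOpen.mem_nhds hy)

lemma IsLeviCivitaOn.contDiffAt_metric (h : IsLeviCivitaOn G Γ U) {y : E} (hy : y ∈ U) :
    ContDiffAt ℝ ∞ G y :=
  h.contDiffOn_metric.contDiffAt (h.isOpen.mem_nhds hy)

lemma IsLeviCivitaOn.contDiffAt_gamma (h : IsLeviCivitaOn G Γ U) {y : E} (hy : y ∈ U) :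
    ContDiffAt ℝ ∞ Γ y :=
  h.contDiffOn_gamma.contDiffAt (h.isOpen.mem_nhds hy)

/-- The transformation law of the Christoffel symbols: both sides satisfy the Koszul formula for
the pulled back metric. -/
lemma IsLocalIsometryOn.gamma_eq [FiniteDimensional ℝ E] (hT : IsLocalIsometryOn G G' T V U')
    (h : IsLeviCivitaOn G Γ U) (h' : IsLeviCivitaOn G' Γ' U') (hVU : V ⊆ U) {y : E} (hy : y ∈ V)
    (u v : E) :
    fderiv ℝ T y (Γ y u v) = fderiv ℝ (fderiv ℝ T) y u v
      + Γ' (T y) (fderiv ℝ T y u) (fderiv ℝ T y v) := by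
  have hTy : ContDiffAt ℝ ∞ T y := hT.contDiffOn.contDiffAt (hT.isOpen.mem_nhds hy)
  have hTd := (hTy.differentiableAt (by simp)).hasFDerivAt
  have hDTd := ((hTy.fderiv_right (m := ∞) (by simp)).differentiableAt (by simp)).hasFDerivAt
  have hsymm : ∀ u v, fderiv ℝ (fderiv ℝ T) y u v = fderiv ℝ (fderiv ℝ T) y v u :=
    fun u v ↦ (hTy.isSymmSndFDerivAt (by simp [two_le_infty])).eq u v
  have hU := hVU hy
  have hU' := hT.mapsTo hy
  set K : E → E → E := fun u v ↦ fderiv ℝ (fderiv ℝ T) y u v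
      + Γ' (T y) (fderiv ℝ T y u) (fderiv ℝ T y v) with hK
  have hKs : ∀ u v, K u v = K v u := fun u v ↦ by
    simp only [hK]; rw [hsymm u v, h'.gamma_symm _ hU']
  have hDG : ∀ u v w, fderiv ℝ G y u v w
      = G' (T y) (K u v) (fderiv ℝ T y w) + G' (T y) (fderiv ℝ T y v) (K u w) := by
    intro u v w
    have e1 : HasFDerivAt (fun z ↦ G z v w) (((fderiv ℝ G y).flip v).flip w) y :=
      ((h.differentiableAt_metric hU).hasFDerivAt.clm_apply (hasFDerivAt_const v y)).clm_apply
        (hasFDerivAt_const w y) |>.congr_fderiv (by ext; simp)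
    have e2 := (((h'.differentiableAt_metric hU').hasFDerivAt.comp y hTd).clm_apply
      (hDTd.clm_apply (hasFDerivAt_const v y))).clm_apply (hDTd.clm_apply (hasFDerivAt_const w y))
    have e3 : (fun z ↦ G z v w) =ᶠ[𝓝 y]
        fun z ↦ G' (T z) (fderiv ℝ T z v) (fderiv ℝ T z w) := by
      filter_upwards [hT.isOpen.mem_nhds hy] with z hz using hT.metric_eq z hz v w
    have e4 := congrArg (fun f : E →L[ℝ] ℝ ↦ f u) (e1.unique (e2.congr_of_eventuallyEq e3))
    simp only [ContinuousLinearMap.flip_apply, Function.comp_apply, _root_.add_apply,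
      ContinuousLinearMap.comp_apply, _root_.zero_apply, map_zero, zero_add,
      h'.compat _ hU'] at e4
    rw [e4]
    simp only [hK, map_add, _root_.add_apply]
    ring
  have hinj : Function.Injective (fderiv ℝ T y) := by
    rw [injective_iff_map_eq_zero]
    intro u hu
    by_contra hne
    have := h.pos y hU u hne
    rw [hT.metric_eq y hy, hu] at this
    simp at this
  have hsurj : Function.Surjective (fderiv ℝ T y) :=
    (LinearMap.injective_iff_surjective (f := (fderiv ℝ T y : E →ₗ[ℝ] E))).mp hinj
  refine h'.eq_of_metric_eq hU' fun w' ↦ ?_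
  obtain ⟨w, rfl⟩ := hsurj w'
  rw [← hT.metric_eq y hy, h.metric_gamma hU, firstKind_apply, hDG, hDG, hDG]
  change _ = G' (T y) (K u v) (fderiv ℝ T y w)
  rw [hKs v u, hKs w u, hKs w v, h'.symm _ hU' (fderiv ℝ T y v), h'.symm _ hU' (fderiv ℝ T y u)]
  ring

/-- The second order exponential map is independent of the coordinates, up to an error of order
greater than two: by the transformation law, the second derivative of `T` accounts for the change of
the Christoffel symbols. -/
lemma IsLocalIsometryOn.quadExp_isLittleO [FiniteDimensional ℝ E]
    (hT : IsLocalIsometryOn G G' T V U')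
    (h : IsLeviCivitaOn G Γ U) (h' : IsLeviCivitaOn G' Γ' U') (hVU : V ⊆ U) {y : E} (hy : y ∈ V)
    {ε : ℝ} (hε : 0 < ε) :
    ∀ᶠ w in 𝓝 (0 : E),
      ‖T (quadExp Γ y w) - quadExp Γ' (T y) (fderiv ℝ T y w)‖ ≤ ε * ‖w‖ ^ 2 := by
  have hTy : ContDiffAt ℝ ∞ T y := hT.contDiffOn.contDiffAt (hT.isOpen.mem_nhds hy)
  obtain ⟨δ, hδ, H⟩ := exists_taylor_two (hTy.of_le two_le_infty) (ε := ε / 8)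
    (by positivity)
  set L := fderiv ℝ (fderiv ℝ T) y with hL
  set q : E → E := fun w ↦ w - (2⁻¹ : ℝ) • Γ y w w with hq
  have hq0 : Tendsto q (𝓝 0) (𝓝 0) := by
    have : Continuous q := by fun_prop
    simpa [hq] using this.tendsto 0
  have hA : Tendsto (fun w : E ↦ ‖Γ y‖ * ‖w‖) (𝓝 0) (𝓝 0) := by
    have : Continuous fun w : E ↦ ‖Γ y‖ * ‖w‖ := by fun_prop
    simpa using this.tendsto 0
  have hB : Tendsto (fun w : E ↦ ‖L‖ * (3 * ‖Γ y‖ * ‖w‖)) (𝓝 0) (𝓝 0) := by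
    have : Continuous fun w : E ↦ ‖L‖ * (3 * ‖Γ y‖ * ‖w‖) := by fun_prop
    simpa using this.tendsto 0
  filter_upwards [hq0 (Metric.ball_mem_nhds 0 hδ), hA.eventually (gt_mem_nhds zero_lt_one),
    hB.eventually (gt_mem_nhds (half_pos hε))] with w hw1 hw2 hw3
  have hqw : ‖q w - w‖ ≤ ‖Γ y‖ * ‖w‖ * ‖w‖ := by
    simp only [hq, sub_sub_cancel_left, norm_neg, norm_smul]
    have := norm_apply_apply_le (Γ y) w w
    have h2 : ‖(2⁻¹ : ℝ)‖ ≤ 1 := by norm_num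
    calc _ ≤ 1 * (‖Γ y‖ * ‖w‖ * ‖w‖) := by gcongr
      _ = _ := one_mul _
  have hqw2 : ‖q w‖ ≤ 2 * ‖w‖ := by
    calc ‖q w‖ = ‖(q w - w) + w‖ := by simp
      _ ≤ ‖q w - w‖ + ‖w‖ := norm_add_le _ _
      _ ≤ 1 * ‖w‖ + ‖w‖ := by gcongr; exact hqw.trans (by gcongr)
      _ = 2 * ‖w‖ := by ring
  have h1 := H y (q w) (by simpa using hδ) (by simpa using hw1)
  have h2 : T (quadExp Γ y w) - quadExp Γ' (T y) (fderiv ℝ T y w)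
      = (T (y + q w) - T y - fderiv ℝ T y (q w) - (2⁻¹ : ℝ) • L (q w) (q w))
        + (2⁻¹ : ℝ) • (L (q w - w) (q w) + L w (q w - w)) := by
    have h3 := hT.gamma_eq h h' hVU hy w w
    have h4 : quadExp Γ y w = y + q w := by simp [quadExp, hq, add_sub_assoc]
    rw [h4, quadExp]
    have h5 : fderiv ℝ T y (q w) = fderiv ℝ T y w
        - (2⁻¹ : ℝ) • (L w w + Γ' (T y) (fderiv ℝ T y w) (fderiv ℝ T y w)) := by
      simp only [hq, map_sub, map_smul, h3, hL]
    rw [h5]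
    simp only [map_sub, _root_.sub_apply]
    module
  rw [h2]
  have h6 : ‖L (q w - w) (q w) + L w (q w - w)‖ ≤ (‖L‖ * (3 * ‖Γ y‖ * ‖w‖)) * ‖w‖ ^ 2 := by
    calc _ ≤ ‖L (q w - w) (q w)‖ + ‖L w (q w - w)‖ := norm_add_le _ _
      _ ≤ ‖L‖ * (‖Γ y‖ * ‖w‖ * ‖w‖) * (2 * ‖w‖) + ‖L‖ * ‖w‖ * (‖Γ y‖ * ‖w‖ * ‖w‖) := by
          gcongr
          · exact (norm_apply_apply_le L _ _).trans (by gcongr)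
          · exact (norm_apply_apply_le L _ _).trans (by gcongr)
      _ = _ := by ring
  calc _ ≤ ε / 8 * ‖q w‖ ^ 2 + ‖(2⁻¹ : ℝ)‖ * ‖L (q w - w) (q w) + L w (q w - w)‖ := by
        refine (norm_add_le _ _).trans ?_
        rw [norm_smul]
        gcongr
    _ ≤ ε / 8 * (2 * ‖w‖) ^ 2 + 1 * ((ε / 2) * ‖w‖ ^ 2) := by
        have h7 : ‖(2⁻¹ : ℝ)‖ ≤ 1 := by norm_num
        gcongr
        exact h6.trans (by gcongr)
    _ = ε * ‖w‖ ^ 2 := by ring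

/-- The geodesic equation is independent of the coordinates. -/
lemma IsLocalIsometryOn.geodesic_eq [FiniteDimensional ℝ E]
    (hT : IsLocalIsometryOn G G' T V U')
    (h : IsLeviCivitaOn G Γ U) (h' : IsLeviCivitaOn G' Γ' U') (hVU : V ⊆ U) {c : ℝ → E} {t : ℝ}
    (hc : ContDiffAt ℝ 2 c t) (hy : c t ∈ V) :
    deriv (deriv (T ∘ c)) t + Γ' (T (c t)) (deriv (T ∘ c) t) (deriv (T ∘ c) t)
      = fderiv ℝ T (c t) (deriv (deriv c) t + Γ (c t) (deriv c t) (deriv c t)) := by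
  have hTy : ∀ y ∈ V, ContDiffAt ℝ ∞ T y :=
    fun y hy ↦ hT.contDiffOn.contDiffAt (hT.isOpen.mem_nhds hy)
  have hcd : deriv (T ∘ c) =ᶠ[𝓝 t] fun s ↦ fderiv ℝ T (c s) (deriv c s) := by
    have h1 : ∀ᶠ s in 𝓝 t, c s ∈ V := hc.continuousAt.preimage_mem_nhds (hT.isOpen.mem_nhds hy)
    filter_upwards [h1, hc.eventually (by simp)] with s hs hs2
    exact (((hTy _ hs).differentiableAt (by simp)).hasFDerivAt.comp_hasDerivAt s
      (hs2.differentiableAt (by norm_num)).hasDerivAt).deriv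
  have hc1 := (hc.differentiableAt (by norm_num)).hasDerivAt
  have hc2 : HasDerivAt (deriv c) (deriv (deriv c) t) t := by
    have h3 : ContDiffAt ℝ 1 (fderiv ℝ c) t := hc.fderiv_right (by norm_num)
    have h4 : DifferentiableAt ℝ (fun s ↦ fderiv ℝ c s 1) t :=
      (h3.differentiableAt (by norm_num)).clm_apply (differentiableAt_const _)
    exact h4.hasDerivAt
  have hDTd := (((hTy _ hy).fderiv_right (m := ∞) (by simp)).differentiableAt
    (by simp)).hasFDerivAt
  have h5 := (hDTd.comp_hasDerivAt t hc1).clm_apply hc2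
  rw [hcd.deriv_eq, hcd.eq_of_nhds, map_add, hT.gamma_eq h h' hVU hy]
  have h6 : deriv (fun s ↦ fderiv ℝ T (c s) (deriv c s)) t
      = fderiv ℝ (fderiv ℝ T) (c t) (deriv c t) (deriv c t)
        + fderiv ℝ T (c t) (deriv (deriv c) t) := h5.deriv
  rw [h6]
  abel

/-- The derivative of the inner product of two vector fields along a curve, in terms of their
covariant derivatives. -/
lemma IsLeviCivitaOn.hasDerivAt_metric (h : IsLeviCivitaOn G Γ U) {c v w : ℝ → E} {c' v' w' : E}
    {t : ℝ} (ht : c t ∈ U) (hc : HasDerivAt c c' t) (hv : HasDerivAt v v' t)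
    (hw : HasDerivAt w w' t) :
    HasDerivAt (fun s ↦ G (c s) (v s) (w s))
      (G (c t) (v' + Γ (c t) c' (v t)) (w t) + G (c t) (v t) (w' + Γ (c t) c' (w t))) t := by
  have h1 := (((h.differentiableAt_metric ht).hasFDerivAt.comp_hasDerivAt t hc).clm_apply
    hv).clm_apply hw
  refine h1.congr_deriv ?_
  simp only [_root_.add_apply, h.compat _ ht, map_add, Function.comp_apply]
  ring

end LocalCalculus

/-! ### Curves and geodesics in charts -/

section ManifoldGlue

variable {E : Type*} [NormedAddCommGroup E] [NormedSpace ℝ E] [FiniteDimensional ℝ E]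
  {M : Type*} [MetricSpace M] [ChartedSpace E M] [IsManifold 𝓘(ℝ, E) ∞ M]
  [RiemannianBundle (fun x : M ↦ TangentSpace 𝓘(ℝ, E) x)]

/-- The inner product of two vectors of the model space, seen as tangent vectors at `x`. With both
vectors in `E`, equal base points can be rewritten. -/
def tangentInner (x : M) (a b : E) : ℝ :=
  @inner ℝ (TangentSpace 𝓘(ℝ, E) x) _ a b

lemma chartG_eq_tangentInner (p : M) (y u v : E) :
    chartG p y u v = tangentInner (E := E) ((extChartAt 𝓘(ℝ, E) p).symm y)
      ((mfderiv 𝓘(ℝ, E) 𝓘(ℝ, E) (extChartAt 𝓘(ℝ, E) p).symm y : E →L[ℝ] E) u)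
      ((mfderiv 𝓘(ℝ, E) 𝓘(ℝ, E) (extChartAt 𝓘(ℝ, E) p).symm y : E →L[ℝ] E) v) := rfl

lemma norm_sq_eq_tangentInner (x : M) (v : TangentSpace 𝓘(ℝ, E) x) :
    ‖v‖ ^ 2 = tangentInner (E := E) x v v :=
  (real_inner_self_eq_norm_sq v).symm

/-- The change of coordinates between the charts centred at `p` and `p'`. -/
def transition (p p' : M) : E → E := extChartAt 𝓘(ℝ, E) p' ∘ (extChartAt 𝓘(ℝ, E) p).symm

/-- The domain of the change of coordinates between the charts centred at `p` and `p'`. -/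
def transitionSource (p p' : M) : Set E :=
  (extChartAt 𝓘(ℝ, E) p).target ∩
    (extChartAt 𝓘(ℝ, E) p).symm ⁻¹' (extChartAt 𝓘(ℝ, E) p').source

lemma isOpen_transitionSource (p p' : M) : IsOpen (transitionSource (E := E) p p') :=
  (continuousOn_extChartAt_symm p).isOpen_inter_preimage (isOpen_chart_target p)
    (isOpen_extChartAt_source p')

lemma chart_mem_transitionSource {p p' x : M} (h : x ∈ (extChartAt 𝓘(ℝ, E) p).source)
    (h' : x ∈ (extChartAt 𝓘(ℝ, E) p').source) :
    extChartAt 𝓘(ℝ, E) p x ∈ transitionSource (E := E) p p' :=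
  ⟨(extChartAt 𝓘(ℝ, E) p).map_source h, by
    rw [mem_preimage, (extChartAt 𝓘(ℝ, E) p).left_inv h]; exact h'⟩

lemma contDiffOn_transition (p p' : M) :
    ContDiffOn ℝ ∞ (transition (E := E) p p') (transitionSource p p') := by
  rw [← contMDiffOn_iff_contDiffOn]
  refine ContMDiffOn.comp (contMDiffOn_extChartAt (I := 𝓘(ℝ, E)) (x := p'))
    ((contMDiffOn_extChartAt_symm (I := 𝓘(ℝ, E)) p).mono inter_subset_left) ?_
  intro y hy
  have := hy.2
  rwa [mem_preimage, extChartAt_source] at this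

lemma isLocalIsometryOn_transition (p p' : M) :
    IsLocalIsometryOn (chartG p) (chartG p') (transition p p') (transitionSource (E := E) p p')
      (extChartAt 𝓘(ℝ, E) p').target := by
  refine ⟨isOpen_transitionSource p p', contDiffOn_transition p p',
    fun y hy ↦ (extChartAt 𝓘(ℝ, E) p').map_source hy.2, fun y hy u v ↦ ?_⟩
  have hV := (isOpen_transitionSource (E := E) p p').mem_nhds hy
  have hinv : ∀ z ∈ transitionSource (E := E) p p',
      (extChartAt 𝓘(ℝ, E) p').symm (transition p p' z) = (extChartAt 𝓘(ℝ, E) p).symm z :=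
    fun z hz ↦ (extChartAt 𝓘(ℝ, E) p').left_inv hz.2
  have heq : (extChartAt 𝓘(ℝ, E) p').symm ∘ transition p p' =ᶠ[𝓝 y]
      (extChartAt 𝓘(ℝ, E) p).symm := by
    filter_upwards [hV] with z hz using hinv z hz
  have hT : MDifferentiableAt 𝓘(ℝ, E) 𝓘(ℝ, E) (transition p p') y :=
    (((contDiffOn_transition p p').contDiffAt hV).differentiableAt (by simp)).mdifferentiableAt
  have h1 : mfderiv 𝓘(ℝ, E) 𝓘(ℝ, E) ((extChartAt 𝓘(ℝ, E) p').symm ∘ transition p p') y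
      = (mfderiv 𝓘(ℝ, E) 𝓘(ℝ, E) (extChartAt 𝓘(ℝ, E) p').symm (transition p p' y)).comp
        (mfderiv 𝓘(ℝ, E) 𝓘(ℝ, E) (transition p p') y) :=
    mfderiv_comp y (mdifferentiableAt_chart_symm p'
      ((extChartAt 𝓘(ℝ, E) p').map_source hy.2)) hT
  rw [mfderiv_eq_fderiv] at h1
  have h2 : ∀ u : E, (mfderiv 𝓘(ℝ, E) 𝓘(ℝ, E) (extChartAt 𝓘(ℝ, E) p).symm y : E →L[ℝ] E) u
      = (mfderiv 𝓘(ℝ, E) 𝓘(ℝ, E) (extChartAt 𝓘(ℝ, E) p').symm (transition p p' y) : E →L[ℝ] E)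
        (fderiv ℝ (transition p p') y u) := by
    intro u
    have h3 : (mfderiv 𝓘(ℝ, E) 𝓘(ℝ, E) ((extChartAt 𝓘(ℝ, E) p').symm ∘ transition p p') y
        : E →L[ℝ] E) = mfderiv 𝓘(ℝ, E) 𝓘(ℝ, E) (extChartAt 𝓘(ℝ, E) p).symm y :=
      heq.mfderiv_eq
    rw [← h3]
    exact congrArg (fun f : E →L[ℝ] E ↦ f u) h1
  rw [chartG_eq_tangentInner, chartG_eq_tangentInner, hinv y hy]
  exact congrArg₂ (tangentInner (E := E) _) (h2 u) (h2 v)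

/-- The velocity of the image of a curve under an inverse chart. -/
lemma mfderiv_symm_comp {β : ℝ → E} {t : ℝ} {p : M} (hβ : DifferentiableAt ℝ β t)
    (hp : β t ∈ (extChartAt 𝓘(ℝ, E) p).target) :
    (mfderiv 𝓘(ℝ, ℝ) 𝓘(ℝ, E) ((extChartAt 𝓘(ℝ, E) p).symm ∘ β) t : ℝ →L[ℝ] E) 1
      = (mfderiv 𝓘(ℝ, E) 𝓘(ℝ, E) (extChartAt 𝓘(ℝ, E) p).symm (β t) : E →L[ℝ] E) (deriv β t) := by
  have h1 : mfderiv 𝓘(ℝ, ℝ) 𝓘(ℝ, E) ((extChartAt 𝓘(ℝ, E) p).symm ∘ β) t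
      = (mfderiv 𝓘(ℝ, E) 𝓘(ℝ, E) (extChartAt 𝓘(ℝ, E) p).symm (β t)).comp
        (mfderiv 𝓘(ℝ, ℝ) 𝓘(ℝ, E) β t) :=
    mfderiv_comp t (mdifferentiableAt_chart_symm p hp) hβ.mdifferentiableAt
  rw [mfderiv_eq_fderiv] at h1
  exact congrArg (fun f : ℝ →L[ℝ] E ↦ f 1) h1

/-- The squared speed of a curve, in terms of its velocity in a chart. -/
lemma speed_sq_symm_comp {β : ℝ → E} {t : ℝ} {p : M} (hβ : DifferentiableAt ℝ β t)
    (hp : β t ∈ (extChartAt 𝓘(ℝ, E) p).target) :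
    ‖mfderiv 𝓘(ℝ, ℝ) 𝓘(ℝ, E) ((extChartAt 𝓘(ℝ, E) p).symm ∘ β) t (1 : ℝ)‖ ^ 2
      = chartG p (β t) (deriv β t) (deriv β t) := by
  rw [norm_sq_eq_tangentInner, chartG_eq_tangentInner]
  have := mfderiv_symm_comp hβ hp
  exact congrArg₂ (tangentInner (E := E) _) this this

lemma contDiffAt_chart_comp {n : ℕ∞} {γ : ℝ → M} {t : ℝ} {p : M}
    (hγ : ContMDiffAt 𝓘(ℝ, ℝ) 𝓘(ℝ, E) n γ t) (hp : γ t ∈ (extChartAt 𝓘(ℝ, E) p).source) :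
    ContDiffAt ℝ n (extChartAt 𝓘(ℝ, E) p ∘ γ) t := by
  rw [← contMDiffAt_iff_contDiffAt]
  have : IsManifold 𝓘(ℝ, E) n M := IsManifold.of_le (n := ∞) (by exact_mod_cast le_top)
  refine ContMDiffAt.comp t (contMDiffAt_extChartAt' (n := n) ?_) hγ
  rwa [extChartAt_source] at hp

lemma symm_comp_chart_eventuallyEq {γ : ℝ → M} {t : ℝ} {p : M} (hγ : ContinuousAt γ t)
    (hp : γ t ∈ (extChartAt 𝓘(ℝ, E) p).source) :
    (extChartAt 𝓘(ℝ, E) p).symm ∘ (extChartAt 𝓘(ℝ, E) p ∘ γ) =ᶠ[𝓝 t] γ := by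
  filter_upwards [hγ.preimage_mem_nhds ((isOpen_extChartAt_source p).mem_nhds hp)] with s hs
    using (extChartAt 𝓘(ℝ, E) p).left_inv hs

/-- The squared speed of a curve in `M`, in terms of its velocity in a chart. -/
lemma speed_sq_eq {γ : ℝ → M} {t : ℝ} {p : M}
    (hγ : ContMDiffAt 𝓘(ℝ, ℝ) 𝓘(ℝ, E) 1 γ t) (hp : γ t ∈ (extChartAt 𝓘(ℝ, E) p).source) :
    ‖mfderiv 𝓘(ℝ, ℝ) 𝓘(ℝ, E) γ t (1 : ℝ)‖ ^ 2
      = chartG p (extChartAt 𝓘(ℝ, E) p (γ t)) (deriv (extChartAt 𝓘(ℝ, E) p ∘ γ) t)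
        (deriv (extChartAt 𝓘(ℝ, E) p ∘ γ) t) := by
  have h1 := symm_comp_chart_eventuallyEq (E := E) hγ.continuousAt hp
  have h2 := speed_sq_symm_comp (p := p) (β := extChartAt 𝓘(ℝ, E) p ∘ γ)
    ((contDiffAt_chart_comp (n := 1) hγ hp).differentiableAt (by simp))
    ((extChartAt 𝓘(ℝ, E) p).map_source hp)
  rw [norm_sq_eq_tangentInner] at h2 ⊢
  have h3 : (mfderiv 𝓘(ℝ, ℝ) 𝓘(ℝ, E) ((extChartAt 𝓘(ℝ, E) p).symm ∘
      (extChartAt 𝓘(ℝ, E) p ∘ γ)) t : ℝ →L[ℝ] E) = mfderiv 𝓘(ℝ, ℝ) 𝓘(ℝ, E) γ t := h1.mfderiv_eq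
  rw [h1.eq_of_nhds] at h2
  rw [← Function.comp_apply (f := extChartAt 𝓘(ℝ, E) p), ← h2]
  exact congrArg (fun f : ℝ →L[ℝ] E ↦ tangentInner (E := E) (γ t) (f 1) (f 1)) h3.symm

variable [IsContMDiffRiemannianBundle 𝓘(ℝ, E) ∞ E (fun x : M ↦ TangentSpace 𝓘(ℝ, E) x)]

/-- The geodesic equation in an arbitrary chart around the point. -/
lemma IsGeodesicOn.chart_eq {γ : ℝ → M} {s : Set ℝ} (h : IsGeodesicOn E γ s) {t : ℝ} (ht : t ∈ s)
    {p : M} (hp : γ t ∈ (extChartAt 𝓘(ℝ, E) p).source) :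
    deriv (deriv (extChartAt 𝓘(ℝ, E) p ∘ γ)) t
      + chartΓ p (extChartAt 𝓘(ℝ, E) p (γ t)) (deriv (extChartAt 𝓘(ℝ, E) p ∘ γ) t)
        (deriv (extChartAt 𝓘(ℝ, E) p ∘ γ) t) = 0 := by
  obtain ⟨hγ, hgeo⟩ := h t ht
  have hs : γ t ∈ (extChartAt 𝓘(ℝ, E) (γ t)).source := mem_extChartAt_source (γ t)
  rw [christoffel_eq (E := E) (γ t) (mem_extChartAt_target (γ t))] at hgeo
  have hc := contDiffAt_chart_comp (E := E) (n := ⊤) hγ hs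
  have key := (isLocalIsometryOn_transition (E := E) (γ t) p).geodesic_eq
    (isLeviCivitaOn_chart (γ t)) (isLeviCivitaOn_chart p) inter_subset_left
    (c := extChartAt 𝓘(ℝ, E) (γ t) ∘ γ) (t := t) (hc.of_le two_le_infty)
    (chart_mem_transitionSource hs hp)
  have h1 : transition (E := E) (γ t) p ∘ (extChartAt 𝓘(ℝ, E) (γ t) ∘ γ)
      =ᶠ[𝓝 t] extChartAt 𝓘(ℝ, E) p ∘ γ :=
    (symm_comp_chart_eventuallyEq hγ.continuousAt hs).fun_comp (extChartAt 𝓘(ℝ, E) p)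
  rw [h1.deriv.deriv_eq, h1.deriv_eq, Function.comp_apply, hgeo, map_zero] at key
  have h2 : transition (E := E) (γ t) p (extChartAt 𝓘(ℝ, E) (γ t) (γ t))
      = extChartAt 𝓘(ℝ, E) p (γ t) := h1.eq_of_nhds
  rwa [h2] at key

lemma deriv_contDiffAt {c : ℝ → E} {t : ℝ} (hc : ContDiffAt ℝ ∞ c t) :
    ContDiffAt ℝ ∞ (deriv c) t := by
  have h3 : ContDiffAt ℝ ∞ (fderiv ℝ c) t := hc.fderiv_right (m := ∞) (by simp)
  exact h3.clm_apply contDiffAt_const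

/-- Geodesics have constant speed. -/
lemma IsGeodesicOn.hasDerivAt_speed_sq {γ : ℝ → M} {s : Set ℝ} (h : IsGeodesicOn E γ s) {t : ℝ}
    (ht : t ∈ s) :
    HasDerivAt (fun r ↦ ‖mfderiv 𝓘(ℝ, ℝ) 𝓘(ℝ, E) γ r (1 : ℝ)‖ ^ 2) 0 t := by
  obtain ⟨hγ, -⟩ := h t ht
  set p := γ t
  have hs : γ t ∈ (extChartAt 𝓘(ℝ, E) p).source := mem_extChartAt_source p
  have hc := contDiffAt_chart_comp (E := E) (n := ⊤) hγ hs
  have hc1 := (hc.differentiableAt (by simp)).hasDerivAt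
  have hc2 := ((deriv_contDiffAt hc).differentiableAt (by simp)).hasDerivAt
  have h1 := (isLeviCivitaOn_chart p).hasDerivAt_metric
    ((extChartAt 𝓘(ℝ, E) p).map_source hs) hc1 hc2 hc2
  have h2 := h.chart_eq ht hs
  rw [Function.comp_apply] at h1
  rw [h2, map_zero, map_zero, _root_.zero_apply, add_zero] at h1
  refine h1.congr_of_eventuallyEq ?_
  have h3 : ∀ᶠ r in 𝓝 t, γ r ∈ (extChartAt 𝓘(ℝ, E) p).source :=
    hγ.continuousAt.preimage_mem_nhds ((isOpen_extChartAt_source p).mem_nhds hs)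
  filter_upwards [h3, (contMDiffAt_iff_contMDiffAt_nhds (n := 1) (by simp)).mp
    (hγ.of_le (by simp))] with r hr hr2
    using speed_sq_eq hr2 hr

lemma IsGeodesicOn.speed_eq {γ : ℝ → M} {a b : ℝ} (h : IsGeodesicOn E γ (Icc a b)) {t : ℝ}
    (ht : t ∈ Icc a b) :
    ‖mfderiv 𝓘(ℝ, ℝ) 𝓘(ℝ, E) γ t (1 : ℝ)‖ = ‖mfderiv 𝓘(ℝ, ℝ) 𝓘(ℝ, E) γ a (1 : ℝ)‖ := by
  have h1 := constant_of_has_deriv_right_zero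
    (f := fun r ↦ ‖mfderiv 𝓘(ℝ, ℝ) 𝓘(ℝ, E) γ r (1 : ℝ)‖ ^ 2) (a := a) (b := b)
    (fun r hr ↦ (h.hasDerivAt_speed_sq hr).continuousAt.continuousWithinAt)
    (fun r hr ↦ (h.hasDerivAt_speed_sq (Ico_subset_Icc_self hr)).hasDerivWithinAt) t ht
  exact (sq_eq_sq₀ (norm_nonneg _) (norm_nonneg _)).mp h1

/-- The length of a geodesic is its speed times the length of the interval. -/
lemma IsGeodesicOn.pathELength_eq {γ : ℝ → M} {a b : ℝ}
    (h : IsGeodesicOn E γ (Icc a b)) :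
    Manifold.pathELength 𝓘(ℝ, E) γ a b
      = ENNReal.ofReal (‖mfderiv 𝓘(ℝ, ℝ) 𝓘(ℝ, E) γ a (1 : ℝ)‖ * (b - a)) := by
  rw [Manifold.pathELength_eq_lintegral_mfderiv_Icc]
  have : ∀ t ∈ Icc a b, ‖mfderiv 𝓘(ℝ, ℝ) 𝓘(ℝ, E) γ t (1 : ℝ)‖ₑ
      = ENNReal.ofReal ‖mfderiv 𝓘(ℝ, ℝ) 𝓘(ℝ, E) γ a (1 : ℝ)‖ := by
    intro t ht
    rw [← ofReal_norm, h.speed_eq ht]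
  refine (MeasureTheory.setLIntegral_congr_fun measurableSet_Icc this).trans ?_
  rw [MeasureTheory.setLIntegral_const, Real.volume_Icc,
    ENNReal.ofReal_mul (norm_nonneg _)]

lemma IsGeodesicOn.mono {γ : ℝ → M} {s s' : Set ℝ} (h : IsGeodesicOn E γ s) (hs : s' ⊆ s) :
    IsGeodesicOn E γ s' := fun t ht ↦ h t (hs ht)

variable [IsRiemannianManifold 𝓘(ℝ, E) M]

lemma IsGeodesicOn.dist_le {γ : ℝ → M} {a b : ℝ} (hab : a ≤ b)
    (h : IsGeodesicOn E γ (Icc a b)) :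
    dist (γ a) (γ b) ≤ ‖mfderiv 𝓘(ℝ, ℝ) 𝓘(ℝ, E) γ a (1 : ℝ)‖ * (b - a) := by
  have h1 : edist (γ a) (γ b) ≤ Manifold.pathELength 𝓘(ℝ, E) γ a b := by
    rw [IsRiemannianManifold.out (I := 𝓘(ℝ, E))]
    refine Manifold.riemannianEDist_le_pathELength ?_ rfl rfl hab
    intro t ht
    exact ((h t ht).1.of_le (by simp)).contMDiffWithinAt
  rw [h.pathELength_eq, edist_dist] at h1
  exact (ENNReal.ofReal_le_ofReal_iff (mul_nonneg (norm_nonneg _) (sub_nonneg.mpr hab))).mp h1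

/-- A curve in a chart whose speed is at most `B` has endpoints at distance at most `B` times
the length of the parameter interval. -/
lemma dist_symm_le {p : M} {β : ℝ → E} {a b B : ℝ} (hab : a ≤ b) (hB : 0 ≤ B)
    (hβ : ∀ t ∈ Icc a b, ContDiffAt ℝ 1 β t)
    (hβt : ∀ t ∈ Icc a b, β t ∈ (extChartAt 𝓘(ℝ, E) p).target)
    (hle : ∀ t ∈ Icc a b, chartG p (β t) (deriv β t) (deriv β t) ≤ B ^ 2) :
    dist ((extChartAt 𝓘(ℝ, E) p).symm (β a)) ((extChartAt 𝓘(ℝ, E) p).symm (β b))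
      ≤ B * (b - a) := by
  set γ := (extChartAt 𝓘(ℝ, E) p).symm ∘ β with hγ
  have h1 : edist (γ a) (γ b) ≤ Manifold.pathELength 𝓘(ℝ, E) γ a b := by
    rw [IsRiemannianManifold.out (I := 𝓘(ℝ, E))]
    refine Manifold.riemannianEDist_le_pathELength ?_ rfl rfl hab
    refine (contMDiffOn_extChartAt_symm p).comp (t := (extChartAt 𝓘(ℝ, E) p).target) ?_ hβt
    intro t ht
    exact (hβ t ht).contMDiffAt.contMDiffWithinAt
  have h2 : Manifold.pathELength 𝓘(ℝ, E) γ a b ≤ ENNReal.ofReal (B * (b - a)) := by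
    rw [Manifold.pathELength_eq_lintegral_mfderiv_Icc]
    calc _ ≤ ∫⁻ t in Icc a b, ENNReal.ofReal B := by
          refine MeasureTheory.setLIntegral_mono' measurableSet_Icc fun t ht ↦ ?_
          rw [← ofReal_norm]
          refine ENNReal.ofReal_le_ofReal ?_
          refine (sq_le_sq₀ (norm_nonneg _) hB).mp ?_
          have := speed_sq_symm_comp (p := p) ((hβ t ht).differentiableAt (by simp)) (hβt t ht)
          exact this.trans_le (hle t ht)
      _ = _ := by
          rw [MeasureTheory.setLIntegral_const, Real.volume_Icc, ENNReal.ofReal_mul hB]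
  have h3 := h1.trans h2
  rw [edist_dist] at h3
  exact (ENNReal.ofReal_le_ofReal_iff (mul_nonneg hB (sub_nonneg.mpr hab))).mp h3

end ManifoldGlue

/-! ### Distance estimates -/

section MetricBounds

variable {E : Type*} [NormedAddCommGroup E] [NormedSpace ℝ E]
  {G : E → E →L[ℝ] E →L[ℝ] ℝ} {Γ : E → E →L[ℝ] E →L[ℝ] E} {U : Set E}

lemma IsLeviCivitaOn.eventually_abs_metric_sub_le (h : IsLeviCivitaOn G Γ U) {y₀ : E} (hy : y₀ ∈ U)
    {ε : ℝ} (hε : 0 < ε) :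
    ∀ᶠ y in 𝓝 y₀, ∀ v, |G y v v - G y₀ v v| ≤ ε * ‖v‖ ^ 2 := by
  have h1 := (h.differentiableAt_metric hy).continuousAt
  filter_upwards [Metric.continuousAt_iff'.mp h1 ε hε] with y hy v
  rw [dist_eq_norm] at hy
  calc |G y v v - G y₀ v v| = ‖(G y - G y₀) v v‖ := by simp
    _ ≤ ‖G y - G y₀‖ * ‖v‖ * ‖v‖ := norm_apply_apply_le _ _ _
    _ ≤ ε * ‖v‖ * ‖v‖ := by gcongr
    _ = ε * ‖v‖ ^ 2 := by ring

lemma exists_norm_sq_le_of_pos [FiniteDimensional ℝ E] (B : E →L[ℝ] E →L[ℝ] ℝ)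
    (h : ∀ u, u ≠ 0 → 0 < B u u) : ∃ C > 0, ∀ v, ‖v‖ ^ 2 ≤ C * B v v := by
  have hK : IsCompact (Metric.sphere (0 : E) 1) := isCompact_sphere 0 1
  have hf : ContinuousOn (fun v ↦ B v v) (Metric.sphere (0 : E) 1) := by fun_prop
  rcases (Metric.sphere (0 : E) 1).eq_empty_or_nonempty with he | hne
  · refine ⟨1, one_pos, fun v ↦ ?_⟩
    have hv : v = 0 := by
      by_contra hv
      have : ‖v‖⁻¹ • v ∈ Metric.sphere (0 : E) 1 := by
        rw [mem_sphere_zero_iff_norm, norm_smul, norm_inv, norm_norm,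
          inv_mul_cancel₀ (norm_ne_zero_iff.mpr hv)]
      rw [he] at this
      exact this
    simp [hv]
  · obtain ⟨u, hu, hmin⟩ := hK.exists_isMinOn hne hf
    have hu0 : u ≠ 0 := by
      rintro rfl
      simp at hu
    have hm := h u hu0
    refine ⟨(B u u)⁻¹, inv_pos.mpr hm, fun v ↦ ?_⟩
    rcases eq_or_ne v 0 with rfl | hv
    · simp
    have hv' : 0 < ‖v‖ := norm_pos_iff.mpr hv
    have h1 : ‖v‖⁻¹ • v ∈ Metric.sphere (0 : E) 1 := by
      rw [mem_sphere_zero_iff_norm, norm_smul, norm_inv, norm_norm, inv_mul_cancel₀ hv'.ne']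
    have h2 : B u u ≤ B (‖v‖⁻¹ • v) (‖v‖⁻¹ • v) := hmin h1
    simp only [map_smul, _root_.smul_apply, smul_eq_mul] at h2
    rw [inv_mul_eq_div, le_div_iff₀ hm]
    have h3 : ‖v‖ ^ 2 * (‖v‖⁻¹ * (‖v‖⁻¹ * B v v)) = B v v := by field_simp
    calc ‖v‖ ^ 2 * B u u ≤ ‖v‖ ^ 2 * (‖v‖⁻¹ * (‖v‖⁻¹ * B v v)) := by gcongr
      _ = B v v := h3

/-- Near each point, the metric is uniformly comparable to the norm of the model space. -/
lemma IsLeviCivitaOn.exists_norm_sq_le [FiniteDimensional ℝ E] (h : IsLeviCivitaOn G Γ U) {y₀ : E}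
    (hy : y₀ ∈ U) :
    ∃ C > 0, ∀ᶠ y in 𝓝 y₀, y ∈ U ∧ ∀ v, G y v v ≤ C * ‖v‖ ^ 2 ∧ ‖v‖ ^ 2 ≤ C * G y v v := by
  obtain ⟨C, hC, hB⟩ := exists_norm_sq_le_of_pos (G y₀) (h.pos y₀ hy)
  refine ⟨2 * C + ‖G y₀‖ + 1, by positivity, ?_⟩
  filter_upwards [h.isOpen.mem_nhds hy,
    h.eventually_abs_metric_sub_le hy (ε := min 1 (1 / (2 * C))) (by positivity)] with y hyU hε
  refine ⟨hyU, fun v ↦ ?_⟩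
  have h1 := abs_le.mp (hε v)
  have h2 : G y₀ v v ≤ ‖G y₀‖ * ‖v‖ ^ 2 := by
    have := (le_abs_self _).trans (norm_apply_apply_le (G y₀) v v)
    nlinarith
  have h3 : min 1 (1 / (2 * C)) * ‖v‖ ^ 2 ≤ 1 * ‖v‖ ^ 2 := by gcongr; exact min_le_left _ _
  have h4 : min 1 (1 / (2 * C)) * ‖v‖ ^ 2 ≤ 1 / (2 * C) * ‖v‖ ^ 2 := by
    gcongr; exact min_le_right _ _
  have h5 : C * (1 / (2 * C) * ‖v‖ ^ 2) = ‖v‖ ^ 2 / 2 := by field_simp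
  have h6 : ‖v‖ ^ 2 ≤ 2 * C * G y v v := by
    have : C * G y₀ v v ≤ C * (G y v v + 1 / (2 * C) * ‖v‖ ^ 2) := by gcongr; linarith
    have := hB v
    nlinarith
  have h7 : 0 ≤ G y v v := by
    by_contra hneg
    push Not at hneg
    nlinarith [sq_nonneg ‖v‖]
  constructor
  · nlinarith [sq_nonneg ‖v‖]
  · nlinarith [norm_nonneg (G y₀)]

end MetricBounds

section Distance

lemma inter_frontier_nonempty_of_isPreconnected {X : Type*} [TopologicalSpace X] {s D : Set X}
    (hs : IsPreconnected s) (h1 : (s ∩ D).Nonempty) (h2 : (s ∩ Dᶜ).Nonempty) :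
    (s ∩ frontier D).Nonempty := by
  by_contra hne
  have hf : ∀ x ∈ s, x ∈ frontier D → False := fun x hx h ↦ hne ⟨x, hx, h⟩
  obtain ⟨x, hxs, hx⟩ := h1
  obtain ⟨z, hzs, hz⟩ := h2
  obtain ⟨w, -, hw1, hw2⟩ := hs (interior D) (closure D)ᶜ isOpen_interior
    isClosed_closure.isOpen_compl
    (fun y hy ↦ by
      by_cases h : y ∈ interior D
      · exact Or.inl h
      · exact Or.inr fun h' ↦ hf y hy ⟨h', h⟩)
    ⟨x, hxs, by
      by_contra h
      exact hf x hxs ⟨subset_closure hx, h⟩⟩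
    ⟨z, hzs, fun h ↦ hf z hzs ⟨h, fun h' ↦ hz (interior_subset h')⟩⟩
  exact hw2 (subset_closure (interior_subset hw1))

/-- In a length space, the frontier is at least as close to a point of `D` as the complement: a path
to the complement crosses the frontier. -/
lemma infDist_frontier_le (E : Type*) [NormedAddCommGroup E] [NormedSpace ℝ E]
    {M : Type*} [MetricSpace M] [ChartedSpace E M]
    [RiemannianBundle (fun x : M ↦ TangentSpace 𝓘(ℝ, E) x)]
    [IsRiemannianManifold 𝓘(ℝ, E) M] {D : Set M} {x : M} (hx : x ∈ D) (hne : Dᶜ.Nonempty) :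
    Metric.infDist x (frontier D) ≤ Metric.infDist x Dᶜ := by
  refine (Metric.le_infDist hne).mpr fun z hz ↦ ?_
  refine le_of_forall_gt fun r hr ↦ ?_
  have hr' : Manifold.riemannianEDist 𝓘(ℝ, E) x z < ENNReal.ofReal r := by
    rw [← IsRiemannianManifold.out (I := 𝓘(ℝ, E)), edist_dist]
    exact (ENNReal.ofReal_lt_ofReal_iff (dist_nonneg.trans_lt hr)).mpr hr
  obtain ⟨γ, h0, h1, hγ, hl⟩ := Manifold.exists_lt_of_riemannianEDist_lt hr'
  have hconn : IsPreconnected (γ '' Icc 0 1) := isPreconnected_Icc.image γ hγ.continuousOn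
  obtain ⟨w, ⟨t, ht, rfl⟩, hw⟩ := inter_frontier_nonempty_of_isPreconnected (D := D) hconn
    ⟨x, ⟨0, by simp, h0⟩, hx⟩ ⟨z, ⟨1, by simp, h1⟩, hz⟩
  refine (Metric.infDist_le_dist_of_mem hw).trans_lt ?_
  have h2 : edist x (γ t) < ENNReal.ofReal r := by
    refine lt_of_le_of_lt ?_ hl
    rw [IsRiemannianManifold.out (I := 𝓘(ℝ, E))]
    exact (Manifold.riemannianEDist_le_pathELength (hγ.mono (Icc_subset_Icc_right ht.2)) h0 rfl
      ht.1).trans (Manifold.pathELength_mono le_rfl ht.2)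
  rw [edist_dist] at h2
  exact (ENNReal.ofReal_lt_ofReal_iff (dist_nonneg.trans_lt hr)).mp h2

variable {E : Type*} [NormedAddCommGroup E] [NormedSpace ℝ E] [FiniteDimensional ℝ E]
  {M : Type*} [MetricSpace M] [ChartedSpace E M] [IsManifold 𝓘(ℝ, E) ∞ M]
  [RiemannianBundle (fun x : M ↦ TangentSpace 𝓘(ℝ, E) x)]
  [IsContMDiffRiemannianBundle 𝓘(ℝ, E) ∞ E (fun x : M ↦ TangentSpace 𝓘(ℝ, E) x)]
  [IsRiemannianManifold 𝓘(ℝ, E) M]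

/-- Near a point, the distance is at most the norm of the coordinate difference for the metric at
the point, up to a relative error. -/
lemma exists_dist_symm_sq_le (p : M) {y₀ : E} (hy : y₀ ∈ (extChartAt 𝓘(ℝ, E) p).target) {ε : ℝ}
    (hε : 0 < ε) :
    ∃ r > 0, ∀ y ∈ Metric.ball y₀ r, ∀ y' ∈ Metric.ball y₀ r,
      dist ((extChartAt 𝓘(ℝ, E) p).symm y) ((extChartAt 𝓘(ℝ, E) p).symm y')
        ≤ √(chartG p y₀ (y' - y) (y' - y) + ε * ‖y' - y‖ ^ 2) := by
  have hLC := isLeviCivitaOn_chart (E := E) p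
  obtain ⟨r, hr, hball⟩ := Metric.mem_nhds_iff.mp
    (inter_mem (hLC.isOpen.mem_nhds hy) (hLC.eventually_abs_metric_sub_le hy hε))
  refine ⟨r, hr, fun y hyb y' hyb' ↦ ?_⟩
  have hmem : ∀ t ∈ Icc (0 : ℝ) 1, AffineMap.lineMap y y' t ∈ Metric.ball y₀ r := by
    intro t ht
    exact (convex_ball y₀ r).lineMap_mem hyb hyb' ht
  have hder : ∀ t : ℝ, HasDerivAt (AffineMap.lineMap y y' : ℝ → E) (y' - y) t := fun t ↦
    AffineMap.hasDerivAt_lineMap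
  have h0 : 0 ≤ chartG p y₀ (y' - y) (y' - y) := hLC.nonneg hy _
  have := dist_symm_le (p := p) (β := AffineMap.lineMap y y') (a := 0) (b := 1)
    (B := √(chartG p y₀ (y' - y) (y' - y) + ε * ‖y' - y‖ ^ 2)) zero_le_one (Real.sqrt_nonneg _)
    (fun t _ ↦ (ContinuousAffineMap.lineMap (R := ℝ) y y').contDiff.contDiffAt)
    (fun t ht ↦ (hball (hmem t ht)).1) (fun t ht ↦ by
      rw [(hder t).deriv, Real.sq_sqrt (by positivity)]
      have := (abs_le.mp ((hball (hmem t ht)).2 (y' - y))).2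
      linarith)
  simpa using this

/-- Inverse charts are locally Lipschitz. -/
lemma exists_dist_symm_le (p : M) {y₀ : E} (hy : y₀ ∈ (extChartAt 𝓘(ℝ, E) p).target) :
    ∃ C > 0, ∃ r > 0, ∀ y ∈ Metric.ball y₀ r, ∀ y' ∈ Metric.ball y₀ r,
      dist ((extChartAt 𝓘(ℝ, E) p).symm y) ((extChartAt 𝓘(ℝ, E) p).symm y') ≤ C * ‖y' - y‖ := by
  obtain ⟨r, hr, H⟩ := exists_dist_symm_sq_le (E := E) p hy one_pos
  refine ⟨√(‖chartG p y₀‖ + 1), by positivity, r, hr, fun y h y' h' ↦ (H y h y' h').trans ?_⟩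
  have h2 := (le_abs_self _).trans (norm_apply_apply_le (chartG p y₀) (y' - y) (y' - y))
  rw [← Real.sqrt_sq (norm_nonneg (y' - y)), ← Real.sqrt_mul (by positivity),
    Real.sqrt_sq (norm_nonneg _)]
  exact Real.sqrt_le_sqrt (by nlinarith)

/-- The speed of a minimal geodesic parametrized by `[0, 1]` is the distance of its endpoints. -/
lemma IsMinimalGeodesic.speed_eq {γ : ℝ → M} {x y : M} (h : IsMinimalGeodesic E γ x y) {t : ℝ}
    (ht : t ∈ Icc (0 : ℝ) 1) : ‖mfderiv 𝓘(ℝ, ℝ) 𝓘(ℝ, E) γ t (1 : ℝ)‖ = dist x y := by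
  obtain ⟨hg, h0, h1, hl⟩ := h
  rw [hg.speed_eq ht]
  rw [hg.pathELength_eq, edist_dist, sub_zero, mul_one] at hl
  exact (ENNReal.ofReal_eq_ofReal_iff (norm_nonneg _) dist_nonneg).mp hl

lemma IsMinimalGeodesic.dist_le {γ : ℝ → M} {x y : M} (h : IsMinimalGeodesic E γ x y) {s t : ℝ}
    (hs : 0 ≤ s) (hst : s ≤ t) (ht : t ≤ 1) : dist (γ s) (γ t) ≤ dist x y * (t - s) := by
  have := (h.1.mono (Icc_subset_Icc hs ht)).dist_le hst
  rwa [h.speed_eq ⟨hs, hst.trans ht⟩] at this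

/-- Bounded closed pieces of a closed convex set are compact: the Hopf-Rinow theorem, for the
convex set instead of the whole manifold. Convexity provides the minimal geodesics which the usual
proof has to construct. -/
lemma GeodConvex.isCompact_inter_closedBall [CompleteSpace M] {D : Set M} (hD : IsClosed D)
    (hconv : GeodConvex E D) {x : M} (hx : x ∈ D) (r : ℝ) :
    IsCompact (D ∩ Metric.closedBall x r) := by
  have : LocallyCompactSpace M := Manifold.locallyCompact_of_finiteDimensional 𝓘(ℝ, E)
  have hcl : ∀ r, IsClosed (D ∩ Metric.closedBall x r) := fun r ↦
    hD.inter Metric.isClosed_closedBall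
  let S : Set ℝ := {r | IsCompact (D ∩ Metric.closedBall x r)}
  have hdown : ∀ r ∈ S, ∀ s ≤ r, s ∈ S := fun r hr s hs ↦
    IsCompact.of_isClosed_subset hr (hcl s)
      (inter_subset_inter_right _ (Metric.closedBall_subset_closedBall hs))
  have h0 : (0 : ℝ) ∈ S := by
    change IsCompact (D ∩ Metric.closedBall x 0)
    rw [Metric.closedBall_zero]
    exact (isCompact_singleton).of_isClosed_subset (hD.inter isClosed_singleton)
      inter_subset_right
  by_contra hr
  have hbdd : BddAbove S := ⟨r, fun s hs ↦ by
    by_contra h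
    exact hr (hdown s hs r (not_le.mp h).le)⟩
  set R := sSup S with hR
  have hR0 : 0 ≤ R := le_csSup hbdd h0
  have hlt : ∀ s < R, s ∈ S := fun s hs ↦ by
    obtain ⟨u, hu, hsu⟩ := exists_lt_of_lt_csSup ⟨0, h0⟩ hs
    exact hdown u hu s hsu.le
  -- total boundedness at the limit radius, by moving points along geodesics towards `x`
  have hRS : R ∈ S := by
    refine TotallyBounded.isCompact_of_isClosed ?_ (hcl R)
    rw [Metric.totallyBounded_iff]
    intro ε hε
    have hc : IsCompact (D ∩ Metric.closedBall x (R - ε / 4)) := hlt _ (by linarith)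
    obtain ⟨t, ht, hcov⟩ := Metric.totallyBounded_iff.mp hc.totallyBounded (ε / 2) (by positivity)
    refine ⟨insert x t, ht.insert x, fun y hy ↦ ?_⟩
    simp only [mem_iUnion]
    have hyR : dist y x ≤ R := hy.2
    rcases lt_or_ge (dist y x) ε with hlt | hge
    · exact ⟨x, mem_insert _ _, hlt⟩
    · obtain ⟨γ, hγ, hγD⟩ := hconv x hx y hy.1
      have hd0 : 0 < dist x y := by rw [dist_comm]; linarith
      set s := 1 - ε / 4 / dist x y with hs
      have hs1 : ε / 4 / dist x y ≤ 1 := by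
        rw [div_le_one hd0, dist_comm]; linarith
      have hs0 : 0 ≤ ε / 4 / dist x y := by positivity
      have h1 := hγ.dist_le le_rfl (show 0 ≤ s by linarith) (by linarith)
      have h2 := hγ.dist_le (show 0 ≤ s by linarith) (show s ≤ 1 by linarith) le_rfl
      rw [hγ.2.1] at h1
      rw [hγ.2.2.1] at h2
      have h3 : dist x y * (s - 0) = dist x y - ε / 4 := by
        rw [hs]; field_simp; ring
      have h4 : dist x y * (1 - s) = ε / 4 := by
        rw [hs]; field_simp; ring
      rw [h3, dist_comm x y] at h1
      rw [h4] at h2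
      have hmem : γ s ∈ D ∩ Metric.closedBall x (R - ε / 4) := by
        refine ⟨hγD s ⟨by linarith, by linarith⟩, ?_⟩
        rw [Metric.mem_closedBall, dist_comm]
        linarith
      obtain ⟨z, hz, hzs⟩ := mem_iUnion₂.mp (hcov hmem)
      refine ⟨z, mem_insert_of_mem _ hz, ?_⟩
      rw [Metric.mem_ball] at hzs ⊢
      have := dist_triangle y (γ s) z
      rw [dist_comm y (γ s)] at this
      linarith
  -- local compactness allows a larger radius
  obtain ⟨δ, hδ, hthick⟩ := (show IsCompact (D ∩ Metric.closedBall x R) from hRS)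
    |>.exists_isCompact_cthickening
  have hbig : R + δ / 2 ∈ S := by
    refine hthick.of_isClosed_subset (hcl _) fun y hy ↦ ?_
    have hyR : dist y x ≤ R + δ / 2 := hy.2
    rcases le_or_gt (dist y x) R with hle | hgt
    · exact Metric.self_subset_cthickening _ ⟨hy.1, hle⟩
    · obtain ⟨γ, hγ, hγD⟩ := hconv x hx y hy.1
      have hd0 : 0 < dist x y := by rw [dist_comm]; linarith
      set s := R / dist x y with hs
      have hs0 : 0 ≤ s := by positivity
      have hs1 : s ≤ 1 := by rw [hs, div_le_one hd0, dist_comm]; exact hgt.le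
      have h1 := hγ.dist_le le_rfl hs0 hs1
      have h2 := hγ.dist_le hs0 hs1 le_rfl
      rw [hγ.2.1] at h1
      rw [hγ.2.2.1] at h2
      have h3 : dist x y * (s - 0) = R := by rw [hs]; field_simp; ring
      have h4 : dist x y * (1 - s) = dist x y - R := by rw [hs]; field_simp
      rw [h3] at h1
      rw [h4] at h2
      refine Metric.mem_cthickening_of_dist_le y (γ s) δ _ ⟨hγD s ⟨hs0, hs1⟩, ?_⟩ ?_
      · rw [Metric.mem_closedBall, dist_comm]; exact h1
      · rw [dist_comm]; rw [dist_comm x y] at h2; linarith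
  have := le_csSup hbdd hbig
  linarith

lemma GeodConvex.exists_infDist_frontier_eq_dist [CompleteSpace M] {D : Set M} (hD : IsClosed D)
    (hconv : GeodConvex E D) {x : M} (hx : x ∈ D) (hne : (frontier D).Nonempty) :
    ∃ q ∈ frontier D, Metric.infDist x (frontier D) = dist x q := by
  obtain ⟨z, hz⟩ := hne
  have hK : IsCompact (frontier D ∩ Metric.closedBall x (dist z x)) :=
    (hconv.isCompact_inter_closedBall hD hx (dist z x)).of_isClosed_subset
      (isClosed_frontier.inter Metric.isClosed_closedBall)
      (inter_subset_inter_left _ hD.frontier_subset)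
  have hzK : z ∈ frontier D ∩ Metric.closedBall x (dist z x) :=
    ⟨hz, Metric.mem_closedBall.mpr le_rfl⟩
  obtain ⟨q, hq, hmin⟩ := hK.exists_isMinOn ⟨z, hzK⟩
    (f := fun y ↦ dist x y) (by fun_prop)
  refine ⟨q, hq.1, le_antisymm (Metric.infDist_le_dist_of_mem hq.1) ?_⟩
  refine (Metric.le_infDist ⟨z, hz⟩).mpr fun y hy ↦ ?_
  rcases le_or_gt (dist y x) (dist z x) with h | h
  · exact hmin ⟨hy, h⟩
  · have h1 : dist x q ≤ dist x z := hmin hzK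
    rw [dist_comm x y]
    rw [dist_comm x z] at h1
    linarith

end Distance

/-! ### Supporting half spaces of convex sets -/

section HalfSpace

variable {E : Type*} [NormedAddCommGroup E] [NormedSpace ℝ E] [FiniteDimensional ℝ E]
  {M : Type*} [MetricSpace M] [ChartedSpace E M] [IsManifold 𝓘(ℝ, E) ∞ M]
  [RiemannianBundle (fun x : M ↦ TangentSpace 𝓘(ℝ, E) x)]
  [IsContMDiffRiemannianBundle 𝓘(ℝ, E) ∞ E (fun x : M ↦ TangentSpace 𝓘(ℝ, E) x)]
  [IsRiemannianManifold 𝓘(ℝ, E) M]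

/-- If the derivative of `ψ` is Lipschitz with constant `c` at `0`, then `ψ` is close to its first
order expansion. -/
lemma norm_sub_sub_le_of_deriv_two {F : Type*} [NormedAddCommGroup F] [NormedSpace ℝ F]
    {ψ ψ' ψ'' : ℝ → F} {c : ℝ} (h1 : ∀ t ∈ Icc (0 : ℝ) 1, HasDerivAt ψ (ψ' t) t)
    (h2 : ∀ t ∈ Icc (0 : ℝ) 1, HasDerivAt ψ' (ψ'' t) t) (hc : ∀ t ∈ Icc (0 : ℝ) 1, ‖ψ'' t‖ ≤ c) :
    ‖ψ 1 - ψ 0 - ψ' 0‖ ≤ c := by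
  have hc0 : 0 ≤ c := (norm_nonneg _).trans (hc 0 (by simp))
  have h3 : ∀ t ∈ Icc (0 : ℝ) 1, ‖ψ' t - ψ' 0‖ ≤ c * (t - 0) :=
    norm_image_sub_le_of_norm_deriv_le_segment' (fun t ht ↦ (h2 t ht).hasDerivWithinAt)
      fun t ht ↦ hc t (Ico_subset_Icc_self ht)
  have h4 := norm_image_sub_le_of_norm_deriv_le_segment_01' (f := fun t ↦ ψ t - t • ψ' 0)
    (f' := fun t ↦ ψ' t - ψ' 0) (C := c)
    (fun t ht ↦ by
      have : HasDerivAt (fun t : ℝ ↦ t • ψ' 0) (ψ' 0) t := by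
        simpa using (hasDerivAt_id t).smul_const (ψ' 0)
      exact ((h1 t ht).sub this).hasDerivWithinAt)
    (fun t ht ↦ (h3 t (Ico_subset_Icc_self ht)).trans (by nlinarith [ht.1, ht.2]))
  simpa [sub_right_comm] using h4

/-- Two nearby points of a convex set are joined by a curve inside the set which, in the
coordinates `quadLog`, is a straight segment up to an error of order greater than two: these
coordinates are geodesic at `q`, so that geodesics close to `q` have small second derivative. -/
lemma GeodConvex.exists_chord {D : Set M} (hconv : GeodConvex E D) (q : M) :
    ∃ C > 0, ∀ ε > 0, ∀ ρ > 0, ∃ r > 0,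
      ∀ d ∈ Metric.ball (extChartAt 𝓘(ℝ, E) q q) r, ∀ a ∈ Metric.ball (extChartAt 𝓘(ℝ, E) q q) r,
      (extChartAt 𝓘(ℝ, E) q).symm d ∈ D → (extChartAt 𝓘(ℝ, E) q).symm a ∈ D →
      ∃ (α : ℝ → E) (v : E), α 0 = d ∧ HasDerivAt α v 0 ∧
        (∀ t ∈ Icc (0 : ℝ) 1, α t ∈ Metric.ball (extChartAt 𝓘(ℝ, E) q q) ρ ∧
          (extChartAt 𝓘(ℝ, E) q).symm (α t) ∈ D) ∧ ‖v‖ ≤ C * ‖a - d‖ ∧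
        ‖quadLog (chartΓ q) (extChartAt 𝓘(ℝ, E) q q) a
          - quadLog (chartΓ q) (extChartAt 𝓘(ℝ, E) q q) d
          - (v + chartΓ q (extChartAt 𝓘(ℝ, E) q q) (d - extChartAt 𝓘(ℝ, E) q q) v)‖
          ≤ ε * ‖a - d‖ ^ 2 := by
  set φ := extChartAt 𝓘(ℝ, E) q with hφ
  set y₀ := φ q with hy₀
  have hqs : q ∈ φ.source := mem_extChartAt_source q
  have hyt : y₀ ∈ φ.target := mem_extChartAt_target q
  have hLC := isLeviCivitaOn_chart (E := E) q
  obtain ⟨C₁, hC₁, hnorm⟩ := hLC.exists_norm_sq_le hyt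
  obtain ⟨C₂, hC₂, r₂, hr₂, hlip⟩ := exists_dist_symm_le (E := E) q hyt
  refine ⟨√C₁ * C₂, by positivity, fun ε hε ρ hρ ↦ ?_⟩
  set K := C₁ * C₂ ^ 2 with hK
  have hK0 : 0 < K := by positivity
  -- the second derivative of the curve in the coordinates `quadLog` is small near `y₀`
  have hsmall : ∀ᶠ y in 𝓝 y₀, ‖chartΓ q y - chartΓ q y₀‖
      + ‖chartΓ q y₀‖ * ‖y - y₀‖ * ‖chartΓ q y‖ < ε / K := by
    have hcont : ContinuousAt (chartΓ (E := E) q) y₀ := (hLC.contDiffAt_gamma hyt).continuousAt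
    have : ContinuousAt (fun y ↦ ‖chartΓ q y - chartΓ q y₀‖
      + ‖chartΓ q y₀‖ * ‖y - y₀‖ * ‖chartΓ q y‖) y₀ := by fun_prop
    refine this.eventually (gt_mem_nhds ?_)
    simp only [sub_self, norm_zero, mul_zero, zero_mul, add_zero]
    positivity
  obtain ⟨r₁, hr₁, hball⟩ := Metric.mem_nhds_iff.mp
    (inter_mem (inter_mem hnorm hsmall) (Metric.ball_mem_nhds y₀ hρ))
  have hW : φ.source ∩ φ ⁻¹' Metric.ball y₀ r₁ ∈ 𝓝 q :=
    inter_mem (extChartAt_source_mem_nhds q)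
      ((continuousAt_extChartAt q).preimage_mem_nhds (Metric.ball_mem_nhds _ hr₁))
  obtain ⟨s, hs, hsW⟩ := Metric.mem_nhds_iff.mp hW
  set r := min r₂ (s / (4 * C₂)) with hr
  have hr0 : 0 < r := by positivity
  have hrs : C₂ * r ≤ s / 4 := by
    calc C₂ * r ≤ C₂ * (s / (4 * C₂)) := by gcongr; exact min_le_right _ _
      _ = s / 4 := by field_simp
  refine ⟨min r r₁, by positivity, fun d hd a ha hdD haD ↦ ?_⟩
  have hd1 : d ∈ Metric.ball y₀ r := Metric.ball_subset_ball (min_le_left _ _) hd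
  have ha1 : a ∈ Metric.ball y₀ r := Metric.ball_subset_ball (min_le_left _ _) ha
  have hd2 : d ∈ φ.target :=
    (hball (Metric.ball_subset_ball (min_le_right _ _) hd)).1.1.1
  have ha2 : a ∈ φ.target :=
    (hball (Metric.ball_subset_ball (min_le_right _ _) ha)).1.1.1
  have hd3 : d ∈ Metric.ball y₀ r₂ := Metric.ball_subset_ball (min_le_left _ _) hd1
  have ha3 : a ∈ Metric.ball y₀ r₂ := Metric.ball_subset_ball (min_le_left _ _) ha1
  obtain ⟨γ, hγ, hγD⟩ := hconv _ hdD _ haD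
  set x := φ.symm d
  set z := φ.symm a
  have hxz : dist x z ≤ C₂ * ‖a - d‖ := hlip d hd3 a ha3
  have hxq : dist x q ≤ C₂ * r := by
    have h1 := hlip d hd3 y₀ (Metric.mem_ball_self hr₂)
    rw [show φ.symm y₀ = q from φ.left_inv hqs] at h1
    refine h1.trans ?_
    gcongr
    rw [norm_sub_rev]
    exact (mem_ball_iff_norm.mp hd1).le
  have hzq : dist z q ≤ C₂ * r := by
    have h1 := hlip a ha3 y₀ (Metric.mem_ball_self hr₂)
    rw [show φ.symm y₀ = q from φ.left_inv hqs] at h1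
    refine h1.trans ?_
    gcongr
    rw [norm_sub_rev]
    exact (mem_ball_iff_norm.mp ha1).le
  have hstay : ∀ t ∈ Icc (0 : ℝ) 1, γ t ∈ φ.source ∩ φ ⁻¹' Metric.ball y₀ r₁ := by
    intro t ht
    refine hsW ?_
    rw [Metric.mem_ball]
    have h1 := hγ.dist_le le_rfl ht.1 ht.2
    rw [hγ.2.1] at h1
    have h2 : dist x z * (t - 0) ≤ dist x z := by nlinarith [ht.2, dist_nonneg (x := x) (y := z)]
    have h3 := dist_triangle (γ t) x q
    have h4 := dist_triangle x q z
    rw [dist_comm (γ t) x] at h3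
    rw [dist_comm q z] at h4
    linarith
  set α := φ ∘ γ with hα
  have hcd : ∀ t ∈ Icc (0 : ℝ) 1, ContDiffAt ℝ ∞ α t := fun t ht ↦
    contDiffAt_chart_comp (E := E) (n := ⊤) (hγ.1 t ht).1 (hstay t ht).1
  have hd1' : ∀ t ∈ Icc (0 : ℝ) 1, HasDerivAt α (deriv α t) t := fun t ht ↦
    ((hcd t ht).differentiableAt (by simp)).hasDerivAt
  have hd2' : ∀ t ∈ Icc (0 : ℝ) 1, HasDerivAt (deriv α)
      (-chartΓ q (α t) (deriv α t) (deriv α t)) t :=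
      fun t ht ↦ by
    have h1 := ((deriv_contDiffAt (hcd t ht)).differentiableAt (by simp)).hasDerivAt
    rwa [eq_neg_of_add_eq_zero_left (hγ.1.chart_eq ht (hstay t ht).1)] at h1
  have hspeed : ∀ t ∈ Icc (0 : ℝ) 1, ‖deriv α t‖ ^ 2 ≤ K * ‖a - d‖ ^ 2 := by
    intro t ht
    have h1 := (hball (hstay t ht).2).1.1.2 (deriv α t)
    have h2 := speed_sq_eq (p := q) ((hγ.1 t ht).1.of_le (by simp)) (hstay t ht).1
    rw [hγ.speed_eq ht] at h2
    calc ‖deriv α t‖ ^ 2 ≤ C₁ * dist x z ^ 2 := by rw [h2]; exact h1.2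
      _ ≤ C₁ * (C₂ * ‖a - d‖) ^ 2 := by gcongr
      _ = K * ‖a - d‖ ^ 2 := by rw [hK]; ring
  have hα0 : α 0 = d := by
    simp only [hα, Function.comp_apply, hγ.2.1]
    exact φ.right_inv hd2
  have hα1 : α 1 = a := by
    simp only [hα, Function.comp_apply, hγ.2.2.1]
    exact φ.right_inv ha2
  refine ⟨α, deriv α 0, hα0, hd1' 0 (by simp), fun t ht ↦ ⟨(hball (hstay t ht).2).2, ?_⟩, ?_, ?_⟩
  · have : φ.symm (α t) = γ t := φ.left_inv (hstay t ht).1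
    rw [this]
    exact hγD t ht
  · have h1 := Real.sqrt_le_sqrt (hspeed 0 (by simp))
    rw [Real.sqrt_sq (norm_nonneg _), hK, Real.sqrt_mul (by positivity), Real.sqrt_sq
      (norm_nonneg _), Real.sqrt_mul hC₁.le, Real.sqrt_sq hC₂.le] at h1
    exact h1
  · have hs0 : ∀ u v, chartΓ q y₀ u v = chartΓ q y₀ v u := hLC.gamma_symm y₀ hyt
    have key := norm_sub_sub_le_of_deriv_two (ψ := fun t ↦ quadLog (chartΓ q) y₀ (α t))
      (ψ' := fun t ↦ deriv α t + chartΓ q y₀ (α t - y₀) (deriv α t))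
      (ψ'' := fun t ↦ -chartΓ q (α t) (deriv α t) (deriv α t)
        + (chartΓ q y₀ (deriv α t) (deriv α t)
          + chartΓ q y₀ (α t - y₀) (-chartΓ q (α t) (deriv α t) (deriv α t))))
      (c := ε * ‖a - d‖ ^ 2)
      (fun t ht ↦ by
        have h1 := (hd1' t ht).sub_const y₀
        have h2 := ((hasDerivAt_const t (chartΓ q y₀)).clm_apply h1).clm_apply h1
        refine (h1.add (h2.const_smul (2⁻¹ : ℝ))).congr_deriv ?_
        simp only [_root_.zero_apply, zero_add, hs0 (deriv α t) (α t - y₀)]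
        module)
      (fun t ht ↦ by
        have h1 := (hd1' t ht).sub_const y₀
        have h2 := ((hasDerivAt_const t (chartΓ q y₀)).clm_apply h1).clm_apply (hd2' t ht)
        refine ((hd2' t ht).add h2).congr_deriv ?_
        simp only [_root_.zero_apply, zero_add])
      (fun t ht ↦ by
        have h1 := (hball (hstay t ht).2).1.2
        change ‖chartΓ q (α t) - chartΓ q y₀‖
          + ‖chartΓ q y₀‖ * ‖α t - y₀‖ * ‖chartΓ q (α t)‖ < ε / K at h1
        set v := deriv α t
        have h2 : -chartΓ q (α t) v v + (chartΓ q y₀ v v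
            + chartΓ q y₀ (α t - y₀) (-chartΓ q (α t) v v))
            = -((chartΓ q (α t) - chartΓ q y₀) v v)
              - chartΓ q y₀ (α t - y₀) (chartΓ q (α t) v v) := by
          simp only [_root_.sub_apply, map_neg]; abel
        rw [h2]
        calc _ ≤ ‖(chartΓ q (α t) - chartΓ q y₀) v v‖
              + ‖chartΓ q y₀ (α t - y₀) (chartΓ q (α t) v v)‖ := by
              refine (norm_sub_le _ _).trans ?_
              rw [norm_neg]
          _ ≤ ‖chartΓ q (α t) - chartΓ q y₀‖ * ‖v‖ * ‖v‖
              + ‖chartΓ q y₀‖ * ‖α t - y₀‖ * (‖chartΓ q (α t)‖ * ‖v‖ * ‖v‖) := by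
              refine add_le_add (norm_apply_apply_le _ _ _)
                ((norm_apply_apply_le _ _ _).trans ?_)
              gcongr
              exact norm_apply_apply_le _ _ _
          _ = (‖chartΓ q (α t) - chartΓ q y₀‖
              + ‖chartΓ q y₀‖ * ‖α t - y₀‖ * ‖chartΓ q (α t)‖) * ‖v‖ ^ 2 := by ring
          _ ≤ ε / K * (K * ‖a - d‖ ^ 2) := by
              gcongr
              exact hspeed t ht
          _ = ε * ‖a - d‖ ^ 2 := by field_simp)
    simp only [hα0, hα1] at key
    exact key

lemma nonneg_of_hasDerivAt_of_le {f : ℝ → ℝ} {f' : ℝ} (hf : HasDerivAt f f' 0)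
    (hmin : ∀ t ∈ Icc (0 : ℝ) 1, f 0 ≤ f t) : 0 ≤ f' := by
  have h1 : Tendsto (slope f 0) (𝓝[>] 0) (𝓝 f') :=
    (hasDerivAt_iff_tendsto_slope.mp hf).mono_left
      (nhdsWithin_mono _ fun x hx ↦ ne_of_gt hx)
  refine ge_of_tendsto h1 ?_
  filter_upwards [Ioo_mem_nhdsGT (zero_lt_one (α := ℝ))] with t ht
  rw [slope_def_field, sub_zero]
  exact div_nonneg (sub_nonneg.mpr (hmin t ⟨ht.1.le, ht.2.le⟩)) ht.1.le

lemma quadLog_self (Γ : E → E →L[ℝ] E →L[ℝ] E) (y : E) : quadLog Γ y y = 0 := by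
  simp [quadLog]

lemma continuous_quadLog (Γ : E → E →L[ℝ] E →L[ℝ] E) (y : E) : Continuous (quadLog Γ y) := by
  unfold quadLog
  fun_prop

/-- A closed convex set has, at each frontier point, a supporting half space up to an error of order
greater than two. The normal is a limit of directions from the nearest points in the set to points
outside the set. -/
lemma GeodConvex.exists_support {D : Set M} (hD : IsClosed D) (hconv : GeodConvex E D) {q : M}
    (hq : q ∈ frontier D) :
    ∃ L : E →L[ℝ] ℝ, L ≠ 0 ∧ ∀ ε > 0, ∀ᶠ y in 𝓝 (extChartAt 𝓘(ℝ, E) q q),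
      (extChartAt 𝓘(ℝ, E) q).symm y ∈ D →
        L (quadLog (chartΓ q) (extChartAt 𝓘(ℝ, E) q q) y)
          ≤ ε * ‖y - extChartAt 𝓘(ℝ, E) q q‖ ^ 2 := by
  have : ProperSpace E := FiniteDimensional.proper_real E
  obtain ⟨C, hC, hchord⟩ := hconv.exists_chord q
  set φ := extChartAt 𝓘(ℝ, E) q with hφ
  set y₀ := φ q with hy₀
  have hqs : q ∈ φ.source := mem_extChartAt_source q
  have hyt : y₀ ∈ φ.target := mem_extChartAt_target q
  have hLC := isLeviCivitaOn_chart (E := E) q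
  obtain ⟨R, hR, hRt⟩ := Metric.nhds_basis_closedBall.mem_iff.mp (hLC.isOpen.mem_nhds hyt)
  set B := chartG q y₀ with hB
  obtain ⟨C₁, hC₁, hBn⟩ := exists_norm_sq_le_of_pos B (hLC.pos y₀ hyt)
  set K := Metric.closedBall y₀ R ∩ φ.symm ⁻¹' D with hK
  have hsymm : ContinuousOn φ.symm φ.target := continuousOn_extChartAt_symm q
  have hKc : IsCompact K :=
    (isCompact_closedBall y₀ R).of_isClosed_subset
      ((hsymm.mono hRt).preimage_isClosed_of_isClosed Metric.isClosed_closedBall hD)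
      inter_subset_left
  have hy0K : y₀ ∈ K := by
    refine ⟨Metric.mem_closedBall_self hR.le, ?_⟩
    rw [mem_preimage, hy₀, φ.left_inv hqs]
    exact hD.frontier_subset hq
  obtain ⟨x, hxD, hxq⟩ : ∃ x : ℕ → M, (∀ n, x n ∈ Dᶜ) ∧ Tendsto x atTop (𝓝 q) := by
    refine mem_closure_iff_seq_limit.mp ?_
    rw [frontier_eq_closure_inter_closure] at hq
    exact hq.2
  set z := fun n ↦ φ (x n) with hz
  have hzy : Tendsto z atTop (𝓝 y₀) := (continuousAt_extChartAt q).tendsto.comp hxq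
  have hmin : ∀ n, ∃ d ∈ K, ∀ y ∈ K, B (d - z n) (d - z n) ≤ B (y - z n) (y - z n) := by
    intro n
    obtain ⟨d, hd, hdm⟩ := hKc.exists_isMinOn ⟨y₀, hy0K⟩
      (f := fun y ↦ B (y - z n) (y - z n)) (by fun_prop)
    exact ⟨d, hd, fun y hy ↦ hdm hy⟩
  choose d hdK hdmin using hmin
  -- `z n` converges to `q` from outside `D`, and `d n` is a nearest point to `z n` in `D`
  have hdz : Tendsto (fun n ↦ d n - z n) atTop (𝓝 0) := by
    have h1 : Tendsto (fun n ↦ C₁ * B (y₀ - z n) (y₀ - z n)) atTop (𝓝 0) := by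
      have hcont : Continuous fun y ↦ C₁ * B (y₀ - y) (y₀ - y) := by fun_prop
      have := (hcont.tendsto y₀).comp hzy
      simpa [Function.comp_def] using this
    have h2 : Tendsto (fun n ↦ ‖d n - z n‖ ^ 2) atTop (𝓝 0) := by
      refine squeeze_zero (fun n ↦ by positivity) (fun n ↦ ?_) h1
      refine (hBn _).trans ?_
      exact mul_le_mul_of_nonneg_left (hdmin n y₀ hy0K) hC₁.le
    have h3 : Tendsto (fun n ↦ √(‖d n - z n‖ ^ 2)) atTop (𝓝 0) := by
      have := h2.sqrt
      rwa [Real.sqrt_zero] at this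
    simp only [Real.sqrt_sq (norm_nonneg _)] at h3
    exact tendsto_zero_iff_norm_tendsto_zero.mpr h3
  have hdy : Tendsto d atTop (𝓝 y₀) := by
    have := hdz.add hzy
    simpa using this
  have hne : ∀ᶠ n in atTop, z n - d n ≠ 0 := by
    have h1 : ∀ᶠ n in atTop, x n ∈ φ.source := hxq (extChartAt_source_mem_nhds q)
    filter_upwards [h1] with n hn h0
    have h2 : φ.symm (d n) = x n := by
      rw [← sub_eq_zero.mp h0]
      exact φ.left_inv hn
    have h3 : φ.symm (d n) ∈ D := (hdK n).2
    rw [h2] at h3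
    exact hxD n h3
  set e := fun n ↦ ‖z n - d n‖⁻¹ • (z n - d n) with he
  have hes : ∀ᶠ n in atTop, e n ∈ Metric.sphere (0 : E) 1 := by
    filter_upwards [hne] with n hn
    rw [mem_sphere_zero_iff_norm]
    simp only [he]
    rw [norm_smul, norm_inv, norm_norm, inv_mul_cancel₀ (norm_ne_zero_iff.mpr hn)]
  obtain ⟨e₀, he₀, σ, hσ, hlim⟩ := (isCompact_sphere (0 : E) 1).tendsto_subseq' hes.frequently
  have hσt := hσ.tendsto_atTop
  have he0 : e₀ ≠ 0 := by
    rintro rfl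
    simp at he₀
  refine ⟨B.flip e₀, fun h ↦ ?_, fun ε hε ↦ ?_⟩
  · have := hLC.pos y₀ hyt e₀ he0
    have h2 : B e₀ e₀ = 0 := by rw [← ContinuousLinearMap.flip_apply, h]; rfl
    exact this.ne' h2
  obtain ⟨r, hr, hcr⟩ := hchord (ε / (‖B‖ + 1)) (by positivity) R hR
  filter_upwards [Metric.ball_mem_nhds y₀ hr] with a ha haD
  set N := quadLog (chartΓ q) y₀ with hN
  rw [ContinuousLinearMap.flip_apply]
  -- the inequality before passing to the limit
  have hn : ∀ᶠ n in atTop, B (N a) (e n) ≤ ‖B‖ * (ε / (‖B‖ + 1) * ‖a - d n‖ ^ 2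
      + ‖N (d n)‖ + ‖chartΓ q y₀‖ * ‖d n - y₀‖ * (C * ‖a - d n‖)) := by
    filter_upwards [hdy (Metric.ball_mem_nhds y₀ hr), hne, hes] with n hdn hnn hen
    obtain ⟨α, v, hα0, hαv, hαK, hv, hψ⟩ := hcr (d n) hdn a ha (hdK n).2 haD
    have hen1 : ‖e n‖ = 1 := mem_sphere_zero_iff_norm.mp hen
    -- the chord from `d n` to `a` stays in `D`, so it starts away from `z n`
    have hBv : B v (e n) ≤ 0 := by
      have h1 : HasDerivAt (fun t ↦ B (α t - z n) (α t - z n))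
          (B v (d n - z n) + B (d n - z n) v) 0 := by
        have h2 := hαv.sub_const (z n)
        refine (((hasDerivAt_const (0 : ℝ) B).clm_apply h2).clm_apply h2).congr_deriv ?_
        simp [hα0]
      have h3 := nonneg_of_hasDerivAt_of_le h1 fun t ht ↦ by
        rw [hα0]
        exact hdmin n _ ⟨Metric.ball_subset_closedBall (hαK t ht).1, (hαK t ht).2⟩
      rw [hLC.symm y₀ hyt (d n - z n) v] at h3
      have h4 : B v (e n) = -(‖z n - d n‖⁻¹ * B v (d n - z n)) := by
        simp only [he, map_smul, smul_eq_mul, map_sub]; ring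
      rw [h4, neg_nonpos]
      have : 0 ≤ B v (d n - z n) := by linarith
      positivity
    set w := N a - N (d n) - (v + chartΓ q y₀ (d n - y₀) v) with hw
    have h5 : N a = w + N (d n) + v + chartΓ q y₀ (d n - y₀) v := by rw [hw]; abel
    have hBe : ∀ u, B u (e n) ≤ ‖B‖ * ‖u‖ := fun u ↦ by
      have := (le_abs_self _).trans (norm_apply_apply_le B u (e n))
      rwa [hen1, mul_one] at this
    have h6 : ‖chartΓ q y₀ (d n - y₀) v‖ ≤ ‖chartΓ q y₀‖ * ‖d n - y₀‖ * (C * ‖a - d n‖) :=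
      (norm_apply_apply_le _ _ _).trans (by gcongr)
    rw [h5]
    simp only [map_add, _root_.add_apply]
    have h7 := hBe w
    have h8 := hBe (N (d n))
    have h9 := hBe (chartΓ q y₀ (d n - y₀) v)
    have h10 : ‖B‖ * ‖w‖ ≤ ‖B‖ * (ε / (‖B‖ + 1) * ‖a - d n‖ ^ 2) := by gcongr
    have h11 : ‖B‖ * ‖chartΓ q y₀ (d n - y₀) v‖
        ≤ ‖B‖ * (‖chartΓ q y₀‖ * ‖d n - y₀‖ * (C * ‖a - d n‖)) := by gcongr
    linarith
  have hl1 : Tendsto (fun k ↦ B (N a) (e (σ k))) atTop (𝓝 (B (N a) e₀)) :=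
    ((B (N a)).continuous.tendsto e₀).comp hlim
  have hl2 : Tendsto (fun n ↦ ‖B‖ * (ε / (‖B‖ + 1) * ‖a - d n‖ ^ 2
      + ‖N (d n)‖ + ‖chartΓ q y₀‖ * ‖d n - y₀‖ * (C * ‖a - d n‖))) atTop
      (𝓝 (‖B‖ * (ε / (‖B‖ + 1) * ‖a - y₀‖ ^ 2))) := by
    have hNc := continuous_quadLog (chartΓ q) y₀
    have hcont : Continuous fun y ↦ ‖B‖ * (ε / (‖B‖ + 1) * ‖a - y‖ ^ 2
      + ‖N y‖ + ‖chartΓ q y₀‖ * ‖y - y₀‖ * (C * ‖a - y‖)) := by fun_prop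
    have h1 := (hcont.tendsto y₀).comp hdy
    have h2 : N y₀ = 0 := quadLog_self _ _
    simpa [h2, Function.comp_def] using h1
  refine (le_of_tendsto_of_tendsto hl1 (hl2.comp hσt) (hσt.eventually hn)).trans ?_
  have h1 : ‖B‖ * (ε / (‖B‖ + 1)) ≤ ε := by
    rw [mul_div_assoc', div_le_iff₀ (by positivity)]
    nlinarith [norm_nonneg B]
  calc _ = (‖B‖ * (ε / (‖B‖ + 1))) * ‖a - y₀‖ ^ 2 := by ring
    _ ≤ _ := by gcongr

end HalfSpace

/-! ### The distance at the boundary -/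

section Initial

variable {E : Type*} [NormedAddCommGroup E] [NormedSpace ℝ E] [FiniteDimensional ℝ E]
  {M : Type*} [MetricSpace M] [ChartedSpace E M] [IsManifold 𝓘(ℝ, E) ∞ M]
  [RiemannianBundle (fun x : M ↦ TangentSpace 𝓘(ℝ, E) x)]
  [IsContMDiffRiemannianBundle 𝓘(ℝ, E) ∞ E (fun x : M ↦ TangentSpace 𝓘(ℝ, E) x)]
  [IsRiemannianManifold 𝓘(ℝ, E) M]

/-- The normal of a supporting half space at the foot of a shortest curve to the complement cannot
make an acute angle with the curve. -/
lemma metric_le_zero_of_support_pos {D : Set M} {q : M} {L : E →L[ℝ] ℝ}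
    (hL : ∀ ε > 0, ∀ᶠ y in 𝓝 (extChartAt 𝓘(ℝ, E) q q), (extChartAt 𝓘(ℝ, E) q).symm y ∈ D →
      L (quadLog (chartΓ q) (extChartAt 𝓘(ℝ, E) q q) y) ≤ ε * ‖y - extChartAt 𝓘(ℝ, E) q q‖ ^ 2)
    {γ : ℝ → M} {ℓ : ℝ} {ν : E} (h0 : γ 0 = q) (hγ : ContinuousAt γ 0)
    (hν : HasDerivAt (extChartAt 𝓘(ℝ, E) q ∘ γ) ν 0)
    (hℓ : chartG q (extChartAt 𝓘(ℝ, E) q q) ν ν = ℓ ^ 2) (hℓ0 : 0 ≤ ℓ)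
    (hdist : ∀ s ∈ Icc (0 : ℝ) 1, ∀ z ∈ Dᶜ, ℓ * s ≤ dist (γ s) z) {u : E} (hu : 0 < L u) :
    chartG q (extChartAt 𝓘(ℝ, E) q q) ν u ≤ 0 := by
  set φ := extChartAt 𝓘(ℝ, E) q with hφ
  set y₀ := φ q with hy₀
  have hqs : q ∈ φ.source := mem_extChartAt_source q
  have hyt : y₀ ∈ φ.target := mem_extChartAt_target q
  have hLC := isLeviCivitaOn_chart (E := E) q
  set B := chartG q y₀ with hB
  have hlin : Tendsto (fun τ : ℝ ↦ y₀ + τ • u) (𝓝[>] 0) (𝓝 y₀) := by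
    have : Continuous fun τ : ℝ ↦ y₀ + τ • u := by fun_prop
    have := (this.tendsto 0).mono_left (nhdsWithin_le_nhds (s := Ioi (0 : ℝ)))
    simpa using this
  -- by the support inequality, the direction `u` leads out of `D`
  have hout : ∀ᶠ τ : ℝ in 𝓝[>] 0, φ.symm (y₀ + τ • u) ∈ Dᶜ := by
    have h1 : Tendsto (fun τ : ℝ ↦ τ * (‖u‖ ^ 2 - 2⁻¹ * L (chartΓ q y₀ u u))) (𝓝[>] 0) (𝓝 0) := by
      have : Continuous fun τ : ℝ ↦ τ * (‖u‖ ^ 2 - 2⁻¹ * L (chartΓ q y₀ u u)) := by fun_prop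
      have := (this.tendsto 0).mono_left (nhdsWithin_le_nhds (s := Ioi (0 : ℝ)))
      simpa using this
    filter_upwards [hlin.eventually (hL 1 one_pos), h1.eventually (gt_mem_nhds hu),
      self_mem_nhdsWithin] with τ h2 h3 hτ hmem
    have hτ0 : 0 < τ := hτ
    have h4 := h2 hmem
    simp only [quadLog, add_sub_cancel_left, map_add, map_smul, _root_.smul_apply, smul_eq_mul,
      norm_smul, Real.norm_of_nonneg hτ0.le, one_mul] at h4
    have h5 : τ * L u ≤ τ * (τ * (‖u‖ ^ 2 - 2⁻¹ * L (chartΓ q y₀ u u))) := by linarith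
    have := le_of_mul_le_mul_left h5 hτ0
    linarith
  -- to first order in `τ`, the distance from `γ (K τ)` to the outer point `y₀ + τ u` is the norm of
  -- `τ (u - K ν)`, and it is at least `ℓ K τ`
  have key : ∀ K > 0, (ℓ * K) ^ 2 ≤ B (u - K • ν) (u - K • ν) := by
    intro K hK
    refine le_of_forall_pos_le_add fun ε hε ↦ ?_
    set ε' := ε / (‖u - K • ν‖ ^ 2 + 1) with hε'
    obtain ⟨r, hr, hd⟩ := exists_dist_symm_sq_le (E := E) q hyt (ε := ε') (by positivity)
    have hKτ : Tendsto (fun τ : ℝ ↦ K * τ) (𝓝[>] 0) (𝓝[>] 0) := by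
      refine tendsto_nhdsWithin_iff.mpr ⟨?_, ?_⟩
      · have : Continuous fun τ : ℝ ↦ K * τ := by fun_prop
        have := (this.tendsto 0).mono_left (nhdsWithin_le_nhds (s := Ioi (0 : ℝ)))
        simpa using this
      · filter_upwards [self_mem_nhdsWithin] with τ hτ using mul_pos hK hτ
    have hγs : ∀ᶠ s : ℝ in 𝓝[>] 0,
        γ s ∈ φ.source ∧ φ (γ s) ∈ Metric.ball y₀ r ∧ s ∈ Icc (0 : ℝ) 1 := by
      have h1 : ∀ᶠ s : ℝ in 𝓝 0, γ s ∈ φ.source :=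
        hγ.preimage_mem_nhds (by rw [h0]; exact extChartAt_source_mem_nhds q)
      have h2 : ∀ᶠ s : ℝ in 𝓝 0, φ (γ s) ∈ Metric.ball y₀ r := by
        refine hν.continuousAt.preimage_mem_nhds ?_
        simp only [Function.comp_apply, h0]
        exact Metric.ball_mem_nhds _ hr
      filter_upwards [nhdsWithin_le_nhds h1, nhdsWithin_le_nhds h2,
        Ioo_mem_nhdsGT (zero_lt_one (α := ℝ))] with s h1 h2 h3 using ⟨h1, h2, h3.1.le, h3.2.le⟩
    have hw : Tendsto (fun τ : ℝ ↦ τ⁻¹ • (y₀ + τ • u - φ (γ (K * τ))))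
        (𝓝[>] 0) (𝓝 (u - K • ν)) := by
      have h1 : HasDerivAt (fun τ : ℝ ↦ τ • u - φ (γ (K * τ))) (u - K • ν) 0 := by
        have h2 : HasDerivAt (fun τ : ℝ ↦ K * τ) K 0 := by
          simpa using (hasDerivAt_id (0 : ℝ)).const_mul K
        have h3 : HasDerivAt (φ ∘ γ) ν (K * 0) := by rwa [mul_zero]
        have h4 : HasDerivAt (fun τ : ℝ ↦ τ • u) u 0 := by
          simpa using (hasDerivAt_id (0 : ℝ)).smul_const u
        exact h4.sub (h3.scomp (0 : ℝ) h2)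
      have h5 := (hasDerivAt_iff_tendsto_slope.mp h1).mono_left
        (nhdsWithin_mono (0 : ℝ) fun x (hx : x ∈ Ioi 0) ↦ ne_of_gt hx)
      refine h5.congr fun τ ↦ ?_
      rw [slope_def_module, sub_zero]
      congr 1
      simp only [zero_smul, mul_zero, h0]
      rw [← hy₀]
      abel
    have hlim : Tendsto (fun τ : ℝ ↦ B (τ⁻¹ • (y₀ + τ • u - φ (γ (K * τ))))
        (τ⁻¹ • (y₀ + τ • u - φ (γ (K * τ)))) + ε' * ‖τ⁻¹ • (y₀ + τ • u - φ (γ (K * τ)))‖ ^ 2)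
        (𝓝[>] 0) (𝓝 (B (u - K • ν) (u - K • ν) + ε' * ‖u - K • ν‖ ^ 2)) := by
      have hcont : Continuous fun w : E ↦ B w w + ε' * ‖w‖ ^ 2 := by fun_prop
      exact (hcont.tendsto _).comp hw
    have hle : (ℓ * K) ^ 2 ≤ B (u - K • ν) (u - K • ν) + ε' * ‖u - K • ν‖ ^ 2 := by
      refine ge_of_tendsto hlim ?_
      filter_upwards [hout, hKτ.eventually hγs, hlin (Metric.ball_mem_nhds y₀ hr),
        self_mem_nhdsWithin] with τ h1 h2 h3 hτ
      have hτ0 : 0 < τ := hτ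
      have h4 := hdist (K * τ) h2.2.2 _ h1
      have h5 := hd _ h2.2.1 _ h3
      rw [φ.left_inv h2.1] at h5
      have h6 := h4.trans h5
      set w := y₀ + τ • u - φ (γ (K * τ)) with hw
      have h7 : 0 ≤ B w w := hLC.nonneg hyt _
      have h8 : (ℓ * (K * τ)) ^ 2 ≤ B w w + ε' * ‖w‖ ^ 2 := by
        have h9 : 0 ≤ ℓ * (K * τ) := by positivity
        calc _ ≤ (√(B w w + ε' * ‖w‖ ^ 2)) ^ 2 := by gcongr
          _ = _ := Real.sq_sqrt (by positivity)
      simp only [map_smul, _root_.smul_apply, smul_eq_mul, norm_smul, norm_inv,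
        Real.norm_of_nonneg hτ0.le]
      have h10 : τ⁻¹ * (τ⁻¹ * B w w) + ε' * (τ⁻¹ * ‖w‖) ^ 2
          = (B w w + ε' * ‖w‖ ^ 2) / τ ^ 2 := by field_simp
      rw [h10, le_div_iff₀ (by positivity)]
      linarith
    refine hle.trans ?_
    gcongr
    rw [hε', div_mul_eq_mul_div, div_le_iff₀ (by positivity)]
    nlinarith
  -- expanding the square, `2 K ⟨ν, u⟩ ≤ |u|²` for all `K > 0`
  by_contra hpos
  push Not at hpos
  have h1 := key ((B u u + 1) / B ν u) (div_pos (by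
    have : 0 ≤ B u u := hLC.nonneg hyt _
    linarith) hpos)
  set K := (B u u + 1) / B ν u with hK
  have h2 : K * B ν u = B u u + 1 := by rw [hK]; field_simp
  have h3 : 0 ≤ B u u := hLC.nonneg hyt _
  simp only [map_sub, map_smul, _root_.sub_apply, _root_.smul_apply, smul_eq_mul, hℓ] at h1
  rw [hLC.symm y₀ hyt u ν] at h1
  nlinarith

/-- Points reached from the foot of a shortest curve to the complement of a convex set by second
order geodesics orthogonal to the curve are outside the set, up to an error of order greater than
two: pushing them by `δ |w|²` against the curve violates the support inequality. -/
lemma GeodConvex.infDist_quadExp_le {D : Set M} (hD : IsClosed D) (hconv : GeodConvex E D) {q : M}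
    (hq : q ∈ frontier D) {γ : ℝ → M} {ℓ : ℝ} {ν : E} (h0 : γ 0 = q) (hγ : ContinuousAt γ 0)
    (hν : HasDerivAt (extChartAt 𝓘(ℝ, E) q ∘ γ) ν 0)
    (hℓ : chartG q (extChartAt 𝓘(ℝ, E) q q) ν ν = ℓ ^ 2) (hℓ0 : 0 < ℓ)
    (hdist : ∀ s ∈ Icc (0 : ℝ) 1, ∀ z ∈ Dᶜ, ℓ * s ≤ dist (γ s) z) {ε : ℝ} (hε : 0 < ε) :
    ∀ᶠ w in 𝓝 (0 : E), chartG q (extChartAt 𝓘(ℝ, E) q q) w ν = 0 →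
      Metric.infDist ((extChartAt 𝓘(ℝ, E) q).symm
        (quadExp (chartΓ q) (extChartAt 𝓘(ℝ, E) q q) w)) Dᶜ ≤ ε * ‖w‖ ^ 2 := by
  obtain ⟨L, hL0, hL⟩ := hconv.exists_support hD hq
  have hpos : ∀ u, 0 < L u → chartG q (extChartAt 𝓘(ℝ, E) q q) ν u ≤ 0 := fun u hu ↦
    metric_le_zero_of_support_pos hL h0 hγ hν hℓ hℓ0.le hdist hu
  set φ := extChartAt 𝓘(ℝ, E) q with hφ
  set y₀ := φ q with hy₀
  have hqs : q ∈ φ.source := mem_extChartAt_source q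
  have hyt : y₀ ∈ φ.target := mem_extChartAt_target q
  have hLC := isLeviCivitaOn_chart (E := E) q
  set B := chartG q y₀ with hB
  have hB0 : 0 < B ν ν := by rw [hℓ]; positivity
  -- the supporting functional vanishes on the orthogonal complement of `ν`
  have hneg : ∀ w, B ν w = 0 → L w ≤ 0 := by
    intro w hw
    by_contra hlt
    push Not at hlt
    have h1 : ∀ δ : ℝ, 0 < δ → L (w + δ • ν) ≤ 0 := by
      intro δ hδ
      by_contra h
      have := hpos _ (not_le.mp h)
      simp only [map_add, map_smul, smul_eq_mul, hw, zero_add] at this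
      have : 0 < δ * B ν ν := by positivity
      linarith
    have h2 : Tendsto (fun δ : ℝ ↦ L (w + δ • ν)) (𝓝[>] 0) (𝓝 (L w)) := by
      have : Continuous fun δ : ℝ ↦ L (w + δ • ν) := by fun_prop
      have := (this.tendsto 0).mono_left (nhdsWithin_le_nhds (s := Ioi (0 : ℝ)))
      simpa using this
    have := le_of_tendsto h2 (by filter_upwards [self_mem_nhdsWithin] with δ hδ using h1 δ hδ)
    linarith
  have hperp : ∀ w, B ν w = 0 → L w = 0 := fun w hw ↦
    le_antisymm (hneg w hw) (by
      have := hneg (-w) (by simp [hw])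
      simpa using this)
  have hLν : L ν < 0 := by
    refine lt_of_le_of_ne ?_ fun h ↦ hL0 ?_
    · by_contra h
      have := hpos ν (not_le.mp h)
      linarith
    · ext u
      have h1 : L (u - (B ν u / B ν ν) • ν) = 0 := hperp _ (by
        simp only [map_sub, map_smul, smul_eq_mul]
        field_simp
        simp)
      simpa [h] using h1
  obtain ⟨C, hC, r, hr, hlip⟩ := exists_dist_symm_le (E := E) q hyt
  set δ := ε / (C * (‖ν‖ + 1)) with hδ
  have hδ0 : 0 < δ := by positivity
  set a : E → E := fun w ↦ quadExp (chartΓ q) y₀ w - (δ * ‖w‖ ^ 2) • ν with ha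
  have hqe : Continuous (quadExp (chartΓ q) y₀) := by unfold quadExp; fun_prop
  have hac : Continuous a := by simp only [ha]; fun_prop
  have hqe0 : Tendsto (quadExp (chartΓ q) y₀) (𝓝 0) (𝓝 y₀) := by
    have := hqe.tendsto 0
    simpa [quadExp] using this
  have ha0 : Tendsto a (𝓝 0) (𝓝 y₀) := by
    have := hac.tendsto 0
    simpa [ha, quadExp] using this
  set Γ₀ := chartΓ q y₀ with hΓ₀
  -- the displacement `a w - y₀` differs from `w` by a quadratic term
  set c := ‖Γ₀‖ + δ * ‖ν‖ with hc
  have hcle : ∀ w, ‖(a w - y₀) - w‖ ≤ c * ‖w‖ ^ 2 := by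
    intro w
    have h1 : (a w - y₀) - w = -((2⁻¹ : ℝ) • Γ₀ w w) - (δ * ‖w‖ ^ 2) • ν := by
      simp only [ha, quadExp]; abel
    rw [h1]
    have h2 := norm_apply_apply_le Γ₀ w w
    have h3 : ‖(2⁻¹ : ℝ)‖ ≤ 1 := by norm_num
    calc _ ≤ ‖(2⁻¹ : ℝ) • Γ₀ w w‖ + ‖(δ * ‖w‖ ^ 2) • ν‖ := by
          refine (norm_sub_le _ _).trans ?_
          rw [norm_neg]
      _ ≤ 1 * (‖Γ₀‖ * ‖w‖ * ‖w‖) + (δ * ‖w‖ ^ 2) * ‖ν‖ := by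
          rw [norm_smul, norm_smul, Real.norm_of_nonneg (by positivity : 0 ≤ δ * ‖w‖ ^ 2)]
          gcongr
      _ = c * ‖w‖ ^ 2 := by rw [hc]; ring
  have hsm1 : ∀ᶠ w in 𝓝 (0 : E), c * ‖w‖ < 1 := by
    have : Continuous fun w : E ↦ c * ‖w‖ := by fun_prop
    have := this.tendsto 0
    simp only [norm_zero, mul_zero] at this
    exact this.eventually (gt_mem_nhds one_pos)
  have hm : 0 < δ * (-L ν) / 4 := by
    have : 0 < -L ν := by linarith
    positivity
  have hsm2 : ∀ᶠ w in 𝓝 (0 : E), ‖L‖ * (‖Γ₀‖ * c * 3) * ‖w‖ < δ * (-L ν) / 4 := by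
    have : Continuous fun w : E ↦ ‖L‖ * (‖Γ₀‖ * c * 3) * ‖w‖ := by fun_prop
    have := this.tendsto 0
    simp only [norm_zero, mul_zero] at this
    exact this.eventually (gt_mem_nhds hm)
  -- the pushed points `a w` violate the support inequality, unless `w = 0`
  have hfin : ∀ᶠ w in 𝓝 (0 : E), B w ν = 0 → φ.symm (a w) ∈ D → w = 0 := by
    filter_upwards [ha0.eventually (hL (δ * (-L ν) / 16) (by
      have : 0 < -L ν := by linarith
      positivity)), hsm1, hsm2] with w h1 h2 h3 hw hmem
    by_contra hw0
    have hwn : 0 < ‖w‖ := norm_pos_iff.mpr hw0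
    have h4 := h1 hmem
    set b := a w - y₀ with hb
    have hbw := hcle w
    rw [← hb] at hbw
    have hb2 : ‖b‖ ≤ 2 * ‖w‖ := by
      calc ‖b‖ = ‖(b - w) + w‖ := by simp
        _ ≤ ‖b - w‖ + ‖w‖ := norm_add_le _ _
        _ ≤ 2 * ‖w‖ := by nlinarith
    have h5 : quadLog (chartΓ q) y₀ (a w)
        = w - (δ * ‖w‖ ^ 2) • ν + (2⁻¹ : ℝ) • (Γ₀ (b - w) b + Γ₀ w (b - w)) := by
      have : b = w - (2⁻¹ : ℝ) • Γ₀ w w - (δ * ‖w‖ ^ 2) • ν := by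
        simp only [hb, ha, quadExp]; abel
      rw [quadLog, ← hb, ← hΓ₀]
      have h6 : Γ₀ b b = Γ₀ (b - w) b + Γ₀ w (b - w) + Γ₀ w w := by
        simp only [map_sub, _root_.sub_apply]; abel
      rw [h6]
      nth_rewrite 1 [this]
      module
    rw [h5] at h4
    simp only [map_add, map_sub, map_smul, smul_eq_mul] at h4
    rw [hperp w (by rw [hLC.symm y₀ hyt]; exact hw)] at h4
    have h6 : ‖Γ₀ (b - w) b + Γ₀ w (b - w)‖ ≤ ‖Γ₀‖ * c * 3 * ‖w‖ ^ 3 := by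
      calc _ ≤ ‖Γ₀‖ * ‖b - w‖ * ‖b‖ + ‖Γ₀‖ * ‖w‖ * ‖b - w‖ :=
            (norm_add_le _ _).trans (add_le_add (norm_apply_apply_le _ _ _)
              (norm_apply_apply_le _ _ _))
        _ ≤ ‖Γ₀‖ * (c * ‖w‖ ^ 2) * (2 * ‖w‖) + ‖Γ₀‖ * ‖w‖ * (c * ‖w‖ ^ 2) := by gcongr
        _ = _ := by ring
    have h7 : |L (Γ₀ (b - w) b + Γ₀ w (b - w))| ≤ (δ * (-L ν) / 4) * ‖w‖ ^ 2 := by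
      calc _ ≤ ‖L‖ * (‖Γ₀‖ * c * 3 * ‖w‖ ^ 3) := (L.le_opNorm _).trans (by gcongr)
        _ = (‖L‖ * (‖Γ₀‖ * c * 3) * ‖w‖) * ‖w‖ ^ 2 := by ring
        _ ≤ _ := by gcongr
    rw [map_add] at h7
    have h8 := abs_le.mp h7
    have h9 : δ * (-L ν) / 16 * ‖b‖ ^ 2 ≤ δ * (-L ν) / 16 * (2 * ‖w‖) ^ 2 := by
      have : 0 ≤ δ * (-L ν) / 16 := by linarith
      gcongr
    have h10 : 0 < δ * (-L ν) * ‖w‖ ^ 2 := by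
      have : 0 < -L ν := by linarith
      positivity
    simp only [map_sub, _root_.sub_apply] at h4 h8
    nlinarith
  have hqc : q ∈ closure Dᶜ := by
    rw [frontier_eq_closure_inter_closure] at hq
    exact hq.2
  filter_upwards [hfin, ha0 (Metric.ball_mem_nhds y₀ hr), hqe0 (Metric.ball_mem_nhds y₀ hr)]
    with w h1 h2 h3 hw
  by_cases hmem : φ.symm (a w) ∈ D
  · have hw0 := h1 hw hmem
    subst hw0
    have h4 : φ.symm (quadExp (chartΓ q) y₀ 0) = q := by
      simp only [quadExp, add_zero, map_zero, smul_zero, sub_zero]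
      exact φ.left_inv hqs
    rw [h4, Metric.infDist_zero_of_mem_closure hqc]
    simp
  · refine (Metric.infDist_le_dist_of_mem hmem).trans ((hlip _ h3 _ h2).trans ?_)
    have h4 : ‖a w - quadExp (chartΓ q) y₀ w‖ = δ * ‖w‖ ^ 2 * ‖ν‖ := by
      simp only [ha, sub_sub_cancel_left, norm_neg, norm_smul,
        Real.norm_of_nonneg (by positivity : 0 ≤ δ * ‖w‖ ^ 2)]
    rw [h4, hδ]
    calc C * (ε / (C * (‖ν‖ + 1)) * ‖w‖ ^ 2 * ‖ν‖)
        = (ε * ‖w‖ ^ 2) * (‖ν‖ / (‖ν‖ + 1)) := by field_simp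
      _ ≤ (ε * ‖w‖ ^ 2) * 1 := by
          gcongr
          rw [div_le_one (by positivity)]
          linarith
      _ = _ := mul_one _

end Initial

/-! ### Variations by approximately parallel fields -/

section Variation

variable {E : Type*} [NormedAddCommGroup E] [NormedSpace ℝ E]
  (G : E → E →L[ℝ] E →L[ℝ] ℝ) (Γ : E → E →L[ℝ] E →L[ℝ] E) (α : ℝ → E)

/-- The first order approximation `w - (t - s) Γ(α'(s), w)` of the parallel transport from `α s` to
`α t`, followed by the projection to the orthogonal complement of `α'(t)`. Along a geodesic, the
result is parallel to first order at `t = s`, and it is explicit, unlike parallel transport. -/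
def normalTransport (t s : ℝ) : E →L[ℝ] E :=
  (ContinuousLinearMap.id ℝ E - (t - s) • Γ (α s) (deriv α s))
    - (G (α t) (deriv α t) (deriv α t))⁻¹ •
      ((G (α t) (deriv α t)).comp
        (ContinuousLinearMap.id ℝ E - (t - s) • Γ (α s) (deriv α s))).smulRight (deriv α t)

/-- The pull-back of the metric by `normalTransport`. -/
def normalMetric (t s : ℝ) : E →L[ℝ] E →L[ℝ] ℝ :=
  (((G (α t)).comp (normalTransport G Γ α t s)).flip.comp (normalTransport G Γ α t s)).flip

/-- The variation of the curve `α` along the normal field `φ(t) normalTransport t s w`; the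
parameters are `(t, s, w)`. -/
def variation (φ : ℝ → ℝ) (z : ℝ × ℝ × E) : E :=
  quadExp Γ (α z.1) (φ z.1 • normalTransport G Γ α z.1 z.2.1 z.2.2)

/-- The squared speed of `variation` in the first parameter. -/
def variationSpeedSq (φ : ℝ → ℝ) (z : ℝ × ℝ × E) : ℝ :=
  G (variation G Γ α φ z) (fderiv ℝ (variation G Γ α φ) z (1, 0, 0))
    (fderiv ℝ (variation G Γ α φ) z (1, 0, 0))

variable {G Γ α} {U : Set E} {φ : ℝ → ℝ} {t₀ ℓ : ℝ}

lemma normalMetric_apply (t s : ℝ) (v w : E) : normalMetric G Γ α t s v w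
    = G (α t) (normalTransport G Γ α t s v) (normalTransport G Γ α t s w) := rfl

lemma normalTransport_self {s : ℝ} {w : E} (hw : G (α s) (deriv α s) w = 0) :
    normalTransport G Γ α s s w = w := by
  simp [normalTransport, hw]

lemma metric_normalTransport {t s : ℝ} (h : G (α t) (deriv α t) (deriv α t) ≠ 0) (w : E) :
    G (α t) (deriv α t) (normalTransport G Γ α t s w) = 0 := by
  simp only [normalTransport, _root_.sub_apply, _root_.smul_apply, map_sub, map_smul,
    ContinuousLinearMap.smulRight_apply, smul_eq_mul, ContinuousLinearMap.comp_apply]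
  field_simp
  ring

variable [FiniteDimensional ℝ E] (h : IsLeviCivitaOn G Γ U) (hα : ContDiffAt ℝ ∞ α t₀)
  (hU : α t₀ ∈ U) (hne : deriv α t₀ ≠ 0)

include h hα hU hne

lemma contDiffAt_normalTransport :
    ContDiffAt ℝ ∞ (fun z : ℝ × ℝ ↦ normalTransport G Γ α z.1 z.2) (t₀, t₀) := by
  have hα' := deriv_contDiffAt hα
  have a1 : ContDiffAt ℝ ∞ (fun z : ℝ × ℝ ↦ α z.1) (t₀, t₀) :=
    ContDiffAt.comp (t₀, t₀) hα contDiffAt_fst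
  have a2 : ContDiffAt ℝ ∞ (fun z : ℝ × ℝ ↦ α z.2) (t₀, t₀) :=
    ContDiffAt.comp (t₀, t₀) hα contDiffAt_snd
  have d1 : ContDiffAt ℝ ∞ (fun z : ℝ × ℝ ↦ deriv α z.1) (t₀, t₀) :=
    ContDiffAt.comp (t₀, t₀) hα' contDiffAt_fst
  have d2 : ContDiffAt ℝ ∞ (fun z : ℝ × ℝ ↦ deriv α z.2) (t₀, t₀) :=
    ContDiffAt.comp (t₀, t₀) hα' contDiffAt_snd
  have g1 : ContDiffAt ℝ ∞ (fun z : ℝ × ℝ ↦ G (α z.1)) (t₀, t₀) :=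
    ContDiffAt.comp (t₀, t₀) (h.contDiffAt_metric hU) a1
  have g2 : ContDiffAt ℝ ∞ (fun z : ℝ × ℝ ↦ Γ (α z.2)) (t₀, t₀) :=
    ContDiffAt.comp (t₀, t₀) (h.contDiffAt_gamma hU) a2
  have b1 : ContDiffAt ℝ ∞ (fun z : ℝ × ℝ ↦
      ContinuousLinearMap.id ℝ E - (z.1 - z.2) • Γ (α z.2) (deriv α z.2)) (t₀, t₀) :=
    contDiffAt_const.sub ((contDiffAt_fst.sub contDiffAt_snd).smul (g2.clm_apply d2))
  have b2 : ContDiffAt ℝ ∞ (fun z : ℝ × ℝ ↦ (G (α z.1) (deriv α z.1) (deriv α z.1))⁻¹)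
      (t₀, t₀) :=
    ((g1.clm_apply d1).clm_apply d1).inv (h.pos _ hU _ hne).ne'
  exact b1.sub (b2.smul (((g1.clm_apply d1).clm_comp b1).smulRight d1))

lemma contDiffAt_normalMetric :
    ContDiffAt ℝ ∞ (fun z : ℝ × ℝ ↦ normalMetric G Γ α z.1 z.2) (t₀, t₀) := by
  have b := contDiffAt_normalTransport h hα hU hne
  have a1 : ContDiffAt ℝ ∞ (fun z : ℝ × ℝ ↦ α z.1) (t₀, t₀) :=
    ContDiffAt.comp (t₀, t₀) hα contDiffAt_fst
  have g1 : ContDiffAt ℝ ∞ (fun z : ℝ × ℝ ↦ G (α z.1)) (t₀, t₀) :=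
    ContDiffAt.comp (t₀, t₀) (h.contDiffAt_metric hU) a1
  exact (ContinuousLinearMap.flipₗᵢ ℝ E E ℝ).contDiff.contDiffAt.comp (t₀, t₀)
    (((ContinuousLinearMap.flipₗᵢ ℝ E E ℝ).contDiff.contDiffAt.comp (t₀, t₀)
      (g1.clm_comp b)).clm_comp b)

lemma contDiffAt_variation (hφ : ContDiff ℝ ∞ φ) :
    ContDiffAt ℝ ∞ (variation G Γ α φ) (t₀, t₀, 0) := by
  have a1 : ContDiffAt ℝ ∞ (fun z : ℝ × ℝ × E ↦ α z.1) (t₀, t₀, 0) :=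
    ContDiffAt.comp (t₀, t₀, 0) hα contDiffAt_fst
  have g1 : ContDiffAt ℝ ∞ (fun z : ℝ × ℝ × E ↦ Γ (α z.1)) (t₀, t₀, 0) :=
    ContDiffAt.comp (t₀, t₀, 0) (h.contDiffAt_gamma hU) a1
  have p1 : ContDiffAt ℝ ∞ (fun z : ℝ × ℝ × E ↦ (z.1, z.2.1)) (t₀, t₀, 0) := by fun_prop
  have b1 : ContDiffAt ℝ ∞ (fun z : ℝ × ℝ × E ↦ normalTransport G Γ α z.1 z.2.1) (t₀, t₀, 0) :=
    ContDiffAt.comp (t₀, t₀, 0)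
      (g := fun z : ℝ × ℝ ↦ normalTransport G Γ α z.1 z.2)
      (contDiffAt_normalTransport h hα hU hne) p1
  have w1 : ContDiffAt ℝ ∞ (fun z : ℝ × ℝ × E ↦
      φ z.1 • normalTransport G Γ α z.1 z.2.1 z.2.2) (t₀, t₀, 0) :=
    (hφ.contDiffAt.comp (t₀, t₀, 0) contDiffAt_fst).smul
      (b1.clm_apply (contDiffAt_snd.comp (t₀, t₀, (0 : E)) contDiffAt_snd))
  exact (a1.add w1).sub (contDiffAt_const.smul ((g1.clm_apply w1).clm_apply w1))

lemma contDiffAt_variationSpeedSq (hφ : ContDiff ℝ ∞ φ) :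
    ContDiffAt ℝ ∞ (variationSpeedSq G Γ α φ) (t₀, t₀, 0) := by
  have hY := contDiffAt_variation h hα hU hne hφ
  have hY' : ContDiffAt ℝ ∞ (fun z ↦ fderiv ℝ (variation G Γ α φ) z (1, 0, 0)) (t₀, t₀, 0) :=
    (hY.fderiv_right (m := ∞) (by simp)).clm_apply contDiffAt_const
  have h0 : variation G Γ α φ (t₀, t₀, 0) = α t₀ := by simp [variation, quadExp]
  have hG : ContDiffAt ℝ ∞ (fun z ↦ G (variation G Γ α φ z)) (t₀, t₀, 0) :=
    ContDiffAt.comp (t₀, t₀, 0) (by rw [h0]; exact h.contDiffAt_metric hU) hY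
  exact (hG.clm_apply hY').clm_apply hY'

/-- The velocity of the curves of the variation, expanded exactly in the size `e` of the variation;
`W'` is the derivative of the variation field. -/
lemma eventually_fderiv_variation (hφ : ContDiff ℝ ∞ φ) :
    ∀ᶠ z : ℝ × ℝ in 𝓝 (t₀, t₀), ∀ w : E, ∃ W' : E,
      HasDerivAt (fun t ↦ φ t • normalTransport G Γ α t z.2 w) W' z.1 ∧
      ∀ᶠ e : ℝ in 𝓝 0, fderiv ℝ (variation G Γ α φ) (z.1, z.2, e • w) (1, 0, 0)
        = deriv α z.1 + e • W' - e ^ 2 • ((2⁻¹ : ℝ) • fderiv ℝ Γ (α z.1) (deriv α z.1)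
            (φ z.1 • normalTransport G Γ α z.1 z.2 w) (φ z.1 • normalTransport G Γ α z.1 z.2 w)
          + (2⁻¹ : ℝ) • (Γ (α z.1) W' (φ z.1 • normalTransport G Γ α z.1 z.2 w)
          + Γ (α z.1) (φ z.1 • normalTransport G Γ α z.1 z.2 w) W')) := by
  have h1 : ∀ᶠ z : ℝ × ℝ in 𝓝 (t₀, t₀),
      ContDiffAt ℝ 1 (fun z : ℝ × ℝ ↦ normalTransport G Γ α z.1 z.2) z :=
    ((contDiffAt_normalTransport h hα hU hne).of_le (by simp)).eventually (by simp)
  have h2 : ∀ᶠ t in 𝓝 t₀, ContDiffAt ℝ 1 α t ∧ α t ∈ U :=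
    ((hα.of_le (by simp)).eventually (by simp)).and
      (hα.continuousAt.preimage_mem_nhds (h.isOpen.mem_nhds hU))
  have h3 : ∀ᶠ z : ℝ × ℝ × E in 𝓝 (t₀, t₀, 0), ContDiffAt ℝ 1 (variation G Γ α φ) z :=
    ((contDiffAt_variation h hα hU hne hφ).of_le (by simp)).eventually (by simp)
  have h4 : ∀ᶠ z : ℝ × ℝ in 𝓝 (t₀, t₀), ∀ᶠ z' : ℝ × ℝ × E in 𝓝 (z.1, z.2, 0),
      ContDiffAt ℝ 1 (variation G Γ α φ) z' := by
    have hc : Tendsto (fun z : ℝ × ℝ ↦ (z.1, z.2, (0 : E))) (𝓝 (t₀, t₀)) (𝓝 (t₀, t₀, 0)) :=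
      Continuous.tendsto (by fun_prop) _
    exact hc.eventually h3.eventually_nhds
  have h5 : ∀ᶠ z : ℝ × ℝ in 𝓝 (t₀, t₀), ContDiffAt ℝ 1 α z.1 ∧ α z.1 ∈ U :=
    (continuous_fst.tendsto (t₀, t₀)).eventually h2
  filter_upwards [h1, h4, h5] with z hz1 hz4 hz5 w
  have e1 : DifferentiableAt ℝ (fun t ↦ normalTransport G Γ α t z.2) z.1 :=
    DifferentiableAt.comp (g := fun z : ℝ × ℝ ↦ normalTransport G Γ α z.1 z.2)
      (f := fun t ↦ (t, z.2)) z.1 (hz1.differentiableAt (by simp)) (by fun_prop)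
  have e2 : DifferentiableAt ℝ (fun t ↦ φ t • normalTransport G Γ α t z.2 w) z.1 :=
    ((hφ.differentiable (by simp)) z.1).smul (e1.clm_apply (differentiableAt_const w))
  refine ⟨_, e2.hasDerivAt, ?_⟩
  set W := fun t ↦ φ t • normalTransport G Γ α t z.2 w with hW
  have e3 := (hz5.1.differentiableAt (by simp)).hasDerivAt
  have e4 : HasDerivAt (fun t ↦ Γ (α t)) (fderiv ℝ Γ (α z.1) (deriv α z.1)) z.1 :=
    ((h.contDiffAt_gamma hz5.2).differentiableAt (by simp)).hasFDerivAt.comp_hasDerivAt z.1 e3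
  have hc : Tendsto (fun e : ℝ ↦ (z.1, z.2, e • w)) (𝓝 0) (𝓝 (z.1, z.2, (0 : E))) := by
    have : Continuous fun e : ℝ ↦ (z.1, z.2, e • w) := by fun_prop
    simpa using this.tendsto 0
  filter_upwards [hc.eventually hz4] with e he
  have e5 : HasDerivAt (fun t ↦ variation G Γ α φ (t, z.2, e • w))
      (fderiv ℝ (variation G Γ α φ) (z.1, z.2, e • w) (1, 0, 0)) z.1 :=
    (he.differentiableAt (by simp)).hasFDerivAt.comp_hasDerivAt (f := fun t ↦ (t, z.2, e • w)) z.1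
      ((hasDerivAt_id z.1).prodMk (hasDerivAt_const z.1 (z.2, e • w)))
  have e6 := e2.hasDerivAt
  have e7 := (e3.add (e6.const_smul e)).sub
    ((((e4.clm_apply e6).clm_apply e6).const_smul (e ^ 2)).const_smul (2⁻¹ : ℝ))
  have e8 : (fun t ↦ variation G Γ α φ (t, z.2, e • w))
      = fun t ↦ α t + e • W t - (2⁻¹ : ℝ) • e ^ 2 • Γ (α t) (W t) (W t) := by
    funext t
    simp only [variation, quadExp, hW, map_smul, _root_.smul_apply, smul_smul]
    congr 2
    · congr 1; ring
    · ring
  rw [e8] at e5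
  rw [e5.unique e7]
  simp only [_root_.add_apply, hW]
  module

end Variation

/-! ### The second variation formula -/

section SecondVariation

variable {E : Type*} [NormedAddCommGroup E] [NormedSpace ℝ E]
  {G : E → E →L[ℝ] E →L[ℝ] ℝ} {Γ : E → E →L[ℝ] E →L[ℝ] E} {U : Set E}

lemma IsLeviCivitaOn.fderiv_gamma_symm (h : IsLeviCivitaOn G Γ U) {y : E} (hy : y ∈ U) (z u v : E) :
    fderiv ℝ Γ y z u v = fderiv ℝ Γ y z v u := by
  have hd := ((h.contDiffAt_gamma hy).differentiableAt (by simp)).hasFDerivAt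
  have h1 : ∀ u v : E, HasFDerivAt (fun x ↦ Γ x u v)
      (((ContinuousLinearMap.apply ℝ E v).comp (ContinuousLinearMap.apply ℝ (E →L[ℝ] E) u)).comp
        (fderiv ℝ Γ y)) y := fun u v ↦
    ((ContinuousLinearMap.apply ℝ E v).comp
      (ContinuousLinearMap.apply ℝ (E →L[ℝ] E) u)).hasFDerivAt.comp y hd
  have h2 : (fun x ↦ Γ x u v) =ᶠ[𝓝 y] fun x ↦ Γ x v u := by
    filter_upwards [h.isOpen.mem_nhds hy] with x hx using h.gamma_symm x hx u v
  have h3 := (h1 u v).unique ((h1 v u).congr_of_eventuallyEq h2)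
  simpa using DFunLike.congr_fun h3 z

/-- The first variation of the squared norm of a vector field `u + e w' - e² S` along the second
order geodesic `e ↦ quadExp Γ y (e w)`. -/
lemma IsLeviCivitaOn.hasDerivAt_energy (h : IsLeviCivitaOn G Γ U) {y : E} (hy : y ∈ U)
    (u w w' S : E) :
    ∀ᶠ e : ℝ in 𝓝 0, HasDerivAt
      (fun e : ℝ ↦ G (quadExp Γ y (e • w)) (u + e • w' - e ^ 2 • S) (u + e • w' - e ^ 2 • S))
      (2 * G (quadExp Γ y (e • w)) (w' - (2 * e) • S
        + Γ (quadExp Γ y (e • w)) (w - e • Γ y w w) (u + e • w' - e ^ 2 • S))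
        (u + e • w' - e ^ 2 • S)) e := by
  have hP : ∀ e : ℝ, HasDerivAt (fun e : ℝ ↦ quadExp Γ y (e • w)) (w - e • Γ y w w) e := by
    intro e
    have h1 : (fun e : ℝ ↦ quadExp Γ y (e • w))
        = fun e : ℝ ↦ y + e • w - (e ^ 2 / 2) • Γ y w w := by
      funext e
      simp only [quadExp, map_smul, _root_.smul_apply, smul_smul]
      congr 2
      ring
    rw [h1]
    have h2 := (((hasDerivAt_id e).smul_const w).const_add y).sub
      ((((hasDerivAt_id e).pow 2).div_const 2).smul_const (Γ y w w))
    refine h2.congr_deriv ?_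
    simp
  have hZ : ∀ e : ℝ, HasDerivAt (fun e : ℝ ↦ u + e • w' - e ^ 2 • S) (w' - (2 * e) • S) e := by
    intro e
    have h2 := (((hasDerivAt_id e).smul_const w').const_add u).sub
      (((hasDerivAt_id e).pow 2).smul_const S)
    refine h2.congr_deriv ?_
    simp
  have h0 : quadExp Γ y ((0 : ℝ) • w) = y := by simp [quadExp]
  have hPU : ∀ᶠ e : ℝ in 𝓝 0, quadExp Γ y (e • w) ∈ U :=
    (hP 0).continuousAt.preimage_mem_nhds (by rw [h0]; exact h.isOpen.mem_nhds hy)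
  filter_upwards [hPU] with e he
  refine (h.hasDerivAt_metric he (hP e) (hZ e) (hZ e)).congr_deriv ?_
  rw [h.symm _ he (u + e • w' - e ^ 2 • S)]
  ring

/-- The second variation of the squared norm of a vector field `u + e w' - e² S` along the second
order geodesic `e ↦ quadExp Γ y (e w)`. -/
lemma IsLeviCivitaOn.deriv_deriv_energy (h : IsLeviCivitaOn G Γ U) {y : E} (hy : y ∈ U)
    (u w w' S : E) :
    deriv (deriv
      (fun e : ℝ ↦ G (quadExp Γ y (e • w)) (u + e • w' - e ^ 2 • S) (u + e • w' - e ^ 2 • S))) 0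
      = 2 * (G y (w' + Γ y w u) (w' + Γ y w u)
        + G y (- (2 : ℝ) • S + fderiv ℝ Γ y w w u - Γ y (Γ y w w) u + Γ y w w'
          + Γ y w (w' + Γ y w u)) u) := by
  have h1 := (h.hasDerivAt_energy hy u w w' S).mono fun e he ↦ he.deriv
  rw [EventuallyEq.deriv_eq h1]
  have h0 : quadExp Γ y ((0 : ℝ) • w) = y := by simp [quadExp]
  have hP : HasDerivAt (fun e : ℝ ↦ quadExp Γ y (e • w)) w 0 := by
    have h1 : (fun e : ℝ ↦ quadExp Γ y (e • w))
        = fun e : ℝ ↦ y + e • w - (e ^ 2 / 2) • Γ y w w := by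
      funext e
      simp only [quadExp, map_smul, _root_.smul_apply, smul_smul]
      congr 2
      ring
    rw [h1]
    have h2 := (((hasDerivAt_id (0 : ℝ)).smul_const w).const_add y).sub
      ((((hasDerivAt_id (0 : ℝ)).pow 2).div_const 2).smul_const (Γ y w w))
    refine h2.congr_deriv ?_
    simp
  have hZ : HasDerivAt (fun e : ℝ ↦ u + e • w' - e ^ 2 • S) w' 0 := by
    have h2 := (((hasDerivAt_id (0 : ℝ)).smul_const w').const_add u).sub
      (((hasDerivAt_id (0 : ℝ)).pow 2).smul_const S)
    refine h2.congr_deriv ?_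
    simp
  have hP' : HasDerivAt (fun e : ℝ ↦ w - e • Γ y w w) (-Γ y w w) 0 := by
    simpa using ((hasDerivAt_id (0 : ℝ)).smul_const (Γ y w w)).const_sub w
  have hZ' : HasDerivAt (fun e : ℝ ↦ w' - (2 * e) • S) (-((2 : ℝ) • S)) 0 := by
    simpa using (((hasDerivAt_id (0 : ℝ)).const_mul 2).smul_const S).const_sub w'
  have hΓ : HasDerivAt (fun e : ℝ ↦ Γ (quadExp Γ y (e • w))) (fderiv ℝ Γ y w) 0 := by
    have h2 : HasFDerivAt Γ (fderiv ℝ Γ y) (quadExp Γ y ((0 : ℝ) • w)) := by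
      rw [h0]
      exact ((h.contDiffAt_gamma hy).differentiableAt (by simp)).hasFDerivAt
    exact h2.comp_hasDerivAt (0 : ℝ) hP
  have hA := hZ'.add ((hΓ.clm_apply hP').clm_apply hZ)
  have h2 := (h.hasDerivAt_metric (c := fun e : ℝ ↦ quadExp Γ y (e • w)) (t := 0)
    (by rw [h0]; exact hy) hP hA hZ).const_mul 2
  have hq : quadExp Γ y 0 = y := by simp [quadExp]
  refine h2.deriv.trans ?_
  simp only [Pi.add_apply, hq, mul_zero, zero_smul, sub_zero, add_zero, ne_eq, OfNat.ofNat_ne_zero,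
    not_false_eq_true, zero_pow, _root_.add_apply, map_neg, _root_.neg_apply]
  rw [add_comm (G y _ u)]
  congr 4
  module

/-- The second variation formula for a variation field `w` with covariant derivative `w' + Γ(w, u)`
along a curve with velocity `u`. For this `S`, the vector `u + e w' - e² S` is the velocity of the
varied curve at the parameter `e`. -/
lemma IsLeviCivitaOn.deriv_deriv_energy_eq (h : IsLeviCivitaOn G Γ U) {y : E} (hy : y ∈ U)
    (u w w' : E) {S : E} (hS : S = (2⁻¹ : ℝ) • fderiv ℝ Γ y u w w
      + (2⁻¹ : ℝ) • (Γ y w' w + Γ y w w')) :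
    deriv (deriv
      (fun e : ℝ ↦ G (quadExp Γ y (e • w)) (u + e • w' - e ^ 2 • S) (u + e • w' - e ^ 2 • S))) 0
      = 2 * (G y (w' + Γ y w u) (w' + Γ y w u) - G y (curvatureOf Γ y u w w) u) := by
  rw [h.deriv_deriv_energy hy, hS, curvatureOf, h.gamma_symm y hy w' w,
    h.gamma_symm y hy (Γ y w w) u, h.gamma_symm y hy u w, h.fderiv_gamma_symm hy w w u]
  rw [sub_eq_add_neg (G y (w' + Γ y w u) (w' + Γ y w u)), ← _root_.neg_apply, ← map_neg]
  congr 4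
  simp only [map_add]
  module

end SecondVariation

section Family

variable {E : Type*} [NormedAddCommGroup E] [NormedSpace ℝ E] [FiniteDimensional ℝ E]
  {G : E → E →L[ℝ] E →L[ℝ] ℝ} {Γ : E → E →L[ℝ] E →L[ℝ] E} {α : ℝ → E}
  {U : Set E} {φ : ℝ → ℝ} {t₀ ℓ : ℝ}

/-- Along a geodesic, the field `normalTransport t t₀ w` has vanishing covariant derivative at
`t₀`. -/
lemma hasDerivAt_normalTransport (h : IsLeviCivitaOn G Γ U) (hα : ContDiffAt ℝ ∞ α t₀)
    (hU : α t₀ ∈ U) (hne : deriv α t₀ ≠ 0)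
    (hgeo : deriv (deriv α) t₀ + Γ (α t₀) (deriv α t₀) (deriv α t₀) = 0) (w : E) :
    HasDerivAt (fun t ↦ normalTransport G Γ α t t₀ w)
      (-Γ (α t₀) (deriv α t₀) (normalTransport G Γ α t₀ t₀ w)) t₀ := by
  have h1 := (hα.differentiableAt (by simp)).hasDerivAt
  have h2 := ((deriv_contDiffAt hα).differentiableAt (by simp)).hasDerivAt
  have h3 : HasDerivAt (fun t ↦ w - (t - t₀) • Γ (α t₀) (deriv α t₀) w)
      (-Γ (α t₀) (deriv α t₀) w) t₀ := by
    simpa using (((hasDerivAt_id t₀).sub_const t₀).smul_const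
      (Γ (α t₀) (deriv α t₀) w)).const_sub w
  have h4 := (h.hasDerivAt_metric hU h1 h2 h2).inv (h.pos _ hU _ hne).ne'
  have h5 := h.hasDerivAt_metric hU h1 h2 h3
  have h6 := h3.sub ((h4.mul h5).smul h2)
  refine (h6.congr_deriv ?_).congr_of_eventuallyEq (Eventually.of_forall fun t ↦ ?_)
  · have h7 : deriv (deriv α) t₀ = - Γ (α t₀) (deriv α t₀) (deriv α t₀) :=
      eq_neg_of_add_eq_zero_left hgeo
    simp only [normalTransport, h7, sub_self, zero_smul, sub_zero, map_zero, neg_add_cancel,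
      _root_.zero_apply, add_zero, neg_zero, zero_div, zero_mul, mul_zero, map_sub, map_smul,
      _root_.sub_apply, _root_.smul_apply, ContinuousLinearMap.smulRight_apply,
      ContinuousLinearMap.comp_apply, ContinuousLinearMap.id_apply, Pi.mul_apply, Pi.inv_apply,
      smul_eq_mul]
    module
  · simp [normalTransport, smul_smul]

end Family

/-! ### The speed of the variation -/

section Family

variable {E : Type*} [NormedAddCommGroup E] [NormedSpace ℝ E]

/-- Second derivatives along a line. -/
lemma fderiv_fderiv_apply_self {E : Type*} [NormedAddCommGroup E] [NormedSpace ℝ E] {f : E → ℝ}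
    {x : E} (hf : ContDiffAt ℝ 2 f x) (v : E) :
    deriv (deriv (fun e : ℝ ↦ f (x + e • v))) 0 = fderiv ℝ (fderiv ℝ f) x v v := by
  have hl : ∀ e : ℝ, HasDerivAt (fun e : ℝ ↦ x + e • v) v e := fun e ↦ by
    simpa using ((hasDerivAt_id e).smul_const v).const_add x
  have h4 : ∀ᶠ y in 𝓝 x, DifferentiableAt ℝ f y :=
    (hf.eventually (by simp)).mono fun y hy ↦ hy.differentiableAt (by norm_num)
  have h0 : x + (0 : ℝ) • v = x := by simp
  have h5 : ∀ᶠ e : ℝ in 𝓝 0, DifferentiableAt ℝ f (x + e • v) :=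
    (hl 0).continuousAt.eventually (by simp only [h0]; exact h4)
  have h6 : deriv (fun e : ℝ ↦ f (x + e • v)) =ᶠ[𝓝 0] fun e ↦ fderiv ℝ f (x + e • v) v := by
    filter_upwards [h5] with e he using
      (he.hasFDerivAt.comp_hasDerivAt (f := fun e : ℝ ↦ x + e • v) e (hl e)).deriv
  rw [h6.deriv_eq]
  have h1 : ContDiffAt ℝ 1 (fderiv ℝ f) x := hf.fderiv_right (by norm_num)
  have h7 : HasFDerivAt (fderiv ℝ f) (fderiv ℝ (fderiv ℝ f) x) (x + (0 : ℝ) • v) := by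
    rw [h0]; exact (h1.differentiableAt (by norm_num)).hasFDerivAt
  have h8 : HasDerivAt (fun e : ℝ ↦ fderiv ℝ f (x + e • v)) (fderiv ℝ (fderiv ℝ f) x v) 0 :=
    h7.comp_hasDerivAt (f := fun e : ℝ ↦ x + e • v) (0 : ℝ) (hl 0)
  have h9 := h8.clm_apply (hasDerivAt_const (0 : ℝ) v)
  rw [h9.deriv]
  simp

variable [FiniteDimensional ℝ E]
  {G : E → E →L[ℝ] E →L[ℝ] ℝ} {Γ : E → E →L[ℝ] E →L[ℝ] E} {α : ℝ → E}
  {U : Set E} {φ : ℝ → ℝ} {t₀ ℓ : ℝ}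

variable (h : IsLeviCivitaOn G Γ U) (hα : ContDiffAt ℝ ∞ α t₀) (hU : α t₀ ∈ U)
  (hne : deriv α t₀ ≠ 0)

include h hα hU hne

/-- The covariant derivative along a geodesic of a field orthogonal to it stays orthogonal. -/
lemma eventually_metric_covariantDeriv :
    ∀ᶠ z : ℝ × ℝ in 𝓝 (t₀, t₀),
      deriv (deriv α) z.1 + Γ (α z.1) (deriv α z.1) (deriv α z.1) = 0 → ∀ w W' : E,
      HasDerivAt (fun t ↦ φ t • normalTransport G Γ α t z.2 w) W' z.1 →
      G (α z.1) (W' + Γ (α z.1) (φ z.1 • normalTransport G Γ α z.1 z.2 w) (deriv α z.1))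
        (deriv α z.1) = 0 := by
  have h2 : ∀ᶠ t in 𝓝 t₀, ContDiffAt ℝ 2 α t ∧ α t ∈ U :=
    ((hα.of_le (by simpa using two_le_infty)).eventually (by simp)).and
      (hα.continuousAt.preimage_mem_nhds (h.isOpen.mem_nhds hU))
  have h3 : ∀ᶠ t in 𝓝 t₀, deriv α t ≠ 0 :=
    (deriv_contDiffAt hα).continuousAt.eventually_ne hne
  have h4 : ∀ᶠ z : ℝ × ℝ in 𝓝 (t₀, t₀),
      ∀ᶠ t in 𝓝 z.1, (ContDiffAt ℝ 2 α t ∧ α t ∈ U) ∧ deriv α t ≠ 0 :=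
    (continuous_fst.tendsto (t₀, t₀)).eventually (h2.and h3).eventually_nhds
  filter_upwards [h4] with z hz hgeo w W' hW'
  obtain ⟨⟨hz1, hz2⟩, hz3⟩ := hz.self_of_nhds
  have h5 := (hz1.differentiableAt (by simp)).hasDerivAt
  have h6 : HasDerivAt (deriv α) (deriv (deriv α) z.1) z.1 := by
    have h7 : ContDiffAt ℝ 1 (fderiv ℝ α) z.1 := hz1.fderiv_right (m := 1) (by norm_num)
    have h8 : ContDiffAt ℝ 1 (deriv α) z.1 := h7.clm_apply contDiffAt_const
    exact (h8.differentiableAt (by simp)).hasDerivAt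
  have h7 := h.hasDerivAt_metric hz2 h5 h6 hW'
  have h8 : (fun t ↦ G (α t) (deriv α t) (φ t • normalTransport G Γ α t z.2 w)) =ᶠ[𝓝 z.1]
      fun _ ↦ 0 := by
    filter_upwards [hz] with t ht
    rw [map_smul, metric_normalTransport (h.pos _ ht.1.2 _ ht.2).ne', smul_zero]
  have h9 := h7.unique ((hasDerivAt_const z.1 (0 : ℝ)).congr_of_eventuallyEq h8)
  rw [hgeo, map_zero, _root_.zero_apply, zero_add] at h9
  rw [h.symm _ hz2, h.gamma_symm _ hz2, h9]

/-- The speed has vanishing first derivative in the direction of the variation, since the covariant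
derivative of the variation field is orthogonal to the geodesic. -/
lemma eventually_fderiv_variationSpeedSq (hφ : ContDiff ℝ ∞ φ) :
    ∀ᶠ z : ℝ × ℝ in 𝓝 (t₀, t₀),
      deriv (deriv α) z.1 + Γ (α z.1) (deriv α z.1) (deriv α z.1) = 0 → ∀ w : E,
      fderiv ℝ (variationSpeedSq G Γ α φ) (z.1, z.2, 0) (0, 0, w) = 0 := by
  have h3 : ∀ᶠ z : ℝ × ℝ × E in 𝓝 (t₀, t₀, 0), ContDiffAt ℝ 1 (variationSpeedSq G Γ α φ) z :=
    ((contDiffAt_variationSpeedSq h hα hU hne hφ).of_le (by simp)).eventually (by simp)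
  have hc : Tendsto (fun z : ℝ × ℝ ↦ (z.1, z.2, (0 : E))) (𝓝 (t₀, t₀)) (𝓝 (t₀, t₀, 0)) :=
    Continuous.tendsto (by fun_prop) _
  have h4 : ∀ᶠ z : ℝ × ℝ in 𝓝 (t₀, t₀), α z.1 ∈ U :=
    (continuous_fst.tendsto (t₀, t₀)).eventually
      (hα.continuousAt.preimage_mem_nhds (h.isOpen.mem_nhds hU))
  filter_upwards [hc.eventually h3, h4, eventually_metric_covariantDeriv h hα hU hne (φ := φ),
    eventually_fderiv_variation h hα hU hne hφ] with z hz1 hz2 hz3 hz4 hgeo w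
  obtain ⟨W', hW', hev⟩ := hz4 w
  have h5 := hz3 hgeo w W' hW'
  set W := φ z.1 • normalTransport G Γ α z.1 z.2 w with hW
  have h6 := (h.hasDerivAt_energy hz2 (deriv α z.1) W W'
    ((2⁻¹ : ℝ) • fderiv ℝ Γ (α z.1) (deriv α z.1) W W
      + (2⁻¹ : ℝ) • (Γ (α z.1) W' W + Γ (α z.1) W W'))).self_of_nhds
  have h7 : HasDerivAt (fun e : ℝ ↦ variationSpeedSq G Γ α φ (z.1, z.2, e • w))
      (fderiv ℝ (variationSpeedSq G Γ α φ) (z.1, z.2, 0) (0, 0, w)) 0 := by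
    have h8 : HasDerivAt (fun e : ℝ ↦ (z.1, z.2, e • w)) (0, 0, w) 0 := by
      have h10 := (hasDerivAt_id (0 : ℝ)).smul_const w
      rw [one_smul] at h10
      exact (hasDerivAt_const (0 : ℝ) z.1).prodMk ((hasDerivAt_const (0 : ℝ) z.2).prodMk h10)
    have h9 : HasFDerivAt (variationSpeedSq G Γ α φ)
        (fderiv ℝ (variationSpeedSq G Γ α φ) (z.1, z.2, 0)) (z.1, z.2, (0 : ℝ) • w) := by
      rw [zero_smul]
      exact (hz1.differentiableAt (by simp)).hasFDerivAt
    exact h9.comp_hasDerivAt (f := fun e : ℝ ↦ (z.1, z.2, e • w)) 0 h8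
  have h8 := h6.congr_of_eventuallyEq (f₁ := fun e : ℝ ↦ variationSpeedSq G Γ α φ (z.1, z.2, e • w))
    (by
      filter_upwards [hev] with e he
      simp only [variationSpeedSq, he, variation, map_smul, hW]
      congr 4
      rw [smul_comm])
  rw [h7.unique h8]
  have h0 : quadExp Γ (α z.1) 0 = α z.1 := by simp [quadExp]
  simp only [zero_smul, h0, mul_zero, sub_zero, add_zero, ne_eq, OfNat.ofNat_ne_zero,
    not_false_eq_true, zero_pow, h5]

/-- The second derivative of the squared speed of the variation: the field is parallel to first
order at `t₀`, so that its covariant derivative there is the one of the factor `φ`. -/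
lemma deriv_deriv_variationSpeedSq (hφ : ContDiff ℝ ∞ φ)
    (hgeo : deriv (deriv α) t₀ + Γ (α t₀) (deriv α t₀) (deriv α t₀) = 0) (w : E) :
    fderiv ℝ (fderiv ℝ (variationSpeedSq G Γ α φ)) (t₀, t₀, 0) (0, 0, w) (0, 0, w)
      = 2 * (deriv φ t₀ ^ 2 * normalMetric G Γ α t₀ t₀ w w
        - φ t₀ ^ 2 * G (α t₀) (curvatureOf Γ (α t₀) (deriv α t₀) (normalTransport G Γ α t₀ t₀ w)
          (normalTransport G Γ α t₀ t₀ w)) (deriv α t₀)) := by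
  rw [← fderiv_fderiv_apply_self
    ((contDiffAt_variationSpeedSq h hα hU hne hφ).of_le (by simpa using two_le_infty))]
  obtain ⟨W', hW', hev⟩ := (eventually_fderiv_variation h hα hU hne hφ).self_of_nhds w
  simp only at hW' hev
  have h1 := (hφ.differentiable (by simp) t₀).hasDerivAt.smul
    (hasDerivAt_normalTransport h hα hU hne hgeo w)
  have h2 := hW'.unique h1
  set V := normalTransport G Γ α t₀ t₀ w with hV
  set W := φ t₀ • V with hW
  have h3 : (fun e : ℝ ↦ variationSpeedSq G Γ α φ ((t₀, t₀, 0) + e • ((0, 0, w) : ℝ × ℝ × E)))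
      =ᶠ[𝓝 0] fun e : ℝ ↦ G (quadExp Γ (α t₀) (e • W))
        (deriv α t₀ + e • W' - e ^ 2 • ((2⁻¹ : ℝ) • fderiv ℝ Γ (α t₀) (deriv α t₀) W W
          + (2⁻¹ : ℝ) • (Γ (α t₀) W' W + Γ (α t₀) W W')))
        (deriv α t₀ + e • W' - e ^ 2 • ((2⁻¹ : ℝ) • fderiv ℝ Γ (α t₀) (deriv α t₀) W W
          + (2⁻¹ : ℝ) • (Γ (α t₀) W' W + Γ (α t₀) W W'))) := by
    filter_upwards [hev] with e he
    have h4 : (t₀, t₀, 0) + e • ((0, 0, w) : ℝ × ℝ × E) = (t₀, t₀, e • w) := by simp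
    rw [h4]
    simp only [variationSpeedSq, he, variation, map_smul, hW, hV]
    congr 4
    rw [smul_comm]
  rw [h3.deriv.deriv_eq, h.deriv_deriv_energy_eq hU _ _ _ rfl]
  have h5 : W' + Γ (α t₀) W (deriv α t₀) = deriv φ t₀ • V := by
    rw [h2, h.gamma_symm _ hU W, hW, map_smul]
    module
  rw [h5, hW, normalMetric_apply, ← hV]
  have h6 : curvatureOf Γ (α t₀) (deriv α t₀) (φ t₀ • V) (φ t₀ • V)
      = φ t₀ ^ 2 • curvatureOf Γ (α t₀) (deriv α t₀) V V := by
    simp only [curvatureOf, map_smul, _root_.smul_apply]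
    module
  rw [h6]
  simp only [map_smul, _root_.smul_apply, smul_eq_mul]
  ring

/-- Second order upper bound for the speed of the variation of a geodesic of speed `ℓ`. -/
lemma exists_variationSpeedSq_le (hφ : ContDiff ℝ ∞ φ)
    (hgeo : deriv (deriv α) t₀ + Γ (α t₀) (deriv α t₀) (deriv α t₀) = 0) {ε : ℝ} (hε : 0 < ε) :
    ∃ δ > 0, ∀ t s : ℝ, |t - t₀| < δ → |s - t₀| < δ →
      deriv (deriv α) t + Γ (α t) (deriv α t) (deriv α t) = 0 → ∀ w : E, ‖w‖ < δ →
      variationSpeedSq G Γ α φ (t, s, w) ≤ G (α t) (deriv α t) (deriv α t)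
        + (deriv φ t₀ ^ 2 * normalMetric G Γ α t₀ t₀ w w
        - φ t₀ ^ 2 * G (α t₀) (curvatureOf Γ (α t₀) (deriv α t₀) (normalTransport G Γ α t₀ t₀ w)
          (normalTransport G Γ α t₀ t₀ w)) (deriv α t₀)) + ε * ‖w‖ ^ 2 := by
  obtain ⟨δ₁, hδ₁, H⟩ := exists_taylor_two
    ((contDiffAt_variationSpeedSq h hα hU hne hφ).of_le (by simpa using two_le_infty)) hε
  obtain ⟨δ₂, hδ₂, H₂⟩ := Metric.eventually_nhds_iff.mp
    ((eventually_fderiv_variationSpeedSq h hα hU hne hφ).and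
      (eventually_fderiv_variation h hα hU hne hφ))
  refine ⟨min δ₁ δ₂, lt_min hδ₁ hδ₂, fun t s ht hs hgt w hw ↦ ?_⟩
  have h1 := H (t, s, 0) (0, 0, w) (by
    rw [show ((t, s, 0) : ℝ × ℝ × E) - (t₀, t₀, 0) = (t - t₀, s - t₀, 0) by simp]
    simp only [Prod.norm_def, norm_zero, Real.norm_eq_abs]
    exact max_lt (ht.trans_le (min_le_left _ _)) (max_lt (hs.trans_le (min_le_left _ _)) hδ₁))
    (by
      simp only [Prod.norm_def, norm_zero]
      exact max_lt hδ₁ (max_lt hδ₁ (hw.trans_le (min_le_left _ _))))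
  obtain ⟨h2, h3⟩ := H₂ (y := (t, s)) (by
    rw [Prod.dist_eq]
    exact max_lt (ht.trans_le (min_le_right _ _)) (hs.trans_le (min_le_right _ _)))
  obtain ⟨W', hW', hev⟩ := h3 0
  have h4 : variationSpeedSq G Γ α φ (t, s, 0) = G (α t) (deriv α t) (deriv α t) := by
    have h5 := hev.self_of_nhds
    simp only [smul_zero, zero_smul, add_zero, ne_eq, OfNat.ofNat_ne_zero, not_false_eq_true,
      zero_pow, sub_zero] at h5
    have h6 : variation G Γ α φ (t, s, 0) = α t := by simp [variation, quadExp]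
    rw [variationSpeedSq, h5, h6]
  rw [deriv_deriv_variationSpeedSq h hα hU hne hφ hgeo, h2 hgt w, h4] at h1
  have h5 : ((t, s, 0) : ℝ × ℝ × E) + (0, 0, w) = (t, s, w) := by simp
  have h6 : ‖((0, 0, w) : ℝ × ℝ × E)‖ = ‖w‖ := by simp [Prod.norm_def]
  rw [h5, h6, smul_eq_mul, Real.norm_eq_abs] at h1
  have := (abs_le.mp h1).2
  linarith

/-- Cruder upper bound for the speed of the variation. It uses the geodesic equation at `t₀` only,
and so applies to curves prolonged beyond the end of a geodesic. -/
lemma exists_variationSpeedSq_le_of_deriv_eq_zero (hφ : ContDiff ℝ ∞ φ)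
    (hgeo : deriv (deriv α) t₀ + Γ (α t₀) (deriv α t₀) (deriv α t₀) = 0) :
    ∃ C > 0, ∃ δ > 0, ∀ t : ℝ, |t - t₀| < δ → ∀ w : E, ‖w‖ < δ →
      variationSpeedSq G Γ α φ (t, t₀, w) ≤ G (α t₀) (deriv α t₀) (deriv α t₀)
        + C * (|t - t₀| + ‖w‖) ^ 2 := by
  obtain ⟨δ₁, hδ₁, H⟩ := exists_taylor_two
    ((contDiffAt_variationSpeedSq h hα hU hne hφ).of_le (by simpa using two_le_infty)) one_pos
  set B := fderiv ℝ (fderiv ℝ (variationSpeedSq G Γ α φ)) (t₀, t₀, 0) with hB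
  have h0 : ∀ᶠ t in 𝓝 t₀, variationSpeedSq G Γ α φ (t, t₀, 0)
      = G (α t) (deriv α t) (deriv α t) := by
    have hc : Tendsto (fun t : ℝ ↦ (t, t₀)) (𝓝 t₀) (𝓝 (t₀, t₀)) :=
      Continuous.tendsto (by fun_prop) _
    filter_upwards [hc.eventually (eventually_fderiv_variation h hα hU hne hφ)] with t ht
    obtain ⟨W', hW', hev⟩ := ht 0
    have h5 := hev.self_of_nhds
    simp only [smul_zero, zero_smul, add_zero, ne_eq, OfNat.ofNat_ne_zero, not_false_eq_true,
      zero_pow, sub_zero] at h5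
    have h6 : variation G Γ α φ (t, t₀, 0) = α t := by simp [variation, quadExp]
    rw [variationSpeedSq, h5, h6]
  have h1 : fderiv ℝ (variationSpeedSq G Γ α φ) (t₀, t₀, 0) (1, 0, 0) = 0 := by
    have h2 : HasDerivAt (fun t ↦ variationSpeedSq G Γ α φ (t, t₀, 0))
        (fderiv ℝ (variationSpeedSq G Γ α φ) (t₀, t₀, 0) (1, 0, 0)) t₀ :=
      ((contDiffAt_variationSpeedSq h hα hU hne hφ).differentiableAt
        (by simp)).hasFDerivAt.comp_hasDerivAt (f := fun t ↦ (t, t₀, 0)) t₀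
        ((hasDerivAt_id t₀).prodMk (hasDerivAt_const t₀ (t₀, (0 : E))))
    have h3 := h.hasDerivAt_metric hU (hα.differentiableAt (by simp)).hasDerivAt
      ((deriv_contDiffAt hα).differentiableAt (by simp)).hasDerivAt
      ((deriv_contDiffAt hα).differentiableAt (by simp)).hasDerivAt
    rw [h2.unique (h3.congr_of_eventuallyEq h0), hgeo]
    simp
  have h2 := (eventually_fderiv_variationSpeedSq h hα hU hne hφ).self_of_nhds hgeo
  refine ⟨‖B‖ + 1, by positivity, δ₁, hδ₁, fun t ht w hw ↦ ?_⟩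
  have h3 := H (t₀, t₀, 0) (t - t₀, 0, w) (by simpa using hδ₁) (by
    simp only [Prod.norm_def, norm_zero]
    exact max_lt ht (max_lt hδ₁ hw))
  have h4 : ((t - t₀, 0, w) : ℝ × ℝ × E) = (t - t₀) • (1, 0, 0) + (0, 0, w) := by simp
  have h5 : fderiv ℝ (variationSpeedSq G Γ α φ) (t₀, t₀, 0) (t - t₀, 0, w) = 0 := by
    rw [h4, map_add, map_smul, h1, smul_zero, zero_add]
    exact h2 w
  have h6 : ((t₀, t₀, 0) : ℝ × ℝ × E) + (t - t₀, 0, w) = (t, t₀, w) := by simp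
  have h7 : ‖((t - t₀, 0, w) : ℝ × ℝ × E)‖ ≤ |t - t₀| + ‖w‖ := by
    simp only [Prod.norm_def, norm_zero, Real.norm_eq_abs]
    exact max_le (by simp) (max_le (by positivity) (by simp))
  rw [h5, h6, h0.self_of_nhds, sub_zero, smul_eq_mul, Real.norm_eq_abs] at h3
  have h8 := (le_abs_self _).trans
    (norm_apply_apply_le B ((t - t₀, 0, w) : ℝ × ℝ × E) (t - t₀, 0, w))
  have h9 := (abs_le.mp h3).2
  have h10 : ‖((t - t₀, 0, w) : ℝ × ℝ × E)‖ ^ 2 ≤ (|t - t₀| + ‖w‖) ^ 2 := by gcongr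
  have h11 : (0 : ℝ) ≤ ‖B‖ := norm_nonneg B
  nlinarith

end Family

/-! ### Propagation over a short time -/

section Family

variable {E : Type*} [NormedAddCommGroup E] [NormedSpace ℝ E] [FiniteDimensional ℝ E]
  {G : E → E →L[ℝ] E →L[ℝ] ℝ} {Γ : E → E →L[ℝ] E →L[ℝ] E} {α : ℝ → E}
  {U : Set E} {φ : ℝ → ℝ} {t₀ ℓ : ℝ}

/-- Normal transport is isometric to first order, since it is parallel to first order. -/
lemma exists_abs_normalMetric_sub_le (h : IsLeviCivitaOn G Γ U) (hα : ContDiffAt ℝ ∞ α t₀)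
    (hU : α t₀ ∈ U) (hne : deriv α t₀ ≠ 0)
    (hgeo : deriv (deriv α) t₀ + Γ (α t₀) (deriv α t₀) (deriv α t₀) = 0) {ε : ℝ} (hε : 0 < ε) :
    ∃ δ > 0, ∀ t s : ℝ, |t - t₀| < δ → |s - t₀| < δ → ∀ w,
      |normalMetric G Γ α t s w w - normalMetric G Γ α s s w w| ≤ ε * |t - s| * ‖w‖ ^ 2 ∧
      |normalMetric G Γ α s s w w - normalMetric G Γ α t₀ t₀ w w| ≤ ε * ‖w‖ ^ 2 := by
  have hH := contDiffAt_normalMetric h hα hU hne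
  set K := fun z : ℝ × ℝ ↦ normalMetric G Γ α z.1 z.2 with hK
  have hd := hH.hasStrictFDerivAt (by simp)
  have hzero : ∀ w, fderiv ℝ K (t₀, t₀) (1, 0) w w = 0 := by
    intro w
    have h1 : HasDerivAt (fun t ↦ K (t, t₀)) (fderiv ℝ K (t₀, t₀) (1, 0)) t₀ :=
      hd.hasFDerivAt.comp_hasDerivAt (f := fun t ↦ (t, t₀)) t₀
        ((hasDerivAt_id t₀).prodMk (hasDerivAt_const t₀ t₀))
    have h2 : HasDerivAt (fun t ↦ K (t, t₀) w w) (fderiv ℝ K (t₀, t₀) (1, 0) w w) t₀ := by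
      simpa using (h1.clm_apply (hasDerivAt_const t₀ w)).clm_apply (hasDerivAt_const t₀ w)
    have h3 := hasDerivAt_normalTransport h hα hU hne hgeo w
    have h4 := h.hasDerivAt_metric hU (hα.differentiableAt (by simp)).hasDerivAt h3 h3
    have h5 : (fun t ↦ K (t, t₀) w w) = fun t ↦ G (α t) (normalTransport G Γ α t t₀ w)
        (normalTransport G Γ α t t₀ w) := rfl
    rw [h5] at h2
    rw [h2.unique h4]
    simp
  have h1 := hd.isLittleO.def hε
  obtain ⟨δ₁, hδ₁, H₁⟩ := Metric.eventually_nhds_iff.mp h1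
  obtain ⟨δ₂, hδ₂, H₂⟩ := Metric.continuousAt_iff.mp hH.continuousAt ε hε
  refine ⟨min δ₁ δ₂, lt_min hδ₁ hδ₂, fun t s ht hs w ↦ ⟨?_, ?_⟩⟩
  · have h2 := H₁ (y := ((t, s), (s, s))) (by
      simp only [Prod.dist_eq, Real.dist_eq]
      have a1 := ht.trans_le (min_le_left _ _)
      have a2 := hs.trans_le (min_le_left _ _)
      exact max_lt (max_lt a1 a2) (max_lt a2 a2))
    simp only at h2
    have h3 : ((t, s) : ℝ × ℝ) - (s, s) = (t - s) • (1, 0) := by simp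
    have h4 : ‖((t, s) : ℝ × ℝ) - (s, s)‖ = |t - s| := by
      simp [Prod.norm_def]
    rw [h4, h3, map_smul] at h2
    have h5 := norm_apply_apply_le (K (t, s) - K (s, s) - (t - s) • fderiv ℝ K (t₀, t₀) (1, 0)) w w
    have h6 : (K (t, s) - K (s, s) - (t - s) • fderiv ℝ K (t₀, t₀) (1, 0)) w w
        = normalMetric G Γ α t s w w - normalMetric G Γ α s s w w := by
      simp only [_root_.sub_apply, _root_.smul_apply, hzero w, smul_zero, sub_zero]
      rfl
    rw [h6, Real.norm_eq_abs] at h5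
    calc _ ≤ _ := h5
      _ ≤ ε * |t - s| * ‖w‖ * ‖w‖ := by gcongr
      _ = _ := by ring
  · have h2 := H₂ (x := (s, s)) (by
      simp only [Prod.dist_eq, Real.dist_eq]
      have a2 := hs.trans_le (min_le_right _ _)
      exact max_lt a2 a2)
    rw [dist_eq_norm] at h2
    have h5 := norm_apply_apply_le (K (s, s) - K (t₀, t₀)) w w
    calc |normalMetric G Γ α s s w w - normalMetric G Γ α t₀ t₀ w w|
        = ‖(K (s, s) - K (t₀, t₀)) w w‖ := rfl
      _ ≤ _ := h5
      _ ≤ ε * ‖w‖ * ‖w‖ := by gcongr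
      _ = _ := by ring

end Family

section Step

variable {E : Type*} [NormedAddCommGroup E] [NormedSpace ℝ E] [FiniteDimensional ℝ E]
  {M : Type*} [MetricSpace M] [ChartedSpace E M] [IsManifold 𝓘(ℝ, E) ∞ M]
  [RiemannianBundle (fun x : M ↦ TangentSpace 𝓘(ℝ, E) x)]
  [IsContMDiffRiemannianBundle 𝓘(ℝ, E) ∞ E (fun x : M ↦ TangentSpace 𝓘(ℝ, E) x)]

/-- In the chart centred at `p`, the bound `ρ ≤ m + c |w|² + o(|w|²)` at the second order
exponential of `k w`, for `w` orthogonal to `v` at the point `y`. Here `k` is the size of the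
variation field at this point, whereas `|w|²` measures its generating vector. -/
def NormalBound (ρ : M → ℝ) (p : M) (y v : E) (k m c : ℝ) : Prop :=
  ∀ ε > 0, ∀ᶠ w in 𝓝 (0 : E), chartG p y v w = 0 →
    ρ ((extChartAt 𝓘(ℝ, E) p).symm (quadExp (chartΓ p) y (k • w)))
      ≤ m + c * chartG p y w w + ε * ‖w‖ ^ 2

/-- The arithmetic of one step: the growth of `c` from `c₁` to `c₂` over a time `Δ` exceeds the
second variation coefficient `k₂` by a margin of the order of `η`, which absorbs
the errors of relative size `ε`. -/
lemma add_le_of_step {r m c₁ c₂ g g₁ Δ η K k₂ k₃ W Y ℓ ε x m' : ℝ} (hΔ : 0 ≤ Δ) (hg : 0 ≤ g)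
    (hη : 0 ≤ η) (h1 : r ≤ m + c₁ * g₁ + x) (h7 : c₁ * g₁ ≤ c₁ * g + K * (ε * Δ * W))
    (h9 : Y ≤ k₂ * g + k₃ * (ε * W)) (h10 : c₁ + (k₂ + 3 / 4 * η) * Δ ≤ c₂)
    (h11 : (K + k₃) * (ε * W) ≤ η / 2 * g) (hm : m' = m + Δ * ℓ) :
    r + Δ * (ℓ + Y) ≤ m' + c₂ * g + x := by
  have h12 : (c₁ + (k₂ + 3 / 4 * η) * Δ) * g ≤ c₂ * g := by gcongr
  have h13 : Δ * Y ≤ Δ * (k₂ * g + k₃ * (ε * W)) := by gcongr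
  have h14 : Δ * ((K + k₃) * (ε * W)) ≤ Δ * (η / 2 * g) := by gcongr
  have h17 : 0 ≤ Δ * (η * g) := by positivity
  linarith

/-- The energy estimate for one step: the bound at time `s₁`, at the point reached by the variation
with base time `s`, together with the length estimate of the curves of the variation, gives the
bound at time `s` if `c` grows faster than the second variation. -/
lemma NormalBound.exists_add_le {ρ : M → ℝ} {p : M} {α : ℝ → E} {φ c : ℝ → ℝ} {t₀ ℓ c' : ℝ}
    (hα : ContDiffAt ℝ ∞ α t₀) (hU : α t₀ ∈ (extChartAt 𝓘(ℝ, E) p).target)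
    (hne : deriv α t₀ ≠ 0)
    (hgeo : deriv (deriv α) t₀ + chartΓ p (α t₀) (deriv α t₀) (deriv α t₀) = 0)
    (hℓ : 0 < ℓ) (hc : HasStrictDerivAt c c' t₀)
    (hc' : (deriv φ t₀ ^ 2 - φ t₀ ^ 2 * ℓ ^ 2) / (2 * ℓ) < c') :
    ∃ ε₁ > 0, ∃ δ > 0, ∀ s₁ s : ℝ, |s₁ - t₀| < δ → |s - t₀| < δ → s₁ ≤ s →
      NormalBound ρ p (α s₁) (deriv α s₁) (φ s₁) (ℓ * s₁) (c s₁) → ∀ ε > 0, ∀ᶠ w in 𝓝 (0 : E),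
      chartG p (α s) (deriv α s) w = 0 →
      ρ ((extChartAt 𝓘(ℝ, E) p).symm (variation (chartG p) (chartΓ p) α φ (s₁, s, w)))
        + (s - s₁) * (ℓ + ((deriv φ t₀ ^ 2 - φ t₀ ^ 2 * ℓ ^ 2)
          * normalMetric (chartG p) (chartΓ p) α t₀ t₀ w w + ε₁ * ‖w‖ ^ 2) / (2 * ℓ))
        ≤ ℓ * s + c s * chartG p (α s) w w + ε * ‖w‖ ^ 2 := by
  have h := isLeviCivitaOn_chart (E := E) p
  set G := chartG (E := E) p with hG
  set Γ := chartΓ (E := E) p with hΓ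
  set κ := deriv φ t₀ ^ 2 - φ t₀ ^ 2 * ℓ ^ 2 with hκ
  obtain ⟨C, hC, hC'⟩ := h.exists_norm_sq_le hU
  have hαc := hα.continuousAt
  set η := c' - κ / (2 * ℓ) with hη
  have hη0 : 0 < η := by linarith
  set K := |c t₀| + 1 with hK
  have hK0 : 0 < K := by positivity
  -- with this choice all error terms together are at most `η / 2` times the metric, see `h11`
  set ε₁ := η / (2 * C * (K + (|κ| + 1) / (2 * ℓ))) with hε₁
  have hD : 0 < K + (|κ| + 1) / (2 * ℓ) := by positivity
  have hε₁0 : 0 < ε₁ := by positivity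
  obtain ⟨δ₁, hδ₁, H₁⟩ := exists_abs_normalMetric_sub_le h hα hU hne hgeo hε₁0
  have hcK : ∀ᶠ s in 𝓝 t₀, |c s| < K :=
    hc.hasDerivAt.continuousAt.abs.eventually (gt_mem_nhds (by rw [hK]; linarith))
  have hne' : ∀ᶠ s in 𝓝 t₀, deriv α s ≠ 0 :=
    (deriv_contDiffAt hα).continuousAt.eventually_ne hne
  have hmono : ∀ᶠ z : ℝ × ℝ in 𝓝 (t₀, t₀), ‖c z.1 - c z.2 - (z.1 - z.2) * c'‖
      ≤ (η / 4) * ‖z.1 - z.2‖ := by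
    have := hc.hasStrictFDerivAt.isLittleO.def (c := η / 4) (by positivity)
    simpa using this
  obtain ⟨δ₂, hδ₂, H₂⟩ := Metric.eventually_nhds_iff.mp hmono
  obtain ⟨δ₃, hδ₃, H₃⟩ := Metric.eventually_nhds_iff.mp
    (hcK.and (hne'.and (hαc.eventually hC')))
  refine ⟨ε₁, hε₁0, min δ₁ (min δ₂ δ₃), by positivity, fun s₁ s hs₁ hs hle hb ε hε ↦ ?_⟩
  have a1 := hs₁.trans_le (min_le_left _ _)
  have a2 := hs.trans_le (min_le_left _ _)
  have b1 := hs₁.trans_le ((min_le_right _ _).trans (min_le_left _ _))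
  have b2 := hs.trans_le ((min_le_right _ _).trans (min_le_left _ _))
  have c1 := hs₁.trans_le ((min_le_right _ _).trans (min_le_right _ _))
  have c2 := hs.trans_le ((min_le_right _ _).trans (min_le_right _ _))
  obtain ⟨d1, e1, f1⟩ := H₃ (y := s₁) c1
  obtain ⟨d2, e2, f2⟩ := H₃ (y := s) c2
  have hcs := H₂ (y := (s, s₁)) (by rw [Prod.dist_eq]; exact max_lt b2 b1)
  simp only [Real.norm_eq_abs, abs_of_nonneg (sub_nonneg.mpr hle)] at hcs
  set A := normalTransport G Γ α s₁ s with hA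
  have hlim : Tendsto (fun w ↦ A w) (𝓝 0) (𝓝 0) := by
    simpa using A.continuous.tendsto 0
  filter_upwards [hlim.eventually (hb (ε / (‖A‖ ^ 2 + 1)) (by positivity))] with w hw hperp
  have h1 := hw (metric_normalTransport (h.pos _ f1.1 _ e1).ne' w)
  have h2 : ε / (‖A‖ ^ 2 + 1) * ‖A w‖ ^ 2 ≤ ε * ‖w‖ ^ 2 := by
    calc ε / (‖A‖ ^ 2 + 1) * ‖A w‖ ^ 2 ≤ ε / (‖A‖ ^ 2 + 1) * (‖A‖ * ‖w‖) ^ 2 := by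
          gcongr
          exact A.le_opNorm w
      _ = (ε * ‖w‖ ^ 2) * (‖A‖ ^ 2 / (‖A‖ ^ 2 + 1)) := by ring
      _ ≤ (ε * ‖w‖ ^ 2) * 1 := by
          gcongr
          rw [div_le_one (by positivity)]
          linarith
      _ = _ := mul_one _
  obtain ⟨h3, h4⟩ := H₁ s₁ s a1 a2 w
  have h5 : normalMetric G Γ α s s w w = G (α s) w w := by
    rw [normalMetric_apply, normalTransport_self hperp]
  have h6 : normalMetric G Γ α s₁ s w w = G (α s₁) (A w) (A w) := rfl
  rw [h5, h6, abs_sub_comm s₁, abs_of_nonneg (sub_nonneg.mpr hle)] at h3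
  rw [h5] at h4
  set g := G (α s) w w with hg
  set g₁ := G (α s₁) (A w) (A w) with hg₁
  set H₀ := normalMetric G Γ α t₀ t₀ w w with hH₀
  set Δ := s - s₁ with hΔ
  have hΔ0 : 0 ≤ Δ := sub_nonneg.mpr hle
  have hwg : ‖w‖ ^ 2 ≤ C * g := (f2.2 w).2
  have hg0 : 0 ≤ g := h.nonneg f2.1 w
  have h7 : c s₁ * g₁ ≤ c s₁ * g + K * (ε₁ * Δ * ‖w‖ ^ 2) := by
    have : c s₁ * (g₁ - g) ≤ K * (ε₁ * Δ * ‖w‖ ^ 2) :=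
      (le_abs_self _).trans (by rw [abs_mul]; gcongr)
    linarith
  have h8 : κ * H₀ ≤ κ * g + |κ| * (ε₁ * ‖w‖ ^ 2) := by
    have : κ * (H₀ - g) ≤ |κ| * (ε₁ * ‖w‖ ^ 2) :=
      (le_abs_self _).trans (by rw [abs_mul, abs_sub_comm H₀ g]; gcongr)
    linarith
  have h9 : (κ * H₀ + ε₁ * ‖w‖ ^ 2) / (2 * ℓ)
      ≤ κ / (2 * ℓ) * g + (|κ| + 1) / (2 * ℓ) * (ε₁ * ‖w‖ ^ 2) := by
    calc _ ≤ (κ * g + |κ| * (ε₁ * ‖w‖ ^ 2) + ε₁ * ‖w‖ ^ 2) / (2 * ℓ) := by gcongr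
      _ = _ := by ring
  have h10 : c s₁ + (c' - η / 4) * Δ ≤ c s := by
    have := (abs_le.mp hcs).1
    linarith
  have h11 : (K + (|κ| + 1) / (2 * ℓ)) * (ε₁ * ‖w‖ ^ 2) ≤ η / 2 * g := by
    calc _ ≤ (K + (|κ| + 1) / (2 * ℓ)) * (ε₁ * (C * g)) := by gcongr
      _ = η / 2 * g := by rw [hε₁]; field_simp
  have h15 : variation G Γ α φ (s₁, s, w) = quadExp Γ (α s₁) (φ s₁ • A w) := rfl
  have h16 : c' - η / 4 = κ / (2 * ℓ) + 3 / 4 * η := by rw [hη]; ring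
  rw [h16] at h10
  rw [h15]
  exact add_le_of_step hΔ0 hg0 hη0.le (h1.trans (add_le_add_right h2 _)) h7 h9 h10 h11 (by ring)

variable [IsRiemannianManifold 𝓘(ℝ, E) M]

/-- The length of a piece of a curve of the variation is bounded by its maximal speed. -/
lemma exists_dist_variation_le_of_speed {p : M} {α : ℝ → E} {φ : ℝ → ℝ} {t₀ : ℝ}
    (hα : ContDiffAt ℝ ∞ α t₀) (hU : α t₀ ∈ (extChartAt 𝓘(ℝ, E) p).target)
    (hne : deriv α t₀ ≠ 0) (hφ : ContDiff ℝ ∞ φ) :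
    ∃ δ > 0, ∀ a b s B : ℝ, ∀ w : E, a ≤ b → |a - t₀| < δ → |b - t₀| < δ → |s - t₀| < δ → ‖w‖ < δ →
      (∀ t ∈ Icc a b, 0 ≤ variationSpeedSq (chartG p) (chartΓ p) α φ (t, s, w)) ∧
      (0 ≤ B →
      (∀ t ∈ Icc a b, variationSpeedSq (chartG p) (chartΓ p) α φ (t, s, w) ≤ B ^ 2) →
      dist ((extChartAt 𝓘(ℝ, E) p).symm (variation (chartG p) (chartΓ p) α φ (a, s, w)))
        ((extChartAt 𝓘(ℝ, E) p).symm (variation (chartG p) (chartΓ p) α φ (b, s, w)))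
        ≤ B * (b - a)) := by
  have h := isLeviCivitaOn_chart (E := E) p
  have hY := contDiffAt_variation h hα hU hne hφ
  have h0 : variation (chartG p) (chartΓ p) α φ (t₀, t₀, 0) = α t₀ := by simp [variation, quadExp]
  have h1 : ∀ᶠ z in 𝓝 ((t₀, t₀, 0) : ℝ × ℝ × E),
      ContDiffAt ℝ 1 (variation (chartG p) (chartΓ p) α φ) z ∧
      variation (chartG p) (chartΓ p) α φ z ∈ (extChartAt 𝓘(ℝ, E) p).target :=
    ((hY.of_le (by simp)).eventually (by simp)).and
      (hY.continuousAt.preimage_mem_nhds (by rw [h0]; exact h.isOpen.mem_nhds hU))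
  obtain ⟨δ, hδ, H⟩ := Metric.eventually_nhds_iff.mp h1
  refine ⟨δ, hδ, fun a b s B w hab ha hb hs hw ↦ ?_⟩
  have h2 : ∀ t ∈ Icc a b, ContDiffAt ℝ 1 (variation (chartG p) (chartΓ p) α φ) (t, s, w) ∧
      variation (chartG p) (chartΓ p) α φ (t, s, w) ∈ (extChartAt 𝓘(ℝ, E) p).target := by
    intro t ht
    refine H (y := (t, s, w)) ?_
    simp only [Prod.dist_eq, Real.dist_eq, dist_zero_right]
    refine max_lt ?_ (max_lt hs hw)
    rw [abs_lt] at ha hb ⊢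
    constructor <;> linarith [ht.1, ht.2]
  have h3 : ∀ t ∈ Icc a b, HasDerivAt (fun t ↦ variation (chartG p) (chartΓ p) α φ (t, s, w))
      (fderiv ℝ (variation (chartG p) (chartΓ p) α φ) (t, s, w) (1, 0, 0)) t := fun t ht ↦
    ((h2 t ht).1.differentiableAt (by simp)).hasFDerivAt.comp_hasDerivAt
      (f := fun t ↦ (t, s, w)) t ((hasDerivAt_id t).prodMk (hasDerivAt_const t (s, w)))
  refine ⟨fun t ht ↦ h.nonneg (h2 t ht).2 _, fun hB hle ↦ ?_⟩
  refine dist_symm_le (β := fun t ↦ variation (chartG p) (chartΓ p) α φ (t, s, w)) hab hB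
    (fun t ht ↦ ?_) (fun t ht ↦ (h2 t ht).2) fun t ht ↦ ?_
  · exact (h2 t ht).1.comp t (contDiffAt_id.prodMk contDiffAt_const)
  · rw [(h3 t ht).deriv]
    exact hle t ht

/-- The second variation inequality for a short piece of a curve of the variation of a geodesic of
speed `ℓ`, under the lower curvature bound `1` at `t₀`. -/
lemma exists_dist_variation_le {p : M} {α : ℝ → E} {φ : ℝ → ℝ} {t₀ ℓ : ℝ} {I : Set ℝ}
    (hI : I.OrdConnected)
    (hα : ContDiffAt ℝ ∞ α t₀) (hU : α t₀ ∈ (extChartAt 𝓘(ℝ, E) p).target)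
    (hne : deriv α t₀ ≠ 0) (ht₀ : t₀ ∈ I)
    (hgeo : ∀ᶠ t in 𝓝 t₀, t ∈ I → deriv (deriv α) t + chartΓ p (α t) (deriv α t) (deriv α t) = 0)
    (hℓ : 0 < ℓ) (hsp : ∀ᶠ t in 𝓝 t₀, t ∈ I → chartG p (α t) (deriv α t) (deriv α t) = ℓ ^ 2)
    (hcurv : ∀ v, chartG p (α t₀) (deriv α t₀) v = 0 → ℓ ^ 2 * chartG p (α t₀) v v ≤
      chartG p (α t₀) (curvatureOf (chartΓ p) (α t₀) (deriv α t₀) v v) (deriv α t₀))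
    (hφ : ContDiff ℝ ∞ φ) {ε : ℝ} (hε : 0 < ε) :
    ∃ δ > 0, ∀ a b s : ℝ, ∀ w : E, a ∈ I → b ∈ I → a ≤ b → |a - t₀| < δ → |b - t₀| < δ →
      |s - t₀| < δ → ‖w‖ < δ →
      dist ((extChartAt 𝓘(ℝ, E) p).symm (variation (chartG p) (chartΓ p) α φ (a, s, w)))
        ((extChartAt 𝓘(ℝ, E) p).symm (variation (chartG p) (chartΓ p) α φ (b, s, w)))
        ≤ (b - a) * (ℓ + ((deriv φ t₀ ^ 2 - φ t₀ ^ 2 * ℓ ^ 2)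
          * normalMetric (chartG p) (chartΓ p) α t₀ t₀ w w + ε * ‖w‖ ^ 2) / (2 * ℓ)) := by
  have h := isLeviCivitaOn_chart (E := E) p
  obtain ⟨δ₁, hδ₁, H₁⟩ := exists_variationSpeedSq_le h hα hU hne hφ (hgeo.self_of_nhds ht₀) hε
  obtain ⟨δ₂, hδ₂, H₂⟩ := exists_dist_variation_le_of_speed hα hU hne hφ
  obtain ⟨δ₃, hδ₃, H₃⟩ := Metric.eventually_nhds_iff.mp (hgeo.and hsp)
  refine ⟨min δ₁ (min δ₂ δ₃), by positivity, fun a b s w haI hbI hab ha hb hs hw ↦ ?_⟩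
  set X := (deriv φ t₀ ^ 2 - φ t₀ ^ 2 * ℓ ^ 2)
    * normalMetric (chartG p) (chartΓ p) α t₀ t₀ w w + ε * ‖w‖ ^ 2 with hX
  have hδ₁' : min δ₁ (min δ₂ δ₃) ≤ δ₁ := min_le_left _ _
  have hδ₂' : min δ₁ (min δ₂ δ₃) ≤ δ₂ := (min_le_right _ _).trans (min_le_left _ _)
  have hδ₃' : min δ₁ (min δ₂ δ₃) ≤ δ₃ := (min_le_right _ _).trans (min_le_right _ _)
  obtain ⟨hpos, hdist⟩ := H₂ a b s (ℓ + X / (2 * ℓ)) w hab (ha.trans_le hδ₂') (hb.trans_le hδ₂')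
    (hs.trans_le hδ₂') (hw.trans_le hδ₂')
  have hF : ∀ t ∈ Icc a b, variationSpeedSq (chartG p) (chartΓ p) α φ (t, s, w) ≤ ℓ ^ 2 + X := by
    intro t ht
    have htI : t ∈ I := hI.out haI hbI ht
    have htδ : |t - t₀| < min δ₁ (min δ₂ δ₃) := by
      rw [abs_lt] at ha hb ⊢
      constructor <;> linarith [ht.1, ht.2]
    obtain ⟨h1, h2⟩ := H₃ (y := t) (htδ.trans_le hδ₃')
    have h3 := H₁ t s (htδ.trans_le hδ₁') (hs.trans_le hδ₁') (h1 htI) w (hw.trans_le hδ₁')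
    have h4 := hcurv (normalTransport (chartG p) (chartΓ p) α t₀ t₀ w)
      (metric_normalTransport (h.pos _ hU _ hne).ne' w)
    rw [← normalMetric_apply] at h4
    have h5 := mul_le_mul_of_nonneg_left h4 (sq_nonneg (φ t₀))
    rw [h2 htI] at h3
    linarith
  have hX0 : 0 ≤ ℓ ^ 2 + X := (hpos a (left_mem_Icc.mpr hab)).trans (hF a (left_mem_Icc.mpr hab))
  -- `ℓ + X / (2 ℓ)` is an upper bound of the square root of `ℓ² + X`
  have hB : 0 ≤ ℓ + X / (2 * ℓ) := by
    have : ℓ + X / (2 * ℓ) = (ℓ ^ 2 + X + ℓ ^ 2) / (2 * ℓ) := by field_simp; ring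
    rw [this]
    positivity
  refine (hdist hB fun t ht ↦ (hF t ht).trans ?_).trans_eq (mul_comm _ _)
  have : (ℓ + X / (2 * ℓ)) ^ 2 = ℓ ^ 2 + X + (X / (2 * ℓ)) ^ 2 := by field_simp; ring
  rw [this]
  nlinarith [sq_nonneg (X / (2 * ℓ))]

end Step

/-! ### Coordinates at the centre of a chart, and independence of the chart -/

section Coords

variable {E : Type*} [NormedAddCommGroup E] [NormedSpace ℝ E] [FiniteDimensional ℝ E]
  {M : Type*} [MetricSpace M] [ChartedSpace E M] [IsManifold 𝓘(ℝ, E) ∞ M]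
  [RiemannianBundle (fun x : M ↦ TangentSpace 𝓘(ℝ, E) x)]
  [IsContMDiffRiemannianBundle 𝓘(ℝ, E) ∞ E (fun x : M ↦ TangentSpace 𝓘(ℝ, E) x)]

lemma mfderiv_symm_coords (p : M) (v : E) :
    (mfderiv 𝓘(ℝ, E) 𝓘(ℝ, E) (extChartAt 𝓘(ℝ, E) p).symm (extChartAt 𝓘(ℝ, E) p p) : E →L[ℝ] E)
      (coords (E := E) p v) = v := by
  have h1 : HasMFDerivAt 𝓘(ℝ, E) 𝓘(ℝ, E) (extChartAt 𝓘(ℝ, E) p) p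
      (mfderiv 𝓘(ℝ, E) 𝓘(ℝ, E) (extChartAt 𝓘(ℝ, E) p) p) :=
    (mdifferentiableAt_extChartAt (I := 𝓘(ℝ, E)) (mem_chart_source E p)).hasMFDerivAt
  have h2 := (mdifferentiableAt_chart_symm p (mem_extChartAt_target (I := 𝓘(ℝ, E)) p)).hasMFDerivAt
  have h3 := h2.comp p h1
  have h4 : (extChartAt 𝓘(ℝ, E) p).symm ∘ extChartAt 𝓘(ℝ, E) p =ᶠ[𝓝 p] id := by
    filter_upwards [extChartAt_source_mem_nhds (I := 𝓘(ℝ, E)) p] with x hx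
      using (extChartAt 𝓘(ℝ, E) p).left_inv hx
  have h5 := (hasMFDerivAt_id (I := 𝓘(ℝ, E)) p).congr_of_eventuallyEq h4
  exact DFunLike.congr_fun (hasMFDerivAt_unique h3 h5) v

lemma chartG_coords (p : M) (u v : TangentSpace 𝓘(ℝ, E) p) :
    chartG p (extChartAt 𝓘(ℝ, E) p p) (coords p u) (coords p v) = inner ℝ u v := by
  rw [chartG_eq_tangentInner]
  refine (congrArg₂ (tangentInner (E := E) _) (mfderiv_symm_coords (E := E) p u)
    (mfderiv_symm_coords (E := E) p v)).trans ?_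
  rw [extChartAt_to_inv]
  rfl

lemma chartG_coords_self (p : M) (v : TangentSpace 𝓘(ℝ, E) p) :
    chartG p (extChartAt 𝓘(ℝ, E) p p) (coords p v) (coords p v) = ‖v‖ ^ 2 := by
  rw [chartG_coords, real_inner_self_eq_norm_sq]

/-- The curvature bound for a pair of orthogonal vectors, in coordinates. -/
lemma SecGE.le_curvatureOf (hsec : SecGE E M 1) (p : M) {u v : E} (hu : u ≠ 0)
    (huv : chartG p (extChartAt 𝓘(ℝ, E) p p) u v = 0) :
    chartG p (extChartAt 𝓘(ℝ, E) p p) u u * chartG p (extChartAt 𝓘(ℝ, E) p p) v v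
      ≤ chartG p (extChartAt 𝓘(ℝ, E) p p)
        (curvatureOf (chartΓ p) (extChartAt 𝓘(ℝ, E) p p) u v v) u := by
  have hyt := mem_extChartAt_target (I := 𝓘(ℝ, E)) p
  have hLC := isLeviCivitaOn_chart (E := E) p
  rcases eq_or_ne v 0 with hv | hv
  · simp [hv, curvatureOf]
  have hsurj : Function.Surjective (coords (E := E) p : E → E) := by
    let L : E →L[ℝ] E := mfderiv 𝓘(ℝ, E) 𝓘(ℝ, E) (extChartAt 𝓘(ℝ, E) p) p
    have hl : Function.Injective (L : E →ₗ[ℝ] E) :=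
      Function.LeftInverse.injective (mfderiv_symm_coords p)
    have hs : Function.Surjective (L : E →ₗ[ℝ] E) := LinearMap.surjective_of_injective hl
    exact hs
  obtain ⟨u', rfl⟩ := hsurj u
  obtain ⟨v', rfl⟩ := hsurj v
  change TangentSpace 𝓘(ℝ, E) p at u' v'
  have huv' : inner ℝ u' v' = 0 := (chartG_coords (E := E) p u' v').symm.trans huv
  have hu0 : 0 < ‖u'‖ ^ 2 := by
    rw [← chartG_coords_self]; exact hLC.pos _ hyt _ hu
  have hv0 : 0 < ‖v'‖ ^ 2 := by
    rw [← chartG_coords_self]; exact hLC.pos _ hyt _ hv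
  have hind : LinearIndependent ℝ ![u', v'] := by
    rw [LinearIndependent.pair_iff]
    intro s t hst
    have h1 : inner ℝ u' (s • u' + t • v') = 0 := by
      rw [hst, inner_zero_right]
    have h2 : inner ℝ v' (s • u' + t • v') = 0 := by
      rw [hst, inner_zero_right]
    rw [inner_add_right, real_inner_smul_right, real_inner_smul_right, huv',
      real_inner_self_eq_norm_sq, mul_zero, add_zero] at h1
    rw [inner_add_right, real_inner_smul_right, real_inner_smul_right, real_inner_comm, huv',
      real_inner_self_eq_norm_sq, mul_zero, zero_add] at h2
    exact ⟨(mul_eq_zero.mp h1).resolve_right hu0.ne', (mul_eq_zero.mp h2).resolve_right hv0.ne'⟩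
  have h1 := hsec p u' v' hind
  rw [sectionalCurvature, huv', le_div_iff₀ (by rw [zero_pow two_ne_zero, sub_zero]; positivity),
    chartCurvature_eq p hyt] at h1
  rw [chartG_coords_self, chartG_coords_self]
  calc _ = 1 * (‖u'‖ ^ 2 * ‖v'‖ ^ 2 - 0 ^ 2) := by
        ring
    _ ≤ _ := h1

end Coords

section Propagation

variable {E : Type*} [NormedAddCommGroup E] [NormedSpace ℝ E] [FiniteDimensional ℝ E]
  {M : Type*} [MetricSpace M] [ChartedSpace E M] [IsManifold 𝓘(ℝ, E) ∞ M]
  [RiemannianBundle (fun x : M ↦ TangentSpace 𝓘(ℝ, E) x)]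
  [IsContMDiffRiemannianBundle 𝓘(ℝ, E) ∞ E (fun x : M ↦ TangentSpace 𝓘(ℝ, E) x)]
  [IsRiemannianManifold 𝓘(ℝ, E) M]

/-- `NormalBound` does not depend on the chart, since the second order exponential map does not, up
to an error of order greater than two, and `ρ` is Lipschitz. -/
lemma NormalBound.transition {ρ : M → ℝ} (hρ : ∀ x y, ρ x ≤ ρ y + dist x y) {p p' : M} {y' v' : E}
    (hy : y' ∈ transitionSource (E := E) p' p) {k m c : ℝ}
    (hb : NormalBound ρ p (RiemConvex.transition p' p y')
      (fderiv ℝ (RiemConvex.transition (E := E) p' p) y' v') k m c) :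
    NormalBound ρ p' y' v' k m c := by
  have h := isLeviCivitaOn_chart (E := E) p
  have h' := isLeviCivitaOn_chart (E := E) p'
  have hT := isLocalIsometryOn_transition (E := E) p' p
  set T := RiemConvex.transition (E := E) p' p with hTdef
  have hTy : T y' ∈ (extChartAt 𝓘(ℝ, E) p).target := hT.mapsTo hy
  obtain ⟨C, hC, r, hr, hlip⟩ := exists_dist_symm_le (E := E) p hTy
  set A := fderiv ℝ T y' with hA
  intro ε hε
  have e1 := hT.quadExp_isLittleO h' h inter_subset_left hy
    (ε := ε / 2 / (C * (k ^ 2 + 1))) (by positivity)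
  have hA0 : Tendsto (fun w ↦ A w) (𝓝 0) (𝓝 0) := by simpa using A.continuous.tendsto 0
  have hk0 : Tendsto (fun w : E ↦ k • w) (𝓝 0) (𝓝 0) := by
    simpa using (continuous_const_smul k).tendsto (0 : E)
  have e2 := hA0.eventually (hb (ε / 2 / (‖A‖ ^ 2 + 1)) (by positivity))
  have hq' : Tendsto (fun w : E ↦ quadExp (chartΓ p') y' (k • w)) (𝓝 0) (𝓝 y') := by
    have : Continuous fun w : E ↦ quadExp (chartΓ p') y' (k • w) := by unfold quadExp; fun_prop
    simpa [quadExp] using this.tendsto 0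
  have hq : Tendsto (fun w : E ↦ quadExp (chartΓ p) (T y') (A (k • w))) (𝓝 0) (𝓝 (T y')) := by
    have : Continuous fun w : E ↦ quadExp (chartΓ p) (T y') (A (k • w)) := by
      unfold quadExp; fun_prop
    simpa [quadExp] using this.tendsto 0
  have hTc : ContinuousAt T y' := (hT.contDiffOn.continuousOn).continuousAt (hT.isOpen.mem_nhds hy)
  filter_upwards [hk0.eventually e1, e2, hq'.eventually (hT.isOpen.mem_nhds hy),
    hq.eventually (Metric.ball_mem_nhds _ hr),
    (hTc.tendsto.comp hq').eventually (Metric.ball_mem_nhds _ hr)] with w h1 h2 h3 h4 h5 hperp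
  have h6 := h2 (by rw [← hT.metric_eq y' hy]; exact hperp)
  rw [← hT.metric_eq y' hy] at h6
  have h7 : (extChartAt 𝓘(ℝ, E) p).symm (T (quadExp (chartΓ p') y' (k • w)))
      = (extChartAt 𝓘(ℝ, E) p').symm (quadExp (chartΓ p') y' (k • w)) :=
    (extChartAt 𝓘(ℝ, E) p).left_inv h3.2
  have h8 := hlip _ h5 _ h4
  simp only [Function.comp_apply] at h8
  rw [h7, ← norm_neg, neg_sub] at h8
  have h9 := hρ ((extChartAt 𝓘(ℝ, E) p').symm (quadExp (chartΓ p') y' (k • w)))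
    ((extChartAt 𝓘(ℝ, E) p).symm (quadExp (chartΓ p) (T y') (A (k • w))))
  rw [← map_smul] at h6
  have h10 : C * ‖T (quadExp (chartΓ p') y' (k • w)) - quadExp (chartΓ p) (T y') (A (k • w))‖
      ≤ ε / 2 * ‖w‖ ^ 2 := by
    calc _ ≤ C * (ε / 2 / (C * (k ^ 2 + 1)) * ‖k • w‖ ^ 2) := by gcongr
      _ = (ε / 2 * ‖w‖ ^ 2) * (k ^ 2 / (k ^ 2 + 1)) := by
        rw [norm_smul, mul_pow, Real.norm_eq_abs, sq_abs]; field_simp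
      _ ≤ (ε / 2 * ‖w‖ ^ 2) * 1 := by
          gcongr
          rw [div_le_one (by positivity)]
          linarith
      _ = _ := mul_one _
  have h11 : ε / 2 / (‖A‖ ^ 2 + 1) * ‖A w‖ ^ 2 ≤ ε / 2 * ‖w‖ ^ 2 := by
    calc ε / 2 / (‖A‖ ^ 2 + 1) * ‖A w‖ ^ 2 ≤ ε / 2 / (‖A‖ ^ 2 + 1) * (‖A‖ * ‖w‖) ^ 2 := by
          gcongr
          exact A.le_opNorm w
      _ = (ε / 2 * ‖w‖ ^ 2) * (‖A‖ ^ 2 / (‖A‖ ^ 2 + 1)) := by ring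
      _ ≤ (ε / 2 * ‖w‖ ^ 2) * 1 := by
          gcongr
          rw [div_le_one (by positivity)]
          linarith
      _ = _ := mul_one _
  linarith

/-- `NormalBound` at the time `t` of a curve `γ` of speed `ℓ`, in the chart centred at `p`, for a
variation field of size `φ t`: the function `ρ` is bounded by the arc length `ℓ t` to zeroth order,
and by `c t` to second order. -/
def CurveBound (ρ : M → ℝ) (γ : ℝ → M) (φ c : ℝ → ℝ) (ℓ : ℝ) (p : M) (t : ℝ) : Prop :=
  NormalBound ρ p (extChartAt 𝓘(ℝ, E) p (γ t)) (deriv (extChartAt 𝓘(ℝ, E) p ∘ γ) t)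
    (φ t) (ℓ * t) (c t)

lemma CurveBound.chart_change {ρ : M → ℝ} (hρ : ∀ x y, ρ x ≤ ρ y + dist x y) {γ : ℝ → M}
    {φ c : ℝ → ℝ} {ℓ t : ℝ} (hγ : ContMDiffAt 𝓘(ℝ, ℝ) 𝓘(ℝ, E) 1 γ t) {p p' : M}
    (hp : γ t ∈ (extChartAt 𝓘(ℝ, E) p).source) (hp' : γ t ∈ (extChartAt 𝓘(ℝ, E) p').source)
    (hb : CurveBound (E := E) ρ γ φ c ℓ p t) : CurveBound (E := E) ρ γ φ c ℓ p' t := by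
  have hy := chart_mem_transitionSource (E := E) hp' hp
  refine NormalBound.transition hρ hy ?_
  have h1 : transition (E := E) p' p (extChartAt 𝓘(ℝ, E) p' (γ t))
      = extChartAt 𝓘(ℝ, E) p (γ t) := by
    simp only [RiemConvex.transition, Function.comp_apply]
    rw [(extChartAt 𝓘(ℝ, E) p').left_inv hp']
  have h2 : deriv (extChartAt 𝓘(ℝ, E) p ∘ γ) t = fderiv ℝ (transition (E := E) p' p)
      (extChartAt 𝓘(ℝ, E) p' (γ t)) (deriv (extChartAt 𝓘(ℝ, E) p' ∘ γ) t) := by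
    have h3 := (((contDiffOn_transition (E := E) p' p).contDiffAt
      ((isOpen_transitionSource p' p).mem_nhds hy)).differentiableAt (by simp)).hasFDerivAt
    have h4 := ((contDiffAt_chart_comp (E := E) (n := 1) hγ hp').differentiableAt
      (by simp)).hasDerivAt
    have h5 := h3.comp_hasDerivAt t h4
    rw [← h5.deriv]
    refine EventuallyEq.deriv_eq ?_
    filter_upwards [symm_comp_chart_eventuallyEq (E := E) hγ.continuousAt hp'] with s hs
    simp only [RiemConvex.transition, Function.comp_apply] at hs ⊢
    rw [hs]
  rw [h1, ← h2]
  exact hb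

end Propagation

/-! ### Propagation along a geodesic -/

/-- Real induction on the unit interval, in a form suited to steps whose length is only locally
bounded below. -/
lemma Icc_induction {P : ℝ → Prop} (h0 : P 0)
    (hstep : ∀ t₀ ∈ Icc (0 : ℝ) 1, ∃ δ > 0, ∀ s₁ ∈ Icc (0 : ℝ) 1, ∀ s ∈ Icc (0 : ℝ) 1,
      |s₁ - t₀| < δ → |s - t₀| < δ → s₁ ≤ s → P s₁ → P s) :
    ∀ t ∈ Icc (0 : ℝ) 1, P t := by
  set S := {t | t ∈ Icc (0 : ℝ) 1 ∧ ∀ s ∈ Icc 0 t, P s} with hS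
  have h0S : (0 : ℝ) ∈ S := ⟨by simp, fun s hs ↦ by
    rw [Icc_self, mem_singleton_iff] at hs; rwa [hs]⟩
  have hbdd : BddAbove S := ⟨1, fun t ht ↦ ht.1.2⟩
  set T := sSup S with hT
  have hT0 : 0 ≤ T := le_csSup hbdd h0S
  have hT1 : T ≤ 1 := csSup_le ⟨0, h0S⟩ fun t ht ↦ ht.1.2
  obtain ⟨δ, hδ, H⟩ := hstep T ⟨hT0, hT1⟩
  obtain ⟨s₁, hs₁, hlt⟩ := exists_lt_of_lt_csSup ⟨0, h0S⟩ (show T - δ < sSup S by linarith)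
  have hs₁T : s₁ ≤ T := le_csSup hbdd hs₁
  have key : ∀ s ∈ Icc (0 : ℝ) 1, s < T + δ → P s := by
    intro s hs hsT
    rcases le_or_gt s s₁ with h | h
    · exact hs₁.2 s ⟨hs.1, h⟩
    · exact H s₁ hs₁.1 s hs (by rw [abs_lt]; constructor <;> linarith)
        (by rw [abs_lt]; constructor <;> linarith) h.le (hs₁.2 s₁ ⟨hs₁.1.1, le_rfl⟩)
  have hT1' : T = 1 := by
    by_contra hne
    have hlt1 : T < 1 := lt_of_le_of_ne hT1 hne
    have : min 1 (T + δ / 2) ∈ S :=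
      ⟨⟨by positivity, min_le_left _ _⟩, fun s hs ↦ key s ⟨hs.1, hs.2.trans (min_le_left _ _)⟩
        ((hs.2.trans (min_le_right _ _)).trans_lt (by linarith))⟩
    have h2 := le_csSup hbdd this
    rcases min_le_iff.mp (h2.trans_eq hT.symm) with h | h <;> linarith
  exact fun t ht ↦ key t ht (by linarith [ht.2])

section Propagation

variable {E : Type*} [NormedAddCommGroup E] [NormedSpace ℝ E] [FiniteDimensional ℝ E]
  {M : Type*} [MetricSpace M] [ChartedSpace E M] [IsManifold 𝓘(ℝ, E) ∞ M]
  [RiemannianBundle (fun x : M ↦ TangentSpace 𝓘(ℝ, E) x)]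
  [IsContMDiffRiemannianBundle 𝓘(ℝ, E) ∞ E (fun x : M ↦ TangentSpace 𝓘(ℝ, E) x)]

/-- The expression of a geodesic of positive speed in the chart centred at one of its points. -/
lemma IsGeodesicOn.chart_facts (hsec : SecGE E M 1) {γ : ℝ → M} {I : Set ℝ} {ℓ t₀ : ℝ}
    (hγ : IsGeodesicOn E γ I) (hℓ : 0 < ℓ)
    (hsp : ∀ t ∈ I, ‖mfderiv 𝓘(ℝ, ℝ) 𝓘(ℝ, E) γ t (1 : ℝ)‖ = ℓ) (ht₀ : t₀ ∈ I) {α : ℝ → E}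
    (hαdef : α = extChartAt 𝓘(ℝ, E) (γ t₀) ∘ γ) :
    ContDiffAt ℝ ∞ α t₀ ∧ α t₀ ∈ (extChartAt 𝓘(ℝ, E) (γ t₀)).target ∧ deriv α t₀ ≠ 0 ∧
      (∀ᶠ t in 𝓝 t₀, γ t ∈ (extChartAt 𝓘(ℝ, E) (γ t₀)).source) ∧
      (∀ᶠ t in 𝓝 t₀, t ∈ I →
        deriv (deriv α) t + chartΓ (γ t₀) (α t) (deriv α t) (deriv α t) = 0) ∧
      (∀ᶠ t in 𝓝 t₀, t ∈ I → chartG (γ t₀) (α t) (deriv α t) (deriv α t) = ℓ ^ 2) ∧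
      (∀ v, chartG (γ t₀) (α t₀) (deriv α t₀) v = 0 → ℓ ^ 2 * chartG (γ t₀) (α t₀) v v ≤
        chartG (γ t₀) (α t₀) (curvatureOf (chartΓ (γ t₀)) (α t₀) (deriv α t₀) v v)
          (deriv α t₀)) := by
  subst hαdef
  have hs : γ t₀ ∈ (extChartAt 𝓘(ℝ, E) (γ t₀)).source := mem_extChartAt_source (γ t₀)
  have hsrc : ∀ᶠ t in 𝓝 t₀, γ t ∈ (extChartAt 𝓘(ℝ, E) (γ t₀)).source :=
    (hγ t₀ ht₀).1.continuousAt.preimage_mem_nhds (extChartAt_source_mem_nhds _)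
  have hspeed : ∀ t ∈ I, γ t ∈ (extChartAt 𝓘(ℝ, E) (γ t₀)).source →
      chartG (γ t₀) ((extChartAt 𝓘(ℝ, E) (γ t₀) ∘ γ) t)
        (deriv (extChartAt 𝓘(ℝ, E) (γ t₀) ∘ γ) t) (deriv (extChartAt 𝓘(ℝ, E) (γ t₀) ∘ γ) t)
        = ℓ ^ 2 := fun t ht hts ↦ by
    rw [← hsp t ht, speed_sq_eq (E := E) ((hγ t ht).1.of_le (by simp)) hts]
    rfl
  have hne : deriv (extChartAt 𝓘(ℝ, E) (γ t₀) ∘ γ) t₀ ≠ 0 := by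
    intro h0
    have := hspeed t₀ ht₀ hs
    rw [h0] at this
    simp only [map_zero] at this
    have : 0 < ℓ ^ 2 := by positivity
    linarith
  refine ⟨contDiffAt_chart_comp (E := E) (n := ⊤) (hγ t₀ ht₀).1 hs,
    (extChartAt 𝓘(ℝ, E) (γ t₀)).map_source hs, hne, hsrc, ?_, ?_, fun v hv ↦ ?_⟩
  · filter_upwards [hsrc] with t ht htI using hγ.chart_eq htI ht
  · filter_upwards [hsrc] with t ht htI using hspeed t htI ht
  · rw [← hspeed t₀ ht₀ hs]
    exact hsec.le_curvatureOf (γ t₀) hne hv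

variable [IsRiemannianManifold 𝓘(ℝ, E) M]

/-- One step of the propagation of the bound along a geodesic: from the point of the variation at
time `s` one follows the curve of the variation back to time `s₁`. -/
lemma CurveBound.exists_step {ρ : M → ℝ} (hρ : ∀ x y, ρ x ≤ ρ y + dist x y)
    (hsec : SecGE E M 1) {γ : ℝ → M} {I : Set ℝ} (hI : I.OrdConnected) {ℓ t₀ : ℝ}
    (hγ : IsGeodesicOn E γ I) (hℓ : 0 < ℓ)
    (hsp : ∀ t ∈ I, ‖mfderiv 𝓘(ℝ, ℝ) 𝓘(ℝ, E) γ t (1 : ℝ)‖ = ℓ) (ht₀ : t₀ ∈ I)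
    {φ c : ℝ → ℝ} {c' : ℝ} (hφ : ContDiff ℝ ∞ φ) (hc : HasStrictDerivAt c c' t₀)
    (hc' : (deriv φ t₀ ^ 2 - φ t₀ ^ 2 * ℓ ^ 2) / (2 * ℓ) < c') :
    ∃ δ > 0, ∀ s₁ ∈ I, ∀ s ∈ I, |s₁ - t₀| < δ → |s - t₀| < δ → s₁ ≤ s →
      CurveBound (E := E) ρ γ φ c ℓ (γ s₁) s₁ → CurveBound (E := E) ρ γ φ c ℓ (γ s) s := by
  set p := γ t₀ with hp
  obtain ⟨hα, hU, hne, hsrc, hgeo, hspeed, hcurv⟩ := hγ.chart_facts hsec hℓ hsp ht₀ rfl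
  rw [← hp] at hα hU hne hsrc hgeo hspeed hcurv
  set α := extChartAt 𝓘(ℝ, E) p ∘ γ with hαdef
  obtain ⟨ε₁, hε₁, δ₁, hδ₁, H₁⟩ := NormalBound.exists_add_le (ρ := ρ) hα hU hne
    (hgeo.self_of_nhds ht₀) hℓ hc hc'
  obtain ⟨δ₂, hδ₂, H₂⟩ := exists_dist_variation_le hI hα hU hne ht₀ hgeo hℓ hspeed hcurv hφ hε₁
  obtain ⟨δ₃, hδ₃, H₃⟩ := Metric.eventually_nhds_iff.mp hsrc
  refine ⟨min δ₁ (min δ₂ δ₃), by positivity, fun s₁ hs₁I s hsI hs₁ hs hle hb ↦ ?_⟩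
  have i1 : min δ₁ (min δ₂ δ₃) ≤ δ₁ := min_le_left _ _
  have i2 : min δ₁ (min δ₂ δ₃) ≤ δ₂ := (min_le_right _ _).trans (min_le_left _ _)
  have i3 : min δ₁ (min δ₂ δ₃) ≤ δ₃ := (min_le_right _ _).trans (min_le_right _ _)
  have hb' : CurveBound (E := E) ρ γ φ c ℓ p s₁ :=
    hb.chart_change hρ ((hγ s₁ hs₁I).1.of_le (by simp)) (mem_extChartAt_source _)
      (H₃ (y := s₁) (hs₁.trans_le i3))
  refine CurveBound.chart_change hρ ((hγ s hsI).1.of_le (by simp)) (p := p)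
    (H₃ (y := s) (hs.trans_le i3)) (mem_extChartAt_source _) ?_
  intro ε hε
  have hball : ∀ᶠ w in 𝓝 (0 : E), ‖w‖ < δ₂ :=
    Metric.eventually_nhds_iff.mpr ⟨δ₂, hδ₂, fun w hw ↦ by simpa using hw⟩
  filter_upwards [H₁ s₁ s (hs₁.trans_le i1) (hs.trans_le i1) hle hb' ε hε, hball]
    with w h1 h2 hperp
  have h3 := h1 hperp
  have h4 := H₂ s₁ s s w hs₁I hsI hle (hs₁.trans_le i2) (hs.trans_le i2) (hs.trans_le i2) h2
  rw [dist_comm] at h4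
  have h5 := hρ ((extChartAt 𝓘(ℝ, E) p).symm (variation (chartG p) (chartΓ p) α φ (s, s, w)))
    ((extChartAt 𝓘(ℝ, E) p).symm (variation (chartG p) (chartΓ p) α φ (s₁, s, w)))
  have h6 : variation (chartG p) (chartΓ p) α φ (s, s, w) = quadExp (chartΓ p) (α s) (φ s • w) := by
    have h7 : normalTransport (chartG p) (chartΓ p) α s s w = w := normalTransport_self hperp
    simp only [variation, h7]
  rw [h6] at h4 h5
  change ρ ((extChartAt 𝓘(ℝ, E) p).symm (quadExp (chartΓ p) (α s) (φ s • w)))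
      ≤ ℓ * s + c s * chartG p (α s) w w + ε * ‖w‖ ^ 2
  linarith

/-- Propagation of the bound along the whole geodesic. -/
lemma CurveBound.of_zero {ρ : M → ℝ} (hρ : ∀ x y, ρ x ≤ ρ y + dist x y)
    (hsec : SecGE E M 1) {γ : ℝ → M} {ℓ : ℝ}
    (hγ : IsGeodesicOn E γ (Icc 0 1)) (hℓ : 0 < ℓ)
    (hsp : ∀ t ∈ Icc (0 : ℝ) 1, ‖mfderiv 𝓘(ℝ, ℝ) 𝓘(ℝ, E) γ t (1 : ℝ)‖ = ℓ)
    {φ c c' : ℝ → ℝ} (hφ : ContDiff ℝ ∞ φ) (hc : ∀ t ∈ Icc (0 : ℝ) 1, HasStrictDerivAt c (c' t) t)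
    (hc' : ∀ t ∈ Icc (0 : ℝ) 1, (deriv φ t ^ 2 - φ t ^ 2 * ℓ ^ 2) / (2 * ℓ) < c' t)
    (h0 : CurveBound (E := E) ρ γ φ c ℓ (γ 0) 0) :
    ∀ t ∈ Icc (0 : ℝ) 1, CurveBound (E := E) ρ γ φ c ℓ (γ t) t :=
  Icc_induction (P := fun t ↦ CurveBound (E := E) ρ γ φ c ℓ (γ t) t) h0 fun _ ht₀ ↦
    CurveBound.exists_step hρ hsec ordConnected_Icc hγ hℓ hsp ht₀ hφ (hc _ ht₀) (hc' _ ht₀)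

set_option maxHeartbeats 1000000 in
/-- The bound at all points near the endpoint of the geodesic, by shortening the curves of the
variation, or prolonging them, by the time `z.1`. -/
lemma CurveBound.eventually_le {ρ : M → ℝ} (hρ : ∀ x y, ρ x ≤ ρ y + dist x y)
    (hsec : SecGE E M 1) {γ : ℝ → M} {ℓ : ℝ}
    (hγ : IsGeodesicOn E γ (Icc 0 1)) (hℓ : 0 < ℓ)
    (hsp : ∀ t ∈ Icc (0 : ℝ) 1, ‖mfderiv 𝓘(ℝ, ℝ) 𝓘(ℝ, E) γ t (1 : ℝ)‖ = ℓ)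
    {φ c : ℝ → ℝ} {c' : ℝ} (hφ : ContDiff ℝ ∞ φ) (hc : HasStrictDerivAt c c' 1)
    (hc' : (deriv φ 1 ^ 2 - φ 1 ^ 2 * ℓ ^ 2) / (2 * ℓ) < c')
    (hb : ∀ t ∈ Ico (0 : ℝ) 1, CurveBound (E := E) ρ γ φ c ℓ (γ t) t) {p : M} (hp : p = γ 1)
    {α : ℝ → E} (hαdef : α = extChartAt 𝓘(ℝ, E) p ∘ γ) {ε : ℝ} (hε : 0 < ε) :
    ∀ᶠ z : ℝ × E in 𝓝 0, chartG p (α 1) (deriv α 1) z.2 = 0 →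
      ρ ((extChartAt 𝓘(ℝ, E) p).symm (variation (chartG p) (chartΓ p) α φ (1 + z.1, 1, z.2)))
        ≤ ℓ + ℓ * z.1 + c 1 * chartG p (α 1) z.2 z.2 + ε * (z.1 ^ 2 + ‖z.2‖ ^ 2) := by
  have h1I : (1 : ℝ) ∈ Icc (0 : ℝ) 1 := by simp
  subst hp
  set p := γ 1 with hp
  obtain ⟨hα, hU, hne, hsrc, hgeo, hspeed, hcurv⟩ := hγ.chart_facts hsec hℓ hsp h1I hαdef
  rw [← hp] at hU hsrc hgeo hspeed hcurv
  have hLC := isLeviCivitaOn_chart (E := E) p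
  obtain ⟨ε₁, hε₁, δ₁, hδ₁, H₁⟩ := NormalBound.exists_add_le (ρ := ρ) hα hU hne
    (hgeo.self_of_nhds h1I) hℓ hc hc'
  obtain ⟨δ₂, hδ₂, H₂⟩ := exists_dist_variation_le ordConnected_Icc hα hU hne h1I hgeo hℓ hspeed
    hcurv hφ hε₁
  obtain ⟨δ₃, hδ₃, H₃⟩ := Metric.eventually_nhds_iff.mp hsrc
  obtain ⟨δ₄, hδ₄, H₄⟩ := exists_dist_variation_le_of_speed hα hU hne hφ
  obtain ⟨C, hC, δ₅, hδ₅, H₅⟩ := exists_variationSpeedSq_le_of_deriv_eq_zero hLC hα hU hne hφ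
    (hgeo.self_of_nhds h1I)
  set δ := min (min δ₁ (min δ₂ δ₃)) (min δ₄ (min δ₅ 1)) with hδ
  have hδ0 : 0 < δ := by positivity
  have i1 : δ ≤ δ₁ := (min_le_left _ _).trans (min_le_left _ _)
  have i2 : δ ≤ δ₂ := ((min_le_left _ _).trans (min_le_right _ _)).trans (min_le_left _ _)
  have i3 : δ ≤ δ₃ := ((min_le_left _ _).trans (min_le_right _ _)).trans (min_le_right _ _)
  have i4 : δ ≤ δ₄ := (min_le_right _ _).trans (min_le_left _ _)
  have i5 : δ ≤ δ₅ := ((min_le_right _ _).trans (min_le_right _ _)).trans (min_le_left _ _)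
  have i6 : δ ≤ 1 := ((min_le_right _ _).trans (min_le_right _ _)).trans (min_le_right _ _)
  -- all curves start from the bound at the earlier time `s₁`
  set s₁ := 1 - δ / 2 with hs₁
  have hs₁I : s₁ ∈ Ico (0 : ℝ) 1 := ⟨by linarith, by linarith⟩
  have hs₁δ : |s₁ - 1| < δ := by rw [abs_lt]; constructor <;> linarith
  have h11 : |(1 : ℝ) - 1| < δ := by simpa using hδ0
  have hb' : CurveBound (E := E) ρ γ φ c ℓ p s₁ :=
    (hb s₁ hs₁I).chart_change hρ ((hγ s₁ (Ico_subset_Icc_self hs₁I)).1.of_le (by simp))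
      (mem_extChartAt_source _) (H₃ (y := s₁) (hs₁δ.trans_le i3))
  subst hαdef
  set α := extChartAt 𝓘(ℝ, E) p ∘ γ with hαdef
  have K₁ := H₁ s₁ 1 (hs₁δ.trans_le i1) (h11.trans_le i1) hs₁I.2.le hb' (ε / 2) (by positivity)
  set κ := deriv φ 1 ^ 2 - φ 1 ^ 2 * ℓ ^ 2 with hκ
  set N := normalMetric (chartG p) (chartΓ p) α 1 1 with hN
  set C' := (|κ| * ‖N‖ + ε₁) / (2 * ℓ) with hC'
  have hC'0 : 0 < C' := by positivity
  set δ' := min (δ / 2) (min (ε / 2 / C') (ε / 2 / (C / ℓ))) with hδ'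
  have hδ'0 : 0 < δ' := by positivity
  have hsnd : Tendsto (fun z : ℝ × E ↦ z.2) (𝓝 0) (𝓝 0) := continuous_snd.tendsto (0 : ℝ × E)
  have hfst : Tendsto (fun z : ℝ × E ↦ z.1) (𝓝 0) (𝓝 0) := continuous_fst.tendsto (0 : ℝ × E)
  filter_upwards [hsnd.eventually K₁, hsnd.eventually (Metric.ball_mem_nhds (0 : E) hδ0),
    hfst.eventually (Metric.ball_mem_nhds (0 : ℝ) hδ'0)] with ⟨τ, w⟩ h1 h2 h3 hperp
  simp only [dist_zero_right, Real.norm_eq_abs] at h1 h2 h3 hperp ⊢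
  have h4 := h1 hperp
  have j1 : |τ| < δ / 2 := h3.trans_le (min_le_left _ _)
  have j2 : |τ| * C' ≤ ε / 2 :=
    (le_div_iff₀ hC'0).mp (h3.le.trans ((min_le_right _ _).trans (min_le_left _ _)))
  have j3 : |τ| * (C / ℓ) ≤ ε / 2 :=
    (le_div_iff₀ (by positivity)).mp (h3.le.trans ((min_le_right _ _).trans (min_le_right _ _)))
  have hτ := abs_lt.mp j1
  have hτδ : |1 + τ - 1| < δ := by rw [abs_lt]; constructor <;> linarith
  set X := (κ * N w w + ε₁ * ‖w‖ ^ 2) / (2 * ℓ) with hX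
  have hXle : |X| ≤ C' * ‖w‖ ^ 2 := by
    rw [hX, abs_div, abs_of_pos (by positivity : 0 < 2 * ℓ), hC', div_mul_eq_mul_div]
    gcongr
    calc |κ * N w w + ε₁ * ‖w‖ ^ 2| ≤ |κ * N w w| + |ε₁ * ‖w‖ ^ 2| := abs_add_le _ _
      _ ≤ |κ| * (‖N‖ * ‖w‖ * ‖w‖) + ε₁ * ‖w‖ ^ 2 := by
          rw [abs_mul, abs_of_nonneg (by positivity : 0 ≤ ε₁ * ‖w‖ ^ 2)]
          gcongr
          exact norm_apply_apply_le N w w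
      _ = _ := by ring
  have h5 := hρ ((extChartAt 𝓘(ℝ, E) p).symm (variation (chartG p) (chartΓ p) α φ (1 + τ, 1, w)))
    ((extChartAt 𝓘(ℝ, E) p).symm (variation (chartG p) (chartΓ p) α φ (s₁, 1, w)))
  rcases le_or_gt τ 0 with hτ0 | hτ0
  · have h6 := H₂ s₁ (1 + τ) 1 w (Ico_subset_Icc_self hs₁I) ⟨by linarith, by linarith⟩
      (by linarith) (hs₁δ.trans_le i2) (hτδ.trans_le i2) (h11.trans_le i2) (h2.trans_le i2)
    rw [dist_comm] at h6
    have h7 : τ * X ≤ ε / 2 * ‖w‖ ^ 2 := by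
      calc τ * X ≤ |τ| * |X| := by rw [← abs_mul]; exact le_abs_self _
        _ ≤ |τ| * (C' * ‖w‖ ^ 2) := by gcongr
        _ = (|τ| * C') * ‖w‖ ^ 2 := by ring
        _ ≤ _ := by gcongr
    have h8 : 0 ≤ ε * τ ^ 2 := by positivity
    have h9 : (1 + τ - s₁) * (ℓ + X) = (1 - s₁) * (ℓ + X) + ℓ * τ + τ * X := by ring
    rw [h9] at h6
    linarith
  -- beyond time `1` the curve need not be a geodesic, and the cruder speed bound is used
  · have h6 := H₂ s₁ 1 1 w (Ico_subset_Icc_self hs₁I) h1I hs₁I.2.le (hs₁δ.trans_le i2)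
      (h11.trans_le i2) (h11.trans_le i2) (h2.trans_le i2)
    rw [dist_comm] at h6
    set Y := C * (τ + ‖w‖) ^ 2 / (2 * ℓ) with hY
    have hY0 : 0 ≤ Y := by positivity
    have h7 := (H₄ 1 (1 + τ) 1 (ℓ + Y) w (by linarith) (h11.trans_le i4) (hτδ.trans_le i4)
      (h11.trans_le i4) (h2.trans_le i4)).2 (by positivity) (by
        intro t ht
        have ht0 : 0 ≤ t - 1 := by linarith [ht.1]
        have h8 := H₅ t (by rw [abs_of_nonneg ht0]; linarith [ht.2]) w (h2.trans_le i5)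
        rw [hspeed.self_of_nhds h1I, abs_of_nonneg ht0] at h8
        refine h8.trans ?_
        calc ℓ ^ 2 + C * (t - 1 + ‖w‖) ^ 2 ≤ ℓ ^ 2 + C * (τ + ‖w‖) ^ 2 := by
              gcongr
              linarith [ht.2]
          _ = ℓ ^ 2 + 2 * ℓ * Y := by rw [hY]; field_simp
          _ ≤ (ℓ + Y) ^ 2 := by rw [add_sq]; linarith [sq_nonneg Y])
    rw [dist_comm] at h7
    have h8 := dist_triangle
      ((extChartAt 𝓘(ℝ, E) p).symm (variation (chartG p) (chartΓ p) α φ (1 + τ, 1, w)))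
      ((extChartAt 𝓘(ℝ, E) p).symm (variation (chartG p) (chartΓ p) α φ (1, 1, w)))
      ((extChartAt 𝓘(ℝ, E) p).symm (variation (chartG p) (chartΓ p) α φ (s₁, 1, w)))
    have h9 : Y * τ ≤ ε / 2 * (τ ^ 2 + ‖w‖ ^ 2) := by
      rw [abs_of_pos hτ0] at j3
      calc Y * τ ≤ (C * (2 * (τ ^ 2 + ‖w‖ ^ 2)) / (2 * ℓ)) * τ := by
            rw [hY]
            gcongr
            nlinarith [sq_nonneg (τ - ‖w‖)]
        _ = (τ * (C / ℓ)) * (τ ^ 2 + ‖w‖ ^ 2) := by field_simp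
        _ ≤ _ := by gcongr
    have h10 : 0 ≤ ε * τ ^ 2 := by positivity
    have h11 : (ℓ + Y) * (1 + τ - 1) = ℓ * τ + Y * τ := by ring
    rw [h11] at h7
    linarith

end Propagation

/-! ### Second order expansion of the variation -/

section Family

variable {E : Type*} [NormedAddCommGroup E] [NormedSpace ℝ E] [FiniteDimensional ℝ E]
  {G : E → E →L[ℝ] E →L[ℝ] ℝ} {Γ : E → E →L[ℝ] E →L[ℝ] E} {α : ℝ → E}
  {U : Set E} {t₀ : ℝ}

/-- Varying the parameter along the geodesic corresponds, to second order, to the tangential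
direction in the exponential map. -/
lemma eventually_norm_variation_sub_quadExp_le (h : IsLeviCivitaOn G Γ U)
    (hα : ContDiffAt ℝ ∞ α t₀) (hU : α t₀ ∈ U) (hne : deriv α t₀ ≠ 0)
    (hgeo : deriv (deriv α) t₀ + Γ (α t₀) (deriv α t₀) (deriv α t₀) = 0) {ε : ℝ} (hε : 0 < ε) :
    ∀ᶠ z : ℝ × E in 𝓝 0, G (α t₀) (deriv α t₀) z.2 = 0 →
      ‖variation G Γ α (fun _ ↦ 1) (t₀ + z.1, t₀, z.2)
        - quadExp Γ (α t₀) (z.1 • deriv α t₀ + z.2)‖ ≤ ε * (z.1 ^ 2 + ‖z.2‖ ^ 2) := by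
  have hshift : Tendsto (fun z : ℝ × E ↦ t₀ + z.1) (𝓝 0) (𝓝 t₀) := by
    have : Continuous fun z : ℝ × E ↦ t₀ + z.1 := by fun_prop
    simpa using this.tendsto 0
  have hpair : ContDiffAt ℝ ∞ (fun t : ℝ ↦ (t, t₀)) t₀ := by fun_prop
  have hV : ContDiffAt ℝ ∞ (fun t ↦ normalTransport G Γ α t t₀) t₀ :=
    ContDiffAt.comp (f := fun t : ℝ ↦ (t, t₀)) t₀
      (g := fun z : ℝ × ℝ ↦ normalTransport G Γ α z.1 z.2)
      (contDiffAt_normalTransport h hα hU hne) hpair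
  -- the Taylor expansion of the geodesic
  have e1 : ∀ᶠ z : ℝ × E in 𝓝 0, ‖α (t₀ + z.1) - α t₀ - z.1 • deriv α t₀
      - (2⁻¹ : ℝ) • z.1 ^ 2 • deriv (deriv α) t₀‖ ≤ ε / 4 * z.1 ^ 2 := by
    obtain ⟨δ, hδ, H⟩ := exists_taylor_two (hα.of_le two_le_infty) (ε := ε / 4) (by positivity)
    have hfst : Tendsto (fun z : ℝ × E ↦ z.1) (𝓝 0) (𝓝 0) := continuous_fst.tendsto (0 : ℝ × E)
    filter_upwards [hfst.eventually (Metric.ball_mem_nhds (0 : ℝ) hδ)] with z hz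
    have h1 := H t₀ z.1 (by simpa using hδ) (by simpa using hz)
    have h2 : fderiv ℝ (fderiv ℝ α) t₀ z.1 z.1 = z.1 ^ 2 • deriv (deriv α) t₀ := by
      have h3 : HasFDerivAt (fderiv ℝ α) (fderiv ℝ (fderiv ℝ α) t₀) t₀ :=
        ((hα.fderiv_right (m := ∞) (by simp)).differentiableAt (by simp)).hasFDerivAt
      have h4 : HasDerivAt (deriv α) (fderiv ℝ (fderiv ℝ α) t₀ 1 1) t₀ := by
        simpa using h3.hasDerivAt.clm_apply (hasDerivAt_const t₀ (1 : ℝ))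
      rw [h4.deriv]
      have h5 : fderiv ℝ (fderiv ℝ α) t₀ (z.1 • (1 : ℝ)) (z.1 • (1 : ℝ))
          = z.1 ^ 2 • fderiv ℝ (fderiv ℝ α) t₀ 1 1 := by
        simp only [map_smul, _root_.smul_apply, smul_smul, pow_two]
      simpa only [smul_eq_mul, mul_one] using h5
    have h6 : fderiv ℝ α t₀ z.1 = z.1 • deriv α t₀ := by
      simp
    rw [h2, h6, Real.norm_eq_abs, sq_abs] at h1
    exact h1
  -- the normal field is parallel to first order
  have e2 : ∀ᶠ z : ℝ × E in 𝓝 0, G (α t₀) (deriv α t₀) z.2 = 0 →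
      ‖normalTransport G Γ α (t₀ + z.1) t₀ z.2 - z.2 + z.1 • Γ (α t₀) (deriv α t₀) z.2‖
        ≤ ε / 4 * (|z.1| * ‖z.2‖) := by
    have h1 := (hV.differentiableAt (by simp)).hasDerivAt
    set V' := deriv (fun t ↦ normalTransport G Γ α t t₀) t₀ with hV'
    have h2 := h1.hasFDerivAt.isLittleO.def (c := ε / 4) (by positivity)
    filter_upwards [hshift.eventually h2] with z hz hperp
    have h3 : V' z.2 = - Γ (α t₀) (deriv α t₀) z.2 := by
      have h4 : HasDerivAt (fun t ↦ normalTransport G Γ α t t₀ z.2) (V' z.2) t₀ := by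
        simpa using h1.clm_apply (hasDerivAt_const t₀ z.2)
      have h5 := h4.unique (hasDerivAt_normalTransport h hα hU hne hgeo z.2)
      rwa [normalTransport_self hperp] at h5
    simp only [add_sub_cancel_left, Real.norm_eq_abs] at hz
    have h6 := ContinuousLinearMap.le_opNorm (normalTransport G Γ α (t₀ + z.1) t₀
      - normalTransport G Γ α t₀ t₀ - z.1 • V') z.2
    have h7 : (normalTransport G Γ α (t₀ + z.1) t₀ - normalTransport G Γ α t₀ t₀ - z.1 • V') z.2
        = normalTransport G Γ α (t₀ + z.1) t₀ z.2 - z.2 + z.1 • Γ (α t₀) (deriv α t₀) z.2 := by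
      simp only [_root_.sub_apply, _root_.smul_apply, h3, normalTransport_self hperp, smul_neg,
        sub_neg_eq_add]
    rw [h7] at h6
    calc _ ≤ _ := h6
      _ ≤ ε / 4 * |z.1| * ‖z.2‖ := by
        gcongr
        simpa using hz
      _ = _ := by ring
  -- the quadratic term varies continuously
  have e3 : ∀ᶠ z : ℝ × E in 𝓝 0, G (α t₀) (deriv α t₀) z.2 = 0 →
      ‖Γ (α (t₀ + z.1)) (normalTransport G Γ α (t₀ + z.1) t₀ z.2)
        (normalTransport G Γ α (t₀ + z.1) t₀ z.2) - Γ (α t₀) z.2 z.2‖ ≤ ε / 4 * ‖z.2‖ ^ 2 := by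
    have g1 : ContDiffAt ℝ ∞ (fun t ↦ Γ (α t)) t₀ := (h.contDiffAt_gamma hU).comp t₀ hα
    have hc := ((ContinuousLinearMap.flipₗᵢ ℝ E E E).contDiff.contDiffAt.comp t₀
      (((ContinuousLinearMap.flipₗᵢ ℝ E E E).contDiff.contDiffAt.comp t₀
      (g1.clm_comp hV)).clm_comp hV)).continuousAt
    filter_upwards [hshift.eventually (Metric.continuousAt_iff'.mp hc (ε / 4) (by positivity))]
      with z hz hperp
    rw [dist_eq_norm] at hz
    have h1 := norm_apply_apply_le (F := E) (_ - _) z.2 z.2 |>.trans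
      (mul_le_mul_of_nonneg_right (mul_le_mul_of_nonneg_right hz.le (norm_nonneg z.2))
        (norm_nonneg z.2))
    have h2 : Γ (α t₀) z.2 z.2 = Γ (α t₀) (normalTransport G Γ α t₀ t₀ z.2)
        (normalTransport G Γ α t₀ t₀ z.2) := by rw [normalTransport_self hperp]
    rw [h2]
    calc _ ≤ _ := h1
      _ = _ := by ring
  filter_upwards [e1, e2, e3] with z h1 h2 h3 hperp
  have h2 := h2 hperp
  have h3 := h3 hperp
  set W := normalTransport G Γ α (t₀ + z.1) t₀ z.2 with hW
  have h4 : deriv (deriv α) t₀ = -Γ (α t₀) (deriv α t₀) (deriv α t₀) :=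
    eq_neg_of_add_eq_zero_left hgeo
  have h5 : variation G Γ α (fun _ ↦ 1) (t₀ + z.1, t₀, z.2)
      - quadExp Γ (α t₀) (z.1 • deriv α t₀ + z.2)
      = (α (t₀ + z.1) - α t₀ - z.1 • deriv α t₀ - (2⁻¹ : ℝ) • z.1 ^ 2 • deriv (deriv α) t₀)
        + (W - z.2 + z.1 • Γ (α t₀) (deriv α t₀) z.2)
        - (2⁻¹ : ℝ) • (Γ (α (t₀ + z.1)) W W - Γ (α t₀) z.2 z.2) := by
    simp only [variation, quadExp, one_smul, ← hW, h4, map_add, map_smul, _root_.add_apply,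
      _root_.smul_apply, h.gamma_symm _ hU z.2 (deriv α t₀)]
    module
  rw [h5]
  have h6 : ‖(2⁻¹ : ℝ) • (Γ (α (t₀ + z.1)) W W - Γ (α t₀) z.2 z.2)‖ ≤ ε / 4 * ‖z.2‖ ^ 2 := by
    rw [norm_smul]
    have : ‖(2⁻¹ : ℝ)‖ ≤ 1 := by norm_num
    calc _ ≤ 1 * _ := mul_le_mul_of_nonneg_right this (norm_nonneg _)
      _ ≤ _ := by rw [one_mul]; exact h3
  have h7 : |z.1| * ‖z.2‖ ≤ z.1 ^ 2 + ‖z.2‖ ^ 2 := by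
    rw [← sq_abs z.1]
    nlinarith [sq_nonneg (|z.1| - ‖z.2‖), sq_nonneg (|z.1|), sq_nonneg ‖z.2‖]
  refine ((norm_sub_le _ _).trans (add_le_add (norm_add_le _ _) le_rfl)).trans ?_
  have h8 : ε / 4 * (|z.1| * ‖z.2‖) ≤ ε / 4 * (z.1 ^ 2 + ‖z.2‖ ^ 2) := by gcongr
  have h9 : 0 ≤ ε * z.1 ^ 2 := by positivity
  have h10 : 0 ≤ ε * ‖z.2‖ ^ 2 := by positivity
  linarith

lemma norm_quadExp_sub_quadExp_le {y z d : E} :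
    ‖quadExp Γ y z - quadExp Γ y d - (z - d)‖ ≤ ‖Γ y‖ * ‖z - d‖ * (‖z‖ + ‖d‖) := by
  have h1 : quadExp Γ y z - quadExp Γ y d - (z - d)
      = -((2⁻¹ : ℝ) • (Γ y (z - d) z + Γ y d (z - d))) := by
    simp only [quadExp, map_sub, _root_.sub_apply]
    module
  rw [h1, norm_neg, norm_smul]
  have : ‖(2⁻¹ : ℝ)‖ ≤ 1 := by norm_num
  calc _ ≤ 1 * _ := mul_le_mul_of_nonneg_right this (norm_nonneg _)
    _ ≤ ‖Γ y‖ * ‖z - d‖ * ‖z‖ + ‖Γ y‖ * ‖d‖ * ‖z - d‖ := by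
      rw [one_mul]
      exact (norm_add_le _ _).trans (add_le_add (norm_apply_apply_le _ _ _)
        (norm_apply_apply_le _ _ _))
    _ = _ := by ring

/-- `quadLog` is a right inverse of `quadExp` up to an error of order greater than two. -/
lemma eventually_norm_quadExp_quadLog_sub_le (Γ : E → E →L[ℝ] E →L[ℝ] E) (y : E) {ε : ℝ}
    (hε : 0 < ε) :
    ∀ᶠ y' in 𝓝 y, ‖quadExp Γ y (quadLog Γ y y') - y'‖ ≤ ε * ‖y' - y‖ ^ 2 ∧
      ‖y' - y‖ ^ 2 ≤ 4 * ‖quadLog Γ y y'‖ ^ 2 := by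
  have hlim : Tendsto (fun y' ↦ (‖Γ y‖ + 3 * ‖Γ y‖ ^ 2) * ‖y' - y‖) (𝓝 y) (𝓝 0) := by
    have : Continuous fun y' ↦ (‖Γ y‖ + 3 * ‖Γ y‖ ^ 2) * ‖y' - y‖ := by fun_prop
    simpa using this.tendsto y
  filter_upwards [hlim.eventually (gt_mem_nhds hε), hlim.eventually (gt_mem_nhds one_pos)]
    with y' h1 h1'
  set d := y' - y with hd
  set z := quadLog Γ y y' with hz
  have hzd : z - d = (2⁻¹ : ℝ) • Γ y d d := by simp [hz, quadLog, hd]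
  have h2 : ‖z - d‖ ≤ 2⁻¹ * (‖Γ y‖ * ‖d‖ * ‖d‖) := by
    rw [hzd, norm_smul]
    have : ‖(2⁻¹ : ℝ)‖ = 2⁻¹ := by norm_num
    rw [this]
    gcongr
    exact norm_apply_apply_le _ _ _
  have hΓ0 : 0 ≤ ‖Γ y‖ := norm_nonneg _
  have hd0 : 0 ≤ ‖d‖ := norm_nonneg _
  have h3 : ‖Γ y‖ * ‖d‖ ≤ 1 := by nlinarith [mul_nonneg (sq_nonneg ‖Γ y‖) hd0]
  have h4 : ‖z - d‖ ≤ 2⁻¹ * ‖d‖ := by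
    refine h2.trans ?_
    gcongr
    calc ‖Γ y‖ * ‖d‖ * ‖d‖ ≤ 1 * ‖d‖ := by gcongr
      _ = _ := one_mul _
  have h5 : ‖z‖ ≤ 2 * ‖d‖ := by
    have := norm_add_le (z - d) d
    rw [sub_add_cancel] at this
    linarith
  have h6 : ‖d‖ ≤ 2 * ‖z‖ := by
    have := norm_sub_le z (z - d)
    rw [sub_sub_cancel] at this
    linarith
  refine ⟨?_, by nlinarith⟩
  have h7 := norm_quadExp_sub_quadExp_le (Γ := Γ) (y := y) (z := z) (d := d)
  have h8 : quadExp Γ y z - quadExp Γ y d - (z - d) = quadExp Γ y z - y' := by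
    rw [hzd]
    simp only [quadExp, hd]
    module
  rw [h8] at h7
  calc _ ≤ _ := h7
    _ ≤ ‖Γ y‖ * (2⁻¹ * (‖Γ y‖ * ‖d‖ * ‖d‖)) * (2 * ‖d‖ + ‖d‖) := by gcongr
    _ = (3 / 2 * ‖Γ y‖ ^ 2 * ‖d‖) * ‖d‖ ^ 2 := by ring
    _ ≤ ε * ‖d‖ ^ 2 := by
      gcongr
      nlinarith [mul_nonneg (sq_nonneg ‖Γ y‖) hd0, mul_nonneg hΓ0 hd0]

end Family

/-! ### The distance near the end of a normal ray -/

lemma exists_ne_zero_apply_eq_zero {E : Type*} [NormedAddCommGroup E] [NormedSpace ℝ E]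
    [FiniteDimensional ℝ E] (hdim : 2 ≤ Module.finrank ℝ E) (L : E →L[ℝ] ℝ) :
    ∃ w, w ≠ 0 ∧ L w = 0 := by
  have h1 : LinearMap.ker (L : E →ₗ[ℝ] ℝ) ≠ ⊥ :=
    LinearMap.ker_ne_bot_of_finrank_lt (by rw [Module.finrank_self]; omega)
  obtain ⟨w, hw, hw0⟩ := Submodule.exists_mem_ne_zero_of_ne_bot h1
  exact ⟨w, hw0, hw⟩

section Distance

variable {E : Type*} [NormedAddCommGroup E] [NormedSpace ℝ E] [FiniteDimensional ℝ E]
  {M : Type*} [MetricSpace M] [ChartedSpace E M] [IsManifold 𝓘(ℝ, E) ∞ M]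
  [RiemannianBundle (fun x : M ↦ TangentSpace 𝓘(ℝ, E) x)]
  [IsContMDiffRiemannianBundle 𝓘(ℝ, E) ∞ E (fun x : M ↦ TangentSpace 𝓘(ℝ, E) x)]
  [IsRiemannianManifold 𝓘(ℝ, E) M]

variable (E) in
/-- A geodesic of speed `ℓ` on `[0, 1]` starting at the boundary of `D`, along which the distance to
the complement of `D` is at least the arc length. -/
structure IsNormalRay (D : Set M) (ℓ : ℝ) (γ : ℝ → M) : Prop where
  isGeodesicOn : IsGeodesicOn E γ (Icc 0 1)
  pos : 0 < ℓ
  speed : ∀ t ∈ Icc (0 : ℝ) 1, ‖mfderiv 𝓘(ℝ, ℝ) 𝓘(ℝ, E) γ t (1 : ℝ)‖ = ℓ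
  zero_mem : γ 0 ∈ frontier D
  le_dist : ∀ s ∈ Icc (0 : ℝ) 1, ∀ z ∈ Dᶜ, ℓ * s ≤ dist (γ s) z

lemma compl_nonempty_of_frontier {X : Type*} [TopologicalSpace X] {D : Set X}
    (hne : (frontier D).Nonempty) : Dᶜ.Nonempty := by
  rw [nonempty_compl]
  rintro rfl
  simp at hne

lemma infDist_frontier_pos {X : Type*} [MetricSpace X] {D : Set X} {x : X} (hx : x ∈ interior D)
    (hne : (frontier D).Nonempty) : 0 < Metric.infDist x (frontier D) :=
  (isClosed_frontier.notMem_iff_infDist_pos hne).mp fun h ↦ h.2 hx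

lemma GeodConvex.exists_isNormalRay [CompleteSpace M] {D : Set M} (hD : IsClosed D)
    (hconv : GeodConvex E D) {x : M} (hx : x ∈ interior D) (hne : (frontier D).Nonempty) :
    ∃ γ : ℝ → M, IsNormalRay E D (Metric.infDist x (frontier D)) γ ∧ γ 1 = x := by
  have hxD := interior_subset hx
  obtain ⟨q, hq, hqx⟩ := hconv.exists_infDist_frontier_eq_dist hD hxD hne
  obtain ⟨γ, hγ, -⟩ := hconv q (hD.frontier_subset hq) x hxD
  rw [dist_comm] at hqx
  refine ⟨γ, ⟨hγ.1, infDist_frontier_pos hx hne, fun t ht ↦ ?_, ?_, fun s hs z hz ↦ ?_⟩, hγ.2.2.1⟩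
  · rw [hγ.speed_eq ht, hqx]
  · rw [hγ.2.1]; exact hq
  · have h1 := hγ.dist_le hs.1 hs.2 le_rfl
    rw [hγ.2.2.1, ← hqx] at h1
    have h2 : Metric.infDist x (frontier D) ≤ dist x z :=
      (infDist_frontier_le E hxD ⟨z, hz⟩).trans (Metric.infDist_le_dist_of_mem hz)
    have h3 := dist_triangle x (γ s) z
    rw [dist_comm x (γ s)] at h3
    linarith

lemma infDist_le_infDist_add_dist' {X : Type*} [MetricSpace X] (s : Set X) (x y : X) :
    Metric.infDist x s ≤ Metric.infDist y s + dist x y :=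
  Metric.infDist_le_infDist_add_dist

/-- The initial bound: convexity of `D` at the foot of a normal ray. -/
lemma IsNormalRay.curveBound_zero {D : Set M} (hD : IsClosed D) (hconv : GeodConvex E D)
    {ℓ : ℝ} {γ : ℝ → M} (hγ : IsNormalRay E D ℓ γ) {φ c : ℝ → ℝ} (hc : c 0 = 0) :
    CurveBound (E := E) (fun y ↦ Metric.infDist y Dᶜ) γ φ c ℓ (γ 0) 0 := by
  have h0 : (0 : ℝ) ∈ Icc (0 : ℝ) 1 := by simp
  have hs : γ 0 ∈ (extChartAt 𝓘(ℝ, E) (γ 0)).source := mem_extChartAt_source (γ 0)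
  obtain ⟨hγ0, -⟩ := hγ.isGeodesicOn 0 h0
  have hα := contDiffAt_chart_comp (E := E) (n := ⊤) hγ0 hs
  have hsp := speed_sq_eq (E := E) (hγ0.of_le (by simp)) hs
  rw [hγ.speed 0 h0] at hsp
  have hLC := isLeviCivitaOn_chart (E := E) (γ 0)
  intro ε hε
  have h1 := hconv.infDist_quadExp_le hD hγ.zero_mem rfl hγ0.continuousAt
    (hα.differentiableAt (by simp)).hasDerivAt hsp.symm hγ.pos hγ.le_dist
    (ε := ε / (φ 0 ^ 2 + 1)) (by positivity)
  have hk0 : Tendsto (fun w : E ↦ φ 0 • w) (𝓝 0) (𝓝 0) := by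
    simpa using (continuous_const_smul (φ 0)).tendsto (0 : E)
  filter_upwards [hk0.eventually h1] with w hw hperp
  have h2 := hw (by
    rw [map_smul, _root_.smul_apply, hLC.symm _ (mem_extChartAt_target _), hperp, smul_zero])
  refine h2.trans ?_
  rw [hc, mul_zero, zero_mul, zero_add, zero_add, norm_smul, mul_pow, Real.norm_eq_abs, sq_abs]
  calc ε / (φ 0 ^ 2 + 1) * (φ 0 ^ 2 * ‖w‖ ^ 2)
      = (ε * ‖w‖ ^ 2) * (φ 0 ^ 2 / (φ 0 ^ 2 + 1)) := by ring
    _ ≤ (ε * ‖w‖ ^ 2) * 1 := by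
        gcongr
        rw [div_le_one (by positivity)]
        linarith
    _ = _ := mul_one _

/-- The Bonnet-Myers argument: a normal ray has length at most `π / 2`. If it were longer, the
variation by fields of size `cos (π t / 2)`, which vanish at the endpoint, would give shorter curves
to the complement of `D`. -/
lemma IsNormalRay.le_pi_div_two (hdim : 2 ≤ Module.finrank ℝ E) (hsec : SecGE E M 1) {D : Set M}
    (hD : IsClosed D) (hconv : GeodConvex E D) {ℓ : ℝ} {γ : ℝ → M} (hγ : IsNormalRay E D ℓ γ)
    (hle : ℓ ≤ Metric.infDist (γ 1) Dᶜ) :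
    ℓ ≤ Real.pi / 2 := by
  by_contra hlt
  push Not at hlt
  have hℓ := hγ.pos
  have hπ := Real.pi_pos
  set A := Real.pi ^ 2 / 8 - ℓ ^ 2 / 2 with hA
  set B := Real.pi ^ 2 / 8 + ℓ ^ 2 / 2 with hB
  have hA0 : A < 0 := by nlinarith
  set θ := -A / (4 * ℓ) with hθ
  have hθ0 : 0 < θ := div_pos (by linarith) (by positivity)
  set φ : ℝ → ℝ := fun t ↦ Real.cos (Real.pi / 2 * t) with hφdef
  have hφ : ContDiff ℝ ∞ φ := Real.contDiff_cos.comp (contDiff_const.mul contDiff_id)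
  have hφ' : ∀ t, deriv φ t = -Real.sin (Real.pi / 2 * t) * (Real.pi / 2) := fun t ↦ by
    have h1 : HasDerivAt (fun t ↦ Real.pi / 2 * t) (Real.pi / 2) t := by
      simpa using (hasDerivAt_id t).const_mul (Real.pi / 2)
    exact h1.cos.deriv
  -- a primitive of `(φ'² - φ² ℓ²) / (2 ℓ)`, plus the margin `θ t`
  set c : ℝ → ℝ := fun t ↦ θ * t + (A * t - B * (Real.sin (Real.pi * t) / Real.pi)) / (2 * ℓ)
    with hcdef
  have hc : ∀ t, HasStrictDerivAt c (θ + (A - B * Real.cos (Real.pi * t)) / (2 * ℓ)) t := by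
    intro t
    have h1 : HasStrictDerivAt (fun t ↦ Real.pi * t) Real.pi t := by
      simpa using (hasStrictDerivAt_id t).const_mul Real.pi
    have h2 := ((hasStrictDerivAt_id t).const_mul θ).add
      ((((hasStrictDerivAt_id t).const_mul A).sub
        ((h1.sin.div_const Real.pi).const_mul B)).div_const (2 * ℓ))
    refine h2.congr_deriv ?_
    field_simp
  have hc' : ∀ t, (deriv φ t ^ 2 - φ t ^ 2 * ℓ ^ 2) / (2 * ℓ)
      < θ + (A - B * Real.cos (Real.pi * t)) / (2 * ℓ) := by
    intro t
    have h1 : Real.cos (Real.pi * t) = 2 * φ t ^ 2 - 1 := by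
      rw [hφdef, ← Real.cos_two_mul]
      congr 1
      ring
    have h2 : deriv φ t ^ 2 = (1 - φ t ^ 2) * (Real.pi / 2) ^ 2 := by
      rw [hφ', mul_pow, neg_sq, Real.sin_sq]
    have h3 : deriv φ t ^ 2 - φ t ^ 2 * ℓ ^ 2 = A - B * Real.cos (Real.pi * t) := by
      rw [h1, h2, hA, hB]; ring
    rw [h3]
    linarith
  have hb := CurveBound.of_zero (infDist_le_infDist_add_dist' Dᶜ) hsec hγ.isGeodesicOn hℓ hγ.speed
    hφ (fun t _ ↦ hc t) (fun t _ ↦ hc' t)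
    (hγ.curveBound_zero hD hconv (φ := φ) (c := c) (by simp [hcdef])) 1 (by simp)
  set p := γ 1 with hp
  have hyt : extChartAt 𝓘(ℝ, E) p p ∈ (extChartAt 𝓘(ℝ, E) p).target := mem_extChartAt_target p
  have hLC := isLeviCivitaOn_chart (E := E) p
  obtain ⟨w₀, hw₀, hperp⟩ := exists_ne_zero_apply_eq_zero hdim
    (chartG p (extChartAt 𝓘(ℝ, E) p p) (deriv (extChartAt 𝓘(ℝ, E) p ∘ γ) 1))
  obtain ⟨C, hC, hC'⟩ := exists_norm_sq_le_of_pos _ (hLC.pos _ hyt)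
  have hφ1 : φ 1 = 0 := by simp [hφdef]
  have hc1 : c 1 = -θ := by
    simp only [hcdef, mul_one, Real.sin_pi, zero_div, mul_zero, sub_zero, hθ]
    field_simp
    ring
  -- the variation fixes the endpoint, where the bound falls below `ℓ`
  have h1 := hb (θ / (2 * C)) (by positivity)
  have h2 : Tendsto (fun e : ℝ ↦ e • w₀) (𝓝[≠] 0) (𝓝 0) := by
    have : Continuous fun e : ℝ ↦ e • w₀ := by fun_prop
    have := (this.tendsto 0).mono_left (nhdsWithin_le_nhds (s := {0}ᶜ))
    simpa using this
  obtain ⟨e, he, hne⟩ := ((h2.eventually h1).and self_mem_nhdsWithin).exists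
  have hw : e • w₀ ≠ 0 := smul_ne_zero hne hw₀
  have h3 := he (by rw [map_smul, hperp, smul_zero])
  have h4 : (extChartAt 𝓘(ℝ, E) p).symm (quadExp (chartΓ p) (extChartAt 𝓘(ℝ, E) p p)
      (φ 1 • e • w₀)) = p := by
    simp only [hφ1, quadExp, zero_smul, add_zero, map_zero, smul_zero, sub_zero]
    exact (extChartAt 𝓘(ℝ, E) p).left_inv (mem_extChartAt_source p)
  rw [← hp, h4, hc1, mul_one] at h3
  have h5 := hLC.pos _ hyt _ hw
  have h6 : θ / (2 * C) * ‖e • w₀‖ ^ 2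
      ≤ θ / 2 * chartG p (extChartAt 𝓘(ℝ, E) p p) (e • w₀) (e • w₀) := by
    calc _ ≤ θ / (2 * C) * (C * chartG p (extChartAt 𝓘(ℝ, E) p p) (e • w₀) (e • w₀)) := by
          gcongr
          exact hC' _
      _ = _ := by field_simp
  have h7 := mul_pos hθ0 h5
  linarith

/-- The second order upper bound for the distance to the complement of `D` at the endpoint of a
normal ray of length `ℓ`: in the direction of the ray the distance grows linearly, and orthogonally
to it the second derivative is at most `-ℓ`, as follows from the variation by fields of constant
size. -/
lemma IsNormalRay.eventually_infDist_le (hsec : SecGE E M 1) {D : Set M}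
    (hD : IsClosed D) (hconv : GeodConvex E D) {ℓ : ℝ} {γ : ℝ → M} (hγ : IsNormalRay E D ℓ γ)
    {p : M} (hp : p = γ 1) {y₀ v : E} (hy₀ : y₀ = extChartAt 𝓘(ℝ, E) p p)
    (hv : v = deriv (extChartAt 𝓘(ℝ, E) p ∘ γ) 1) {θ : ℝ} (hθ : 0 < θ) :
    ∀ᶠ y in 𝓝 y₀, Metric.infDist ((extChartAt 𝓘(ℝ, E) p).symm y) Dᶜ ≤
      ℓ + chartG p y₀ v (quadLog (chartΓ p) y₀ y) / ℓ
        + (θ - ℓ / 2) * (chartG p y₀ (quadLog (chartΓ p) y₀ y) (quadLog (chartΓ p) y₀ y)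
          - (chartG p y₀ v (quadLog (chartΓ p) y₀ y) / ℓ) ^ 2)
        + θ * chartG p y₀ (quadLog (chartΓ p) y₀ y) (quadLog (chartΓ p) y₀ y) := by
  have hℓ := hγ.pos
  set φ : ℝ → ℝ := fun _ ↦ 1 with hφdef
  have hφ : ContDiff ℝ ∞ φ := contDiff_const
  set c : ℝ → ℝ := fun t ↦ (θ - ℓ / 2) * t with hcdef
  have hc : ∀ t, HasStrictDerivAt c (θ - ℓ / 2) t := fun t ↦ by
    simpa using (hasStrictDerivAt_id t).const_mul (θ - ℓ / 2)
  have hc' : ∀ t, (deriv φ t ^ 2 - φ t ^ 2 * ℓ ^ 2) / (2 * ℓ) < θ - ℓ / 2 := fun t ↦ by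
    have h1 : (deriv φ t ^ 2 - φ t ^ 2 * ℓ ^ 2) / (2 * ℓ) = -(ℓ / 2) := by
      simp only [hφdef, deriv_const]
      field_simp
      ring
    rw [h1]
    linarith
  have hρ := infDist_le_infDist_add_dist' (X := M) Dᶜ
  have hb := CurveBound.of_zero hρ hsec hγ.isGeodesicOn hℓ hγ.speed
    hφ (fun t _ ↦ hc t) (fun t _ ↦ hc' t)
    (hγ.curveBound_zero hD hconv (φ := φ) (c := c) (by simp [hcdef]))
  have h1I : (1 : ℝ) ∈ Icc (0 : ℝ) 1 := by simp
  subst hp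
  set p := γ 1 with hp
  obtain ⟨hα, hU, hne, -, hgeo, hspeed, -⟩ :=
    hγ.isGeodesicOn.chart_facts hsec hℓ hγ.speed h1I rfl
  rw [← hp] at hα hU hne hgeo hspeed
  set α := extChartAt 𝓘(ℝ, E) p ∘ γ with hαdef
  have hαy : α 1 = y₀ := hy₀.symm
  have hLC := isLeviCivitaOn_chart (E := E) p
  have hGv := hspeed.self_of_nhds h1I
  have hgeo1 := hgeo.self_of_nhds h1I
  rw [← hv, hαy] at hGv
  have hyt : y₀ ∈ (extChartAt 𝓘(ℝ, E) p).target := hαy ▸ hU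
  obtain ⟨C, hC, hC'⟩ := exists_norm_sq_le_of_pos _ (hLC.pos _ hyt)
  obtain ⟨C₁, hC₁, r, hr, hlip⟩ := exists_dist_symm_le (E := E) p hyt
  set G₀ := chartG p y₀ with hG₀
  set N := quadLog (chartΓ p) y₀ with hN
  -- decomposition of a vector into its components along `v` and orthogonal to `v`
  set τ : E → ℝ := fun y ↦ G₀ v (N y) / ℓ ^ 2 with hτ
  set w : E → E := fun y ↦ N y - τ y • v with hw
  have hNc : Continuous N := continuous_quadLog _ _
  have hzc : Continuous fun y ↦ ((τ y, w y) : ℝ × E) := by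
    have h1 : Continuous τ := ((G₀ v).continuous.comp hNc).div_const _
    exact h1.prodMk (hNc.sub (h1.smul continuous_const))
  have hz0 : Tendsto (fun y ↦ ((τ y, w y) : ℝ × E)) (𝓝 y₀) (𝓝 0) := by
    have h1 := hzc.tendsto y₀
    have h2 : ((τ y₀, w y₀) : ℝ × E) = 0 := by simp [hτ, hw, hN, quadLog_self]
    rwa [h2] at h1
  have hperp : ∀ y, G₀ v (w y) = 0 := fun y ↦ by
    simp only [hw, map_sub, map_smul, smul_eq_mul, hGv, hτ]
    field_simp
    simp
  set K := (‖G₀ v‖ / ℓ ^ 2) ^ 2 + (1 + ‖G₀ v‖ / ℓ ^ 2 * ‖v‖) ^ 2 with hK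
  have hKle : ∀ y, (τ y) ^ 2 + ‖w y‖ ^ 2 ≤ K * ‖N y‖ ^ 2 := fun y ↦ by
    have h1 : |τ y| ≤ ‖G₀ v‖ / ℓ ^ 2 * ‖N y‖ := by
      rw [hτ, abs_div, abs_of_pos (by positivity : 0 < ℓ ^ 2), div_mul_eq_mul_div]
      gcongr
      exact (G₀ v).le_opNorm _
    have h2 : ‖w y‖ ≤ (1 + ‖G₀ v‖ / ℓ ^ 2 * ‖v‖) * ‖N y‖ := by
      calc ‖w y‖ ≤ ‖N y‖ + ‖τ y • v‖ := norm_sub_le _ _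
        _ = ‖N y‖ + |τ y| * ‖v‖ := by rw [norm_smul, Real.norm_eq_abs]
        _ ≤ ‖N y‖ + ‖G₀ v‖ / ℓ ^ 2 * ‖N y‖ * ‖v‖ := by gcongr
        _ = _ := by ring
    rw [← sq_abs (τ y), hK, add_mul, ← mul_pow, ← mul_pow]
    gcongr
  have hK0 : 0 ≤ K := by positivity
  set ε := θ / (C * (K + C₁ * (K + 4) + 1)) with hε
  have hε0 : 0 < ε := by positivity
  have e1 := hz0.eventually (CurveBound.eventually_le hρ hsec hγ.isGeodesicOn hℓ hγ.speed hφ (hc 1)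
    (hc' 1) (fun t ht ↦ hb t (Ico_subset_Icc_self ht)) hp hαdef hε0)
  have e2 := hz0.eventually (eventually_norm_variation_sub_quadExp_le hLC hα hU hne hgeo1 hε0)
  have e3 := eventually_norm_quadExp_quadLog_sub_le (chartΓ p) y₀ hε0
  have e4 : ∀ᶠ y in 𝓝 y₀, variation (chartG p) (chartΓ p) α φ (1 + τ y, 1, w y)
      ∈ Metric.ball y₀ r := by
    have h1 : Tendsto (fun y ↦ ((1 + τ y, 1, w y) : ℝ × ℝ × E)) (𝓝 y₀) (𝓝 (1, 1, 0)) := by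
      have h2 : Continuous fun z : ℝ × E ↦ ((1 + z.1, 1, z.2) : ℝ × ℝ × E) := by fun_prop
      have h3 := (h2.tendsto 0).comp hz0
      simpa [Function.comp_def] using h3
    have h4 := (contDiffAt_variation hLC hα hU hne hφ).continuousAt.tendsto.comp h1
    have h5 : variation (chartG p) (chartΓ p) α φ (1, 1, 0) = y₀ := by
      simp [variation, quadExp, hαy]
    rw [h5] at h4
    exact h4.eventually (Metric.ball_mem_nhds _ hr)
  filter_upwards [e1, e2, e3, e4, Metric.ball_mem_nhds y₀ hr] with y h1 h2 h3 h4 h5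
  rw [hαy, ← hv] at h1 h2
  have h1 := h1 (hperp y)
  have h2 := h2 (hperp y)
  have hzN : τ y • v + w y = N y := by simp [hw]
  rw [hzN] at h2
  obtain ⟨h3, h3'⟩ := h3
  set Y := variation (chartG p) (chartΓ p) α φ (1 + τ y, 1, w y) with hY
  have h6 := hρ ((extChartAt 𝓘(ℝ, E) p).symm y) ((extChartAt 𝓘(ℝ, E) p).symm Y)
  have h7 := hlip y h5 Y h4
  have h8 : ‖Y - y‖ ≤ ε * (K * ‖N y‖ ^ 2) + ε * (4 * ‖N y‖ ^ 2) := by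
    calc ‖Y - y‖ = ‖(Y - quadExp (chartΓ p) y₀ (N y)) + (quadExp (chartΓ p) y₀ (N y) - y)‖ := by
          congr 1; abel
      _ ≤ _ := norm_add_le _ _
      _ ≤ ε * (τ y ^ 2 + ‖w y‖ ^ 2) + ε * ‖y - y₀‖ ^ 2 := add_le_add h2 h3
      _ ≤ _ := by
        gcongr
        exact hKle y
  have h9 : C₁ * ‖Y - y‖ ≤ C₁ * (ε * (K * ‖N y‖ ^ 2) + ε * (4 * ‖N y‖ ^ 2)) := by gcongr
  have h10 : ε * (τ y ^ 2 + ‖w y‖ ^ 2) ≤ ε * (K * ‖N y‖ ^ 2) := by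
    gcongr
    exact hKle y
  have h11 : ε * (K * ‖N y‖ ^ 2) + C₁ * (ε * (K * ‖N y‖ ^ 2) + ε * (4 * ‖N y‖ ^ 2))
      ≤ θ * G₀ (N y) (N y) := by
    calc _ = (ε * (K + C₁ * (K + 4))) * ‖N y‖ ^ 2 := by ring
      _ ≤ (ε * (K + C₁ * (K + 4) + 1)) * (C * G₀ (N y) (N y)) :=
        mul_le_mul (mul_le_mul_of_nonneg_left (by linarith) hε0.le) (hC' _) (by positivity)
          (by positivity)
      _ = _ := by rw [hε]; field_simp
  have h12 : G₀ (w y) (w y) = G₀ (N y) (N y) - (G₀ v (N y) / ℓ) ^ 2 := by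
    have h13 : G₀ (w y) (w y) = G₀ (N y) (N y) - τ y * G₀ v (N y) := by
      have h14 : G₀ (w y) v = 0 := by rw [hLC.symm _ hyt]; exact hperp y
      calc G₀ (w y) (w y) = G₀ (w y) (N y) := by
            nth_rewrite 2 [hw]
            simp only [map_sub, map_smul, h14, smul_zero, sub_zero]
        _ = _ := by
            simp only [hw, map_sub, map_smul, _root_.sub_apply, _root_.smul_apply, smul_eq_mul]
    rw [h13, hτ]
    field_simp
  have h15 : ℓ * τ y = G₀ v (N y) / ℓ := by
    rw [hτ]; field_simp
  have h16 : c 1 = θ - ℓ / 2 := by simp [hcdef]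
  rw [h12, h15, h16] at h1
  linarith

end Distance

/-! ### Strict convexity and Hessians -/

section OneVariable

/-- A function on an interval is strictly convex if at every point it is supported from below by
a function with positive second derivative: otherwise the difference to a chord has an interior
maximum, and so has the difference of the support function to the chord. -/
lemma strictConvexOn_of_support {f : ℝ → ℝ} {a b : ℝ} (hf : ContinuousOn f (Icc a b))
    (hsupp : ∀ t ∈ Icc a b, ∃ h : ℝ → ℝ, ContDiffAt ℝ 2 h t ∧ (∀ᶠ s in 𝓝 t, h s ≤ f s) ∧
      h t = f t ∧ 0 < deriv (deriv h) t) :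
    StrictConvexOn ℝ (Icc a b) f := by
  refine LinearOrder.strictConvexOn_of_lt (convex_Icc a b) fun x hx y hy hxy c d hc hd hcd ↦ ?_
  set m := (f y - f x) / (y - x) with hm
  have hyx : 0 < y - x := sub_pos.mpr hxy
  have hm' : m * (y - x) = f y - f x := div_mul_cancel₀ _ hyx.ne'
  set g : ℝ → ℝ := fun s ↦ f s - (f x + m * (s - x)) with hg
  have hgx : g x = 0 := by simp [hg]
  have hgy : g y = 0 := by simp only [hg, hm']; ring
  set z := c • x + d • y with hz
  have hzx : z - x = d * (y - x) := by
    simp only [hz, smul_eq_mul]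
    have : c = 1 - d := by linarith
    rw [this]; ring
  have hzy : y - z = c * (y - x) := by
    simp only [hz, smul_eq_mul]
    have : d = 1 - c := by linarith
    rw [this]; ring
  have hzI : z ∈ Ioo x y := ⟨by nlinarith [mul_pos hd hyx], by nlinarith [mul_pos hc hyx]⟩
  have key : g z < 0 := by
    by_contra hge
    push Not at hge
    have hsub : Icc x y ⊆ Icc a b := Icc_subset_Icc hx.1 hy.2
    have hgc : ContinuousOn g (Icc x y) := (hf.mono hsub).sub (by fun_prop)
    obtain ⟨t₁, ht₁, hmax₁⟩ := isCompact_Icc.exists_isMaxOn (nonempty_Icc.mpr hxy.le) hgc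
    -- the maximum is attained at an interior point
    obtain ⟨t, ht, hmax⟩ : ∃ t ∈ Ioo x y, ∀ s ∈ Icc x y, g s ≤ g t := by
      by_cases hint : t₁ ∈ Ioo x y
      · exact ⟨t₁, hint, hmax₁⟩
      · have h0 : g t₁ = 0 := by
          rcases eq_or_lt_of_le ht₁.1 with h | h
          · rw [← h, hgx]
          · rcases eq_or_lt_of_le ht₁.2 with h' | h'
            · rw [h', hgy]
            · exact absurd ⟨h, h'⟩ hint
        exact ⟨z, hzI, fun s hs ↦ (hmax₁ hs).trans (h0.le.trans hge)⟩
    obtain ⟨h, hh, hle, heq, hpos⟩ := hsupp t (hsub (Ioo_subset_Icc_self ht))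
    set k : ℝ → ℝ := fun s ↦ h s - (f x + m * (s - x)) with hk
    have hkmax : IsLocalMax k t := by
      filter_upwards [hle, Ioo_mem_nhds ht.1 ht.2] with s hs hsI
      have h1 := hmax s (Ioo_subset_Icc_self hsI)
      simp only [hg, hk] at h1 ⊢
      linarith
    have hd1 : ∀ᶠ s in 𝓝 t, deriv k s = deriv h s - m := by
      filter_upwards [hh.eventually (by simp)] with s hs
      have h1 := (hs.differentiableAt (by simp)).hasDerivAt.sub
        ((((hasDerivAt_id s).sub_const x).const_mul m).const_add (f x))
      exact (h1.congr_deriv (by simp)).deriv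
    have hd2 : deriv (deriv k) t = deriv (deriv h) t := by
      rw [EventuallyEq.deriv_eq hd1, deriv_sub_const]
    have hkc : ContinuousAt k t := hh.continuousAt.sub (by fun_prop)
    have hkmin : IsLocalMin k t :=
      isLocalMin_of_deriv_deriv_pos (by rwa [hd2]) hkmax.deriv_eq_zero hkc
    have hconst : k =ᶠ[𝓝 t] fun _ ↦ k t := by
      filter_upwards [hkmax, hkmin] with s h1 h2 using le_antisymm h1 h2
    have h0 : deriv (deriv k) t = 0 := by
      rw [hconst.deriv.deriv_eq]
      simp
    linarith
  have h1 : c • f x + d • f y = f x + m * (z - x) := by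
    rw [hzx, mul_left_comm, hm']
    simp only [smul_eq_mul]
    have : c = 1 - d := by linarith
    rw [this]; ring
  rw [h1]
  simp only [hg] at key
  linarith

lemma deriv_deriv_exp_quartic (a₀ a₁ a₂ a₃ a₄ : ℝ) :
    HasDerivAt (fun e : ℝ ↦ Real.exp (a₀ + a₁ * e + a₂ * e ^ 2 + a₃ * e ^ 3 + a₄ * e ^ 4))
      (Real.exp a₀ * a₁) 0 ∧
    deriv (deriv fun e : ℝ ↦ Real.exp (a₀ + a₁ * e + a₂ * e ^ 2 + a₃ * e ^ 3 + a₄ * e ^ 4)) 0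
      = Real.exp a₀ * (a₁ ^ 2 + 2 * a₂) := by
  have hp : ∀ e : ℝ, HasDerivAt (fun e ↦ a₀ + a₁ * e + a₂ * e ^ 2 + a₃ * e ^ 3 + a₄ * e ^ 4)
      (a₁ + 2 * a₂ * e + 3 * a₃ * e ^ 2 + 4 * a₄ * e ^ 3) e := by
    intro e
    have h := ((((((hasDerivAt_id e).const_mul a₁).const_add a₀).add
      (((hasDerivAt_id e).pow 2).const_mul a₂)).add
      (((hasDerivAt_id e).pow 3).const_mul a₃)).add (((hasDerivAt_id e).pow 4).const_mul a₄))
    refine h.congr_deriv ?_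
    simp only [id_eq]
    push_cast
    ring
  have hq : HasDerivAt (fun e : ℝ ↦ a₁ + 2 * a₂ * e + 3 * a₃ * e ^ 2 + 4 * a₄ * e ^ 3)
      (2 * a₂) 0 := by
    have h := (((((hasDerivAt_id (0 : ℝ)).const_mul (2 * a₂)).const_add a₁).add
      (((hasDerivAt_id (0 : ℝ)).pow 2).const_mul (3 * a₃))).add
      (((hasDerivAt_id (0 : ℝ)).pow 3).const_mul (4 * a₄)))
    refine h.congr_deriv ?_
    simp
  refine ⟨by simpa using (hp 0).exp, ?_⟩
  have h1 : deriv (fun e : ℝ ↦ Real.exp (a₀ + a₁ * e + a₂ * e ^ 2 + a₃ * e ^ 3 + a₄ * e ^ 4))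
      = fun e ↦ Real.exp (a₀ + a₁ * e + a₂ * e ^ 2 + a₃ * e ^ 3 + a₄ * e ^ 4)
        * (a₁ + 2 * a₂ * e + 3 * a₃ * e ^ 2 + 4 * a₄ * e ^ 3) := by
    funext e
    exact (hp e).exp.deriv
  rw [h1]
  have h2 := ((hp 0).exp.mul hq).deriv
  refine h2.trans ?_
  simp
  ring

end OneVariable

section Support

variable {E : Type*} [NormedAddCommGroup E] [NormedSpace ℝ E] [FiniteDimensional ℝ E]
  {M : Type*} [MetricSpace M] [ChartedSpace E M] [IsManifold 𝓘(ℝ, E) ∞ M]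
  [RiemannianBundle (fun x : M ↦ TangentSpace 𝓘(ℝ, E) x)]
  [IsContMDiffRiemannianBundle 𝓘(ℝ, E) ∞ E (fun x : M ↦ TangentSpace 𝓘(ℝ, E) x)]

lemma hessian_eq {h : M → ℝ} {p : M}
    (hk : ContDiffAt ℝ 2 (h ∘ (extChartAt 𝓘(ℝ, E) p).symm) (extChartAt 𝓘(ℝ, E) p p))
    (v : TangentSpace 𝓘(ℝ, E) p) :
    hessian h p v v = fderiv ℝ (fderiv ℝ (h ∘ (extChartAt 𝓘(ℝ, E) p).symm))
        (extChartAt 𝓘(ℝ, E) p p) (coords p v) (coords p v)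
      - fderiv ℝ (h ∘ (extChartAt 𝓘(ℝ, E) p).symm) (extChartAt 𝓘(ℝ, E) p p)
        (chartΓ p (extChartAt 𝓘(ℝ, E) p p) (coords p v) (coords p v)) := by
  have h1 : ContDiffAt ℝ 1 (fderiv ℝ (h ∘ (extChartAt 𝓘(ℝ, E) p).symm))
      (extChartAt 𝓘(ℝ, E) p p) := hk.fderiv_right (by norm_num)
  have h2 := (h1.differentiableAt (by norm_num)).hasFDerivAt.clm_apply
    (hasFDerivAt_const (coords p v) (extChartAt 𝓘(ℝ, E) p p))
  rw [hessian, christoffel_eq p (mem_extChartAt_target p), h2.fderiv]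
  simp

/-- The second derivative of a function along a geodesic is given by the Hessian. -/
lemma IsGeodesicOn.deriv_deriv_comp {γ : ℝ → M} {s : Set ℝ} (hγ : IsGeodesicOn E γ s) {t : ℝ}
    (ht : t ∈ s) {h : M → ℝ} (hh : ContMDiffAt 𝓘(ℝ, E) 𝓘(ℝ, ℝ) 2 h (γ t)) :
    ContDiffAt ℝ 2 (h ∘ γ) t ∧ deriv (deriv (h ∘ γ)) t
      = hessian h (γ t) (mfderiv 𝓘(ℝ, ℝ) 𝓘(ℝ, E) γ t (1 : ℝ))
        (mfderiv 𝓘(ℝ, ℝ) 𝓘(ℝ, E) γ t (1 : ℝ)) := by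
  obtain ⟨hγt, -⟩ := hγ t ht
  have hgeo := hγ.chart_eq ht (mem_extChartAt_source (I := 𝓘(ℝ, E)) (γ t))
  set p := γ t with hp
  set φ := extChartAt 𝓘(ℝ, E) p with hφ
  set α := φ ∘ γ with hα
  set k := h ∘ φ.symm with hk
  have hαc : ContDiffAt ℝ 2 α t :=
    (contDiffAt_chart_comp (E := E) (n := ⊤) hγt (mem_extChartAt_source p)).of_le
      (by simpa using two_le_infty)
  have hkc : ContDiffAt ℝ 2 k (φ p) := by
    rw [← contMDiffAt_iff_contDiffAt]
    have h1 : ContMDiffAt 𝓘(ℝ, E) 𝓘(ℝ, E) 2 φ.symm (φ p) :=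
      ((contMDiffOn_extChartAt_symm (I := 𝓘(ℝ, E)) (n := ∞) p).contMDiffAt
        ((isOpen_chart_target p).mem_nhds (mem_extChartAt_target p))).of_le
        (by simpa using two_le_infty)
    refine ContMDiffAt.comp (φ p) ?_ h1
    rw [hφ, extChartAt_to_inv]
    exact hh
  have hev : h ∘ γ =ᶠ[𝓝 t] k ∘ α := by
    filter_upwards [symm_comp_chart_eventuallyEq (E := E) hγt.continuousAt
      (mem_extChartAt_source (γ t))] with r hr
    simp only [Function.comp_apply, hk, hα] at hr ⊢
    rw [hr]
  have hαt : α t = φ p := rfl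
  have hka : ContDiffAt ℝ 2 (k ∘ α) t := hkc.comp t hαc
  refine ⟨hka.congr_of_eventuallyEq hev, ?_⟩
  have hcoords : coords p (mfderiv 𝓘(ℝ, ℝ) 𝓘(ℝ, E) γ t (1 : ℝ)) = deriv α t := by
    have h1 : mfderiv 𝓘(ℝ, ℝ) 𝓘(ℝ, E) (φ ∘ γ) t
        = (mfderiv 𝓘(ℝ, E) 𝓘(ℝ, E) φ (γ t)).comp (mfderiv 𝓘(ℝ, ℝ) 𝓘(ℝ, E) γ t) :=
      mfderiv_comp t (mdifferentiableAt_extChartAt (I := 𝓘(ℝ, E)) (mem_chart_source E p))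
        (hγt.mdifferentiableAt (by simp))
    rw [mfderiv_eq_fderiv] at h1
    exact (DFunLike.congr_fun h1 (1 : ℝ)).symm
  rw [hessian_eq hkc, hcoords, hev.deriv.deriv_eq]
  have h1 : deriv (k ∘ α) =ᶠ[𝓝 t] fun r ↦ fderiv ℝ k (α r) (deriv α r) := by
    have h2 : ∀ᶠ y in 𝓝 (α t), ContDiffAt ℝ 2 k y := hkc.eventually (by simp)
    filter_upwards [hαc.eventually (by simp), hαc.continuousAt.eventually h2] with r hr hr'
    exact ((hr'.differentiableAt (by simp)).hasFDerivAt.comp_hasDerivAt r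
      (hr.differentiableAt (by simp)).hasDerivAt).deriv
  have h3 : HasDerivAt α (deriv α t) t := (hαc.differentiableAt (by simp)).hasDerivAt
  have h4 : HasDerivAt (deriv α) (deriv (deriv α) t) t := by
    have h5 : ContDiffAt ℝ 1 (fderiv ℝ α) t := hαc.fderiv_right (m := 1) (by norm_num)
    have h6 : ContDiffAt ℝ 1 (deriv α) t := h5.clm_apply contDiffAt_const
    exact (h6.differentiableAt (by simp)).hasDerivAt
  have h5 : HasFDerivAt (fderiv ℝ k) (fderiv ℝ (fderiv ℝ k) (φ p)) (α t) :=
    ((hkc.fderiv_right (m := 1) (by norm_num)).differentiableAt (by simp)).hasFDerivAt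
  have h6 := (h5.comp_hasDerivAt t h3).clm_apply h4
  rw [h1.deriv_eq]
  refine h6.deriv.trans ?_
  have h7 : deriv (deriv α) t = -chartΓ p (φ p) (deriv α t) (deriv α t) :=
    eq_neg_of_add_eq_zero_left hgeo
  rw [h7, map_neg, sub_eq_add_neg]
  rfl

end Support

/-! ### The support function -/

section SupportFunction

variable {E : Type*} [NormedAddCommGroup E] [NormedSpace ℝ E]

/-- First and second derivative at `y` of the exponential of a quadratic function of
`quadLog Γ y`. -/
lemma fderiv_exp_quadLog (Γ : E → E →L[ℝ] E →L[ℝ] E) (y u : E) (L : E →L[ℝ] ℝ)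
    (Q : E →L[ℝ] E →L[ℝ] ℝ) (a b c : ℝ) {k : E → ℝ}
    (hk : ∀ z, k z = Real.exp (a - (L (quadLog Γ y z) + (b * Q (quadLog Γ y z) (quadLog Γ y z)
      - c * L (quadLog Γ y z) ^ 2)))) :
    ContDiff ℝ ∞ k ∧ fderiv ℝ k y u = -(Real.exp a * L u) ∧
    fderiv ℝ (fderiv ℝ k) y u u
      = Real.exp a * (L u ^ 2 - L (Γ y u u) - 2 * b * Q u u + 2 * c * L u ^ 2) := by
  have hN : ContDiff ℝ ∞ (quadLog Γ y) := by unfold quadLog; fun_prop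
  have hkc : ContDiff ℝ ∞ k := by
    have h1 : ContDiff ℝ ∞ fun z ↦ L (quadLog Γ y z) := L.contDiff.comp hN
    have h2 : ContDiff ℝ ∞ fun z ↦ Q (quadLog Γ y z) (quadLog Γ y z) :=
      (Q.contDiff.comp hN).clm_apply hN
    rw [funext hk]
    exact (contDiff_const.sub (h1.add ((contDiff_const.mul h2).sub
      (contDiff_const.mul (h1.pow 2))))).exp
  set g := Γ y u u with hg
  have hline : (fun e : ℝ ↦ k (y + e • u)) = fun e : ℝ ↦ Real.exp (a + (-L u) * e
      + (-(L g / 2 + b * Q u u - c * L u ^ 2)) * e ^ 2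
      + (-(b * (Q u g + Q g u) / 2 - c * (L u * L g))) * e ^ 3
      + (-(b * Q g g / 4 - c * L g ^ 2 / 4)) * e ^ 4) := by
    funext e
    rw [hk]
    congr 1
    have h1 : quadLog Γ y (y + e • u) = e • u + (2⁻¹ * e ^ 2) • g := by
      simp only [quadLog, add_sub_cancel_left, map_smul, _root_.smul_apply, hg]
      module
    rw [h1]
    simp only [map_add, map_smul, _root_.add_apply, _root_.smul_apply, smul_eq_mul]
    ring
  obtain ⟨h1, h2⟩ := deriv_deriv_exp_quartic a (-L u) (-(L g / 2 + b * Q u u - c * L u ^ 2))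
    (-(b * (Q u g + Q g u) / 2 - c * (L u * L g))) (-(b * Q g g / 4 - c * L g ^ 2 / 4))
  rw [← hline] at h1 h2
  refine ⟨hkc, ?_, ?_⟩
  · have h3 : HasDerivAt (fun e : ℝ ↦ y + e • u) u 0 := by
      simpa using ((hasDerivAt_id (0 : ℝ)).smul_const u).const_add y
    have h4 : HasFDerivAt k (fderiv ℝ k y) (y + (0 : ℝ) • u) := by
      rw [zero_smul, add_zero]
      exact (hkc.differentiable (by simp) y).hasFDerivAt
    have h5 := h4.comp_hasDerivAt (f := fun e : ℝ ↦ y + e • u) (0 : ℝ) h3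
    rw [h5.unique h1]
    ring
  · rw [← fderiv_fderiv_apply_self (hkc.contDiffAt.of_le two_le_infty), h2]
    ring

variable [FiniteDimensional ℝ E]
  {M : Type*} [MetricSpace M] [ChartedSpace E M] [IsManifold 𝓘(ℝ, E) ∞ M]
  [RiemannianBundle (fun x : M ↦ TangentSpace 𝓘(ℝ, E) x)]
  [IsContMDiffRiemannianBundle 𝓘(ℝ, E) ∞ E (fun x : M ↦ TangentSpace 𝓘(ℝ, E) x)]
  [IsRiemannianManifold 𝓘(ℝ, E) M]

/-- The function `f` is supported by the exponential of minus the upper bound for the distance. The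
Hessian at `x` is `exp (π / 2 - ℓ)`, which is at least `1` by `ℓ ≤ π / 2`, times a form which up to
an arbitrarily small error is the sum of the square of the radial component and `ℓ` times the square
of the orthogonal one. -/
lemma GeodConvex.epsConvexAt [CompleteSpace M] (hdim : 2 ≤ Module.finrank ℝ E)
    (hsec : SecGE E M 1) {D : Set M} (hD : IsClosed D) (hconv : GeodConvex E D)
    (hbd : (frontier D).Nonempty) {f : M → ℝ}
    (hf : ∀ x, f x = Real.exp (Real.pi / 2 - Metric.infDist x (frontier D))) {x : M}
    (hx : x ∈ interior D) :
    EpsConvexAt E f (min 1 (Metric.infDist x (frontier D))) x := by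
  obtain ⟨γ, hγ, hγx⟩ := hconv.exists_isNormalRay hD hx hbd
  set ℓ := Metric.infDist x (frontier D) with hℓdef
  have hℓ := hγ.pos
  refine ⟨lt_min one_pos hℓ, fun η hη hηlt ↦ ?_⟩
  have hne := compl_nonempty_of_frontier hbd
  have hℓπ : ℓ ≤ Real.pi / 2 := hγ.le_pi_div_two hdim hsec hD hconv (by
    rw [hγx]; exact infDist_frontier_le E (interior_subset hx) hne)
  have h1I : (1 : ℝ) ∈ Icc (0 : ℝ) 1 := by simp
  set θ := (min 1 ℓ - η) / 4 with hθ
  have hθ0 : 0 < θ := by rw [hθ]; linarith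
  set y₀ := extChartAt 𝓘(ℝ, E) x x with hy₀
  set v := deriv (extChartAt 𝓘(ℝ, E) x ∘ γ) 1 with hv
  have hyt : y₀ ∈ (extChartAt 𝓘(ℝ, E) x).target := mem_extChartAt_target x
  have hxs : x ∈ (extChartAt 𝓘(ℝ, E) x).source := mem_extChartAt_source x
  have hLC := isLeviCivitaOn_chart (E := E) x
  have hGv : chartG x y₀ v v = ℓ ^ 2 := by
    rw [← hγ.speed 1 h1I, speed_sq_eq (E := E) (p := x)
      ((hγ.isGeodesicOn 1 h1I).1.of_le (by simp)) (by rw [hγx]; exact hxs), hγx]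
  set L : E →L[ℝ] ℝ := ℓ⁻¹ • chartG x y₀ v with hL
  have hLu : ∀ u, L u = chartG x y₀ v u / ℓ := fun u ↦ by
    simp only [hL, _root_.smul_apply, smul_eq_mul]; ring
  -- the Cauchy-Schwarz inequality for the unit vector `v / ℓ`
  have hCS : ∀ u, L u ^ 2 ≤ chartG x y₀ u u := fun u ↦ by
    have h1 := hLC.nonneg hyt (u - (chartG x y₀ v u / ℓ ^ 2) • v)
    simp only [map_sub, map_smul, _root_.sub_apply, _root_.smul_apply, smul_eq_mul, hGv,
      hLC.symm y₀ hyt u v] at h1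
    rw [hLu]
    have h2 : chartG x y₀ u u - chartG x y₀ v u / ℓ ^ 2 * chartG x y₀ v u
        - chartG x y₀ v u / ℓ ^ 2 * (chartG x y₀ v u - chartG x y₀ v u / ℓ ^ 2 * ℓ ^ 2)
        = chartG x y₀ u u - (chartG x y₀ v u / ℓ) ^ 2 := by field_simp; ring
    linarith
  set N := quadLog (chartΓ x) y₀ with hN
  set k : E → ℝ := fun y ↦ Real.exp ((Real.pi / 2 - ℓ) - (L (N y)
    + ((2 * θ - ℓ / 2) * chartG x y₀ (N y) (N y) - (θ - ℓ / 2) * L (N y) ^ 2))) with hk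
  have hder := fun u ↦ fderiv_exp_quadLog (chartΓ x) y₀ u L (chartG x y₀) (Real.pi / 2 - ℓ)
    (2 * θ - ℓ / 2) (θ - ℓ / 2) (k := k) fun _ ↦ rfl
  have hkc : ContDiff ℝ ∞ k := (hder 0).1
  have hupper := hγ.eventually_infDist_le hsec hD hconv hγx.symm hy₀ hv hθ0
  obtain ⟨V, hVsub, hVo, hyV⟩ := eventually_nhds_iff.mp hupper
  set O := (extChartAt 𝓘(ℝ, E) x).source ∩ extChartAt 𝓘(ℝ, E) x ⁻¹' V with hO
  have hOo : IsOpen O :=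
    (continuousOn_extChartAt x).isOpen_inter_preimage (isOpen_extChartAt_source x) hVo
  have hev : (k ∘ extChartAt 𝓘(ℝ, E) x) ∘ (extChartAt 𝓘(ℝ, E) x).symm =ᶠ[𝓝 y₀] k := by
    filter_upwards [(isOpen_chart_target x).mem_nhds hyt] with y hy
    simp only [Function.comp_apply]
    rw [(extChartAt 𝓘(ℝ, E) x).right_inv hy]
  refine ⟨O ∩ interior D, k ∘ extChartAt 𝓘(ℝ, E) x, ⟨hOo.inter isOpen_interior, ⟨⟨hxs, hyV⟩, hx⟩,
    ?_, ?_, ?_, fun u ↦ ?_⟩⟩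
  · refine ContMDiffOn.comp (t := univ) hkc.contMDiff.contMDiffOn
      ((contMDiffOn_extChartAt (I := 𝓘(ℝ, E)) (x := x)).mono ?_) (fun _ _ ↦ mem_univ _)
    intro z hz
    have := hz.1.1
    rwa [extChartAt_source] at this
  · intro z hz
    have h1 := hVsub _ hz.1.2
    rw [(extChartAt 𝓘(ℝ, E) x).left_inv hz.1.1] at h1
    have h2 := infDist_frontier_le E (interior_subset hz.2) hne
    rw [hf, Function.comp_apply, hk, Real.exp_le_exp]
    simp only [hLu, ← hN] at h1 ⊢
    linarith
  · have h0 : N y₀ = 0 := quadLog_self _ _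
    rw [hf, Function.comp_apply, hk, ← hy₀, ← hℓdef]
    simp only [h0, map_zero, mul_zero, ne_eq, OfNat.ofNat_ne_zero, not_false_eq_true, zero_pow,
      sub_zero, add_zero]
  · have hkh : ContDiffAt ℝ 2 ((k ∘ extChartAt 𝓘(ℝ, E) x) ∘ (extChartAt 𝓘(ℝ, E) x).symm) y₀ :=
      (hkc.contDiffAt.of_le two_le_infty).congr_of_eventuallyEq hev
    rw [hessian_eq hkh, ← hy₀, hev.fderiv.fderiv_eq, hev.fderiv_eq, (hder _).2.1, (hder _).2.2,
      ← chartG_coords_self, ← hy₀]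
    set c := coords x u with hc
    have h1 := hCS c
    have h2 : 0 ≤ chartG x y₀ c c := hLC.nonneg hyt c
    have h3 : 1 ≤ Real.exp (Real.pi / 2 - ℓ) := Real.one_le_exp (by linarith)
    have h4 : η * chartG x y₀ c c
        ≤ L c ^ 2 - 2 * (2 * θ - ℓ / 2) * chartG x y₀ c c + 2 * (θ - ℓ / 2) * L c ^ 2 := by
      have h5 : min 1 ℓ * L c ^ 2 ≤ 1 * L c ^ 2 := by
        gcongr
        exact min_le_left _ _
      have h6 : min 1 ℓ * (chartG x y₀ c c - L c ^ 2) ≤ ℓ * (chartG x y₀ c c - L c ^ 2) :=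
        mul_le_mul_of_nonneg_right (min_le_right _ _) (by linarith)
      have h7 : η = min 1 ℓ - 4 * θ := by rw [hθ]; ring
      have h8 : 0 ≤ θ * L c ^ 2 := by positivity
      rw [h7]
      linarith
    calc η * chartG x y₀ c c ≤ 1 * (η * chartG x y₀ c c) := by rw [one_mul]
      _ ≤ Real.exp (Real.pi / 2 - ℓ) * (η * chartG x y₀ c c) := by gcongr
      _ ≤ Real.exp (Real.pi / 2 - ℓ) * (L c ^ 2 - 2 * (2 * θ - ℓ / 2) * chartG x y₀ c c
          + 2 * (θ - ℓ / 2) * L c ^ 2) := by gcongr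
      _ = _ := by ring

lemma strictGeodConvexOn_of_epsConvexAt {U : Set M} {f : M → ℝ} (hf : Continuous f)
    (hsupp : ∀ x ∈ U, ∃ ε, EpsConvexAt E f ε x) : StrictGeodConvexOn E U f := by
  intro γ a b hab hγ hU hnc
  have hcont : ContinuousOn (f ∘ γ) (Icc a b) := fun t ht ↦
    hf.continuousAt.comp_continuousWithinAt (hγ t ht).1.continuousAt.continuousWithinAt
  refine strictConvexOn_of_support hcont fun t ht ↦ ?_
  obtain ⟨ε, hε, hs⟩ := hsupp (γ t) (hU t ht)
  obtain ⟨V, h, hh⟩ := hs (ε / 2) (by positivity) (by linarith)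
  have hV : V ∈ 𝓝 (γ t) := hh.isOpen.mem_nhds hh.mem
  have hγc : ContinuousAt γ t := (hγ t ht).1.continuousAt
  obtain ⟨h1, h2⟩ := hγ.deriv_deriv_comp ht
    ((hh.smooth.contMDiffAt hV).of_le (by simpa using two_le_infty))
  refine ⟨h ∘ γ, h1, ?_, hh.eq, ?_⟩
  · filter_upwards [hγc.preimage_mem_nhds hV] with s hs using hh.le _ hs
  · rw [h2]
    refine lt_of_lt_of_le ?_ (hh.hess _)
    -- a geodesic of zero speed is constant
    have hspeed : 0 < ‖mfderiv 𝓘(ℝ, ℝ) 𝓘(ℝ, E) γ t (1 : ℝ)‖ := by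
      refine lt_of_le_of_ne (norm_nonneg _) fun h0 ↦ ?_
      obtain ⟨s, hs, hne⟩ := hnc
      have h3 := (hγ.mono (Icc_subset_Icc_right hs.2)).dist_le hs.1
      rw [← hγ.speed_eq ht, ← h0, zero_mul] at h3
      exact hne (dist_le_zero.mp h3).symm
    positivity

end SupportFunction

end RiemConvex

end

theorem mainTheorem4
    {E : Type*} [NormedAddCommGroup E] [NormedSpace ℝ E] [FiniteDimensional ℝ E]
    (hdim : 2 ≤ Module.finrank ℝ E)
    {M : Type*} [MetricSpace M] [ChartedSpace E M] [IsManifold 𝓘(ℝ, E) ∞ M]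
    [RiemannianBundle (fun x : M ↦ TangentSpace 𝓘(ℝ, E) x)]
    [IsContMDiffRiemannianBundle 𝓘(ℝ, E) ∞ E (fun x : M ↦ TangentSpace 𝓘(ℝ, E) x)]
    [IsRiemannianManifold 𝓘(ℝ, E) M] [CompleteSpace M]
    (hsec : RiemConvex.SecGE E M 1)
    (D : Set M) (hclosed : IsClosed D) (hconvex : RiemConvex.GeodConvex E D)
    (hbd : (frontier D).Nonempty)
    (f : M → ℝ)
    (hf : ∀ x, f x = Real.exp (Real.pi / 2 - Metric.infDist x (frontier D))) :
    Continuous f ∧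
    RiemConvex.StrictGeodConvexOn E (interior D) f ∧
    ∀ x ∈ interior D, ∀ ℓ : ℝ, Metric.infDist x (frontier D) = ℓ →
      RiemConvex.EpsConvexAt E f (min 1 ℓ) x := by
  have hcont : Continuous f := by
    rw [funext hf]
    exact Real.continuous_exp.comp (continuous_const.sub (Metric.continuous_infDist_pt _))
  have heps : ∀ x ∈ interior D, RiemConvex.EpsConvexAt E f
      (min 1 (Metric.infDist x (frontier D))) x := fun x hx ↦
    hconvex.epsConvexAt hdim hsec hclosed hbd hf hx
  refine ⟨hcont, RiemConvex.strictGeodConvexOn_of_epsConvexAt hcont fun x hx ↦ ⟨_, heps x hx⟩, ?_⟩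
  rintro x hx ℓ rfl
  exact heps x hx
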